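/- Let $k$ be a field of characteristic zero and let $n$ be a positive integer. **Conventions.** A *Poisson bracket* on a commutative $k$-algebra $A$ is a $k$-bilinear Lie bracket $\{-,-\}$ that is a derivation in each variable. A *Poisson ideal* is an ideal $I$ with $\{A,I\}\subseteq I$; a *Poisson prime* is a prime ideal that is a Poisson ideal; the set $\operatorname{P.spec}A$ of Poisson primes carries the relative Zariski topology of $\operatorname{spec}A$. The *Poisson primitive* ideals are the Poisson cores of the maximal ideals, where the Poisson core of an ideal $J$ is the largest Poisson ideal contained in $J$. A Poisson prime $P$ is *Poisson rational* if the Poisson center $\{z : \{z,-\}=0\}$ of $\operatorname{Fract}(A/P)$, with the unique Poisson bracket extending the one induced on $A/P$, is algebraic over $k$. $A$ satisfies the *Poisson Dixmier–Moeglin equivalence* if the set of Poisson primitive ideals, the set of locally closed points of $\operatorname{P.spec}A$, and the set of Poisson rational Poisson primes coincide. An action of a torus $H=(k^\times)^r$ on $A$ by $k$-algebra automorphisms is *rational* if $A$ is generated as a $k$-algebra by $H$-eigenvectors whose eigenvalues are rational characters $h\mapsto h_1^{m_1}\cdots h_r^{m_r}$ ($m_i\in\mathbb Z$); it is a *rational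 Poisson action* if moreover $H$ preserves the bracket. **Claim.** In each of the cases (1)–(5) below there is exactly one Poisson bracket on the polynomial algebra $A$ with the stated values, the stated action of $H$ on $A$ is a rational Poisson action, $A$ has at most $2^N$ $H$-stable Poisson primes, where $N$ is the number of indeterminates of $A$, and $A$ satisfies the Poisson Dixmier–Moeglin equivalence. 1. (Semiclassical limits of quantum matrices; $N=n^2$.) $A=\mathcal O(M_n(k))=k[X_{ij}\mid 1\le i,j\le n]$; $\lambda\in k$ is nonzero, $(p_{ij})\in M_n(k)$ is antisymmetric, and $$\{X_{lm},X_{ij}\}=\begin{cases}(p_{li}+p_{jm})X_{ij}X_{lm}+\lambda X_{im}X_{lj}&(l>i,\ m>j)\\(\lambda+p_{li}+p_{jm})X_{ij}X_{lm}&(l>i,\ m\le j)\\p_{jm}X_{ij}X_{lm}&(l=i,\ m>j);\end{cases}$$ $H=(k^\times)^{2n}$ acts by $h.X_{ij}=h_ih_{n+j}X_{ij}$. 2. (The Poisson algebra $A^{P,Q}_{n,\Gamma}(k)$: semiclassical limits of quantum symplectic and even-dimensional euclidean spaces; $N=2n$.) $A=k[x_1,y_1,\dots,x_n,y_n]$;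 $\Gamma=(\gamma_{ij})\in M_n(k)$ is antisymmetric, $P=(p_1,\dots,p_n)$ and $Q=(q_1,\dots,q_n)$ lie in $k^n$ with $p_i\ne q_i$ for all $i$, and $$\begin{aligned}\{y_i,y_j\}&=\gamma_{ij}y_iy_j &&(\text{all } i,j)\\ \{x_i,y_j\}&=(p_j+\gamma_{ji})x_iy_j&&(i<j)\\ \{x_i,y_j\}&=(q_j+\gamma_{ji})x_iy_j&&(i>j)\\ \{x_i,x_j\}&=(q_i-p_j+\gamma_{ij})x_ix_j&&(i<j)\\ \{x_i,y_i\}&=q_ix_iy_i+\textstyle\sum_{\ell<i}(q_\ell-p_\ell)x_\ell y_\ell&&(\text{all } i);\end{aligned}$$ $H=(k^\times)^{n+1}$ acts by $h.x_i=h_ix_i$ and $h.y_i=h_1h_{n+1}h_i^{-1}y_i$. 3. (Odd-dimensional analogues; $N=2n+1$.) $A=k[z_0,x_1,y_1,\dots,x_n,y_n]$; $\Gamma,P,Q$ are as in (2), $\lambda\in k$ is arbitrary, $\{y_i,y_j\}$, $\{x_i,y_j\}$ for $i\neq j$, and $\{x_i,x_j\}$ for $i<j$ are as in (2), and, for all $i$,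 $$\{z_0,x_i\}=-\tfrac{p_i}{2}z_0x_i,\quad \{z_0,y_i\}=\tfrac{p_i}{2}z_0y_i,\quad \{x_i,y_i\}=q_ix_iy_i+\sum_{\ell<i}(q_\ell-p_\ell)x_\ell y_\ell+\lambda z_0^2;$$ $H=(k^\times)^{n+1}$ acts by $h.x_i=h_ix_i$, $h.z_0=h_{n+1}z_0$ and $h.y_i=h_{n+1}^2h_i^{-1}y_i$. 4. (Semiclassical limit of quantum symmetric matrices; $N=n(n+1)/2$.) $A=k[y_{ij}\mid 1\le i\le j\le n]$ with $y_{ji}=y_{ij}$, and for $i\le j$ and $l\le m$ $$\{y_{ij},y_{lm}\}=(\operatorname{sign}(l-j)+\operatorname{sign}(m-i))\,y_{il}y_{jm}+(\operatorname{sign}(l-i)+\operatorname{sign}(m-j))\,y_{im}y_{jl};$$ $H=(k^\times)^n$ acts by $h.y_{ij}=h_ih_jy_{ij}$. 5. (Semiclassical limit of quantum antisymmetric matrices; $N=n(n-1)/2$.) $A=k[y_{ij}\mid 1\le i<j\le n]$ with $y_{ji}=-y_{ij}$, $y_{ii}=0$, and for $i<j$ and $l<m$ $$\{y_{ij},y_{lm}\}=(\operatorname{sign}(l-j)+\operatorname{sign}(m-i))\,y_{il}y_{jm}-(\operatorname{sign}(l-i)+\operatorname{sign}(m-j))\,y_{im}y_{jl};$$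 $H=(k^\times)^n$ acts by $h.y_{ij}=h_ih_jy_{ij}$. Here $\operatorname{sign}(t)\in\{1,0,-1\}$ is the sign of the integer $t$. -/

import Mathlib

open MvPolynomial

noncomputable section

namespace PoissonDME

universe u v

/-! ### Poisson algebras -/

/-- A Poisson bracket on a commutative `k`-algebra `A`: a `k`-bilinear Lie bracket which is a
derivation in each variable (the derivation property in the first variable follows by
antisymmetry). -/
@[ext]
structure PoissonBracket (k : Type u) (A : Type v) [Field k] [CommRing A] [Algebra k A] where
  br : A →ₗ[k] A →ₗ[k] A
  self_eq_zero : ∀ a, br a a = 0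
  jacobi : ∀ a b c, br a (br b c) + br b (br c a) + br c (br a b) = 0
  leibniz : ∀ a b c, br a (b * c) = br a b * c + b * br a c

section General

variable {k : Type u} {A : Type v} [Field k] [CommRing A] [Algebra k A]

/-- Poisson ideals: `{A, I} ⊆ I`. -/
def IsPoissonIdeal (π : PoissonBracket k A) (I : Ideal A) : Prop :=
  ∀ a : A, ∀ b ∈ I, π.br a b ∈ I

/-- Poisson prime ideals. -/
def IsPoissonPrime (π : PoissonBracket k A) (I : Ideal A) : Prop :=
  I.IsPrime ∧ IsPoissonIdeal π I

/-- The Poisson prime spectrum, a subspace of the prime spectrum with the Zariski topology. -/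
abbrev PoissonSpectrum (π : PoissonBracket k A) : Type v :=
  {P : PrimeSpectrum A // IsPoissonIdeal π P.asIdeal}

/-- `C` is the Poisson core of `J`, that is, the largest Poisson ideal contained in `J`. -/
def IsPoissonCore (π : PoissonBracket k A) (J C : Ideal A) : Prop :=
  IsGreatest {I : Ideal A | IsPoissonIdeal π I ∧ I ≤ J} C

/-- Poisson primitive ideals: the Poisson cores of the maximal ideals. -/
def IsPoissonPrimitive (π : PoissonBracket k A) (I : Ideal A) : Prop :=
  ∃ M : Ideal A, M.IsMaximal ∧ IsPoissonCore π M I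

/-- The Poisson center `{z | {z, -} = 0}`. -/
def poissonCenter (π : PoissonBracket k A) : Set A :=
  {z | ∀ a, π.br z a = 0}

/-- `β` is the Poisson bracket on `Fract (A / P)` extending the bracket on `A / P` induced from
that of `A`. For a Poisson prime `P` there is exactly one such `β`. -/
def IsInducedOnFract (π : PoissonBracket k A) (P : Ideal A)
    (β : PoissonBracket k (FractionRing (A ⧸ P))) : Prop :=
  ∀ a b : A,
    β.br (algebraMap (A ⧸ P) (FractionRing (A ⧸ P)) (Ideal.Quotient.mk P a))
        (algebraMap (A ⧸ P) (FractionRing (A ⧸ P)) (Ideal.Quotient.mk P b)) =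
      algebraMap (A ⧸ P) (FractionRing (A ⧸ P)) (Ideal.Quotient.mk P (π.br a b))

/-- Poisson rational Poisson primes: the Poisson center of `Fract (A / P)`, with its induced
Poisson bracket, is algebraic over `k`. -/
def IsPoissonRational (π : PoissonBracket k A) (P : Ideal A) : Prop :=
  IsPoissonPrime π P ∧
    ∃ β : PoissonBracket k (FractionRing (A ⧸ P)), IsInducedOnFract π P β ∧
      ∀ z ∈ poissonCenter β, IsAlgebraic k z

/-- Ideals that are locally closed points of the Poisson prime spectrum. -/
def IsLocallyClosedPoint (π : PoissonBracket k A) (I : Ideal A) : Prop :=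
  ∃ P : PoissonSpectrum π, P.1.asIdeal = I ∧ IsLocallyClosed ({P} : Set (PoissonSpectrum π))

/-- The Poisson Dixmier-Moeglin equivalence: the sets of Poisson primitive ideals, of locally
closed points of the Poisson prime spectrum, and of Poisson rational Poisson primes coincide. -/
def PoissonDixmierMoeglin (π : PoissonBracket k A) : Prop :=
  {I | IsPoissonPrimitive π I} = {I | IsLocallyClosedPoint π I} ∧
    {I | IsLocallyClosedPoint π I} = {I | IsPoissonRational π I}

/-! ### Torus actions -/

/-- A torus `(kˣ)^r` acts rationally if `A` is generated, as a `k`-algebra, by eigenvectors whose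
eigenvalues are rational characters `h ↦ h₁ ^ m₁ ⋯ h_r ^ m_r`. -/
def IsRationalAction {r : ℕ} (ρ : (Fin r → kˣ) →* (A ≃ₐ[k] A)) : Prop :=
  Algebra.adjoin k {a : A | ∃ m : Fin r → ℤ, ∀ h : Fin r → kˣ,
    ρ h a = ((∏ i, h i ^ m i : kˣ) : k) • a} = ⊤

/-- A rational action by Poisson automorphisms. -/
def IsRationalPoissonAction {r : ℕ} (π : PoissonBracket k A)
    (ρ : (Fin r → kˣ) →* (A ≃ₐ[k] A)) : Prop :=
  IsRationalAction ρ ∧ ∀ h a b, ρ h (π.br a b) = π.br (ρ h a) (ρ h b)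

/-- The set of `H`-stable Poisson primes, for a group `H` acting on `A`. -/
def stablePoissonPrimes {H : Type*} [Group H] (π : PoissonBracket k A)
    (ρ : H →* (A ≃ₐ[k] A)) : Set (Ideal A) :=
  {P | IsPoissonPrime π P ∧ ∀ h, ∀ a ∈ P, ρ h a ∈ P}

end General

/-- The endomorphism `x_s ↦ c_s x_s` of a polynomial algebra. -/
def scaleHom {k : Type u} [Field k] {σ : Type*} (c : σ → kˣ) :
    MvPolynomial σ k →ₐ[k] MvPolynomial σ k :=
  aeval fun s => C (c s : k) * X s

theorem scaleHom_X {k : Type u} [Field k] {σ : Type*} (c : σ → kˣ) (s : σ) :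
    scaleHom c (X s) = C (c s : k) * X s :=
  aeval_X _ _

theorem scaleHom_one {k : Type u} [Field k] {σ : Type*} :
    scaleHom (1 : σ → kˣ) = AlgHom.id k (MvPolynomial σ k) := by
  ext1 s
  simp [scaleHom_X]

theorem scaleHom_mul {k : Type u} [Field k] {σ : Type*} (c d : σ → kˣ) :
    scaleHom (c * d) = (scaleHom c).comp (scaleHom d) := by
  ext1 s
  rw [AlgHom.comp_apply, scaleHom_X, scaleHom_X, map_mul, scaleHom_X, algHom_C, algebraMap_eq,
    Pi.mul_apply, Units.val_mul, C_mul]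
  ring

/-- The action of a group `H` on a polynomial algebra that rescales the variables:
`h . x_s = χ(h)_s x_s`. -/
def scalingAction {k : Type u} [Field k] {H σ : Type*} [Group H] (χ : H →* (σ → kˣ)) :
    H →* (MvPolynomial σ k ≃ₐ[k] MvPolynomial σ k) where
  toFun h := AlgEquiv.ofAlgHom (scaleHom (χ h)) (scaleHom (χ h⁻¹))
    (by rw [← scaleHom_mul, ← map_mul, mul_inv_cancel, map_one, scaleHom_one])
    (by rw [← scaleHom_mul, ← map_mul, inv_mul_cancel, map_one, scaleHom_one])
  map_one' := AlgEquiv.ext fun f => by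
    change scaleHom (χ 1) f = f
    rw [map_one, scaleHom_one, AlgHom.id_apply]
  map_mul' g h := AlgEquiv.ext fun f => by
    change scaleHom (χ (g * h)) f = scaleHom (χ g) (scaleHom (χ h) f)
    rw [map_mul, scaleHom_mul, AlgHom.comp_apply]

theorem scalingAction_X {k : Type u} [Field k] {H σ : Type*} [Group H] (χ : H →* (σ → kˣ))
    (h : H) (s : σ) : scalingAction χ h (X s) = C (χ h s : k) * X s :=
  scaleHom_X _ _

section Families

variable {k : Type u} [Field k]

/-! ### Quantum matrices -/

/-- `O(M_n(k)) = k[X_ij | i, j = 1, …, n]`. -/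
abbrev MatrixAlg (k : Type u) [Field k] (n : ℕ) : Type u := MvPolynomial (Fin n × Fin n) k

/-- The multiparameter Poisson bracket on `O(M_n(k))` with parameters `lam` and `p`. -/
structure IsMatrixBracket {n : ℕ} (lam : k) (p : Matrix (Fin n) (Fin n) k)
    (π : PoissonBracket k (MatrixAlg k n)) : Prop where
  gt_gt : ∀ l m i j : Fin n, i < l → j < m →
    π.br (X (l, m)) (X (i, j)) =
      C (p l i + p j m) * X (i, j) * X (l, m) + C lam * X (i, m) * X (l, j)
  gt_le : ∀ l m i j : Fin n, i < l → m ≤ j →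
    π.br (X (l, m)) (X (i, j)) = C (lam + p l i + p j m) * X (i, j) * X (l, m)
  eq_gt : ∀ l m i j : Fin n, l = i → j < m →
    π.br (X (l, m)) (X (i, j)) = C (p j m) * X (i, j) * X (l, m)

/-- `h . X_ij = h_i h_{n+j} X_ij` for `h ∈ (kˣ)^{2n}`. -/
def matrixAction (k : Type u) [Field k] (n : ℕ) :
    (Fin (n + n) → kˣ) →* (MatrixAlg k n ≃ₐ[k] MatrixAlg k n) :=
  scalingAction
    { toFun := fun h s => h (Fin.castAdd n s.1) * h (Fin.natAdd n s.2)
      map_one' := by ext; simp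
      map_mul' := fun g h => by
        funext s
        exact mul_mul_mul_comm _ _ _ _ }

/-! ### The Poisson algebras `A^{P,Q}_{n,Γ}` -/

/-- `k[x_1, y_1, …, x_n, y_n]`. -/
abbrev EvenAlg (k : Type u) [Field k] (n : ℕ) : Type u := MvPolynomial (Fin n ⊕ Fin n) k

namespace EvenAlg

/-- The variable `x_i`. -/
def x {n : ℕ} (i : Fin n) : EvenAlg k n := X (Sum.inl i)

/-- The variable `y_i`. -/
def y {n : ℕ} (i : Fin n) : EvenAlg k n := X (Sum.inr i)

end EvenAlg

open EvenAlg in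
/-- The Poisson bracket of `A^{P,Q}_{n,Γ}(k)`. -/
structure IsEvenBracket {n : ℕ} (γ : Matrix (Fin n) (Fin n) k) (p q : Fin n → k)
    (π : PoissonBracket k (EvenAlg k n)) : Prop where
  y_y : ∀ i j, π.br (y i) (y j) = C (γ i j) * y i * y j
  x_y_lt : ∀ i j, i < j → π.br (x i) (y j) = C (p j + γ j i) * x i * y j
  x_y_gt : ∀ i j, j < i → π.br (x i) (y j) = C (q j + γ j i) * x i * y j
  x_x : ∀ i j, i < j → π.br (x i) (x j) = C (q i - p j + γ i j) * x i * x j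
  x_y : ∀ i, π.br (x i) (y i) =
    C (q i) * x i * y i + (∑ l ∈ Finset.Iio i, C (q l - p l) * x l * y l)

/-- `h . x_i = h_i x_i` and `h . y_i = h_1 h_{n+1} h_i⁻¹ y_i` for `h ∈ (kˣ)^{n+1}`. -/
def evenAction (k : Type u) [Field k] (n : ℕ) :
    (Fin (n + 1) → kˣ) →* (EvenAlg k n ≃ₐ[k] EvenAlg k n) :=
  scalingAction
    { toFun := fun h => Sum.elim (fun i => h i.castSucc)
        (fun i => h 0 * h (Fin.last n) * (h i.castSucc)⁻¹)
      map_one' := by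
        funext s
        cases s <;> simp
      map_mul' := fun g h => by
        funext s
        cases s
        · rfl
        · simp only [Sum.elim_inr, Pi.mul_apply, mul_inv]
          ac_rfl }

/-! ### Odd-dimensional analogues -/

/-- `k[z_0, x_1, y_1, …, x_n, y_n]`. -/
abbrev OddAlg (k : Type u) [Field k] (n : ℕ) : Type u :=
  MvPolynomial (Option (Fin n ⊕ Fin n)) k

namespace OddAlg

/-- The variable `z_0`. -/
def z {n : ℕ} : OddAlg k n := X none

/-- The variable `x_i`. -/
def x {n : ℕ} (i : Fin n) : OddAlg k n := X (some (Sum.inl i))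

/-- The variable `y_i`. -/
def y {n : ℕ} (i : Fin n) : OddAlg k n := X (some (Sum.inr i))

end OddAlg

open OddAlg in
/-- The odd-dimensional analogue of the bracket of `A^{P,Q}_{n,Γ}(k)`, with one more
parameter `lam`. -/
structure IsOddBracket {n : ℕ} (γ : Matrix (Fin n) (Fin n) k) (p q : Fin n → k) (lam : k)
    (π : PoissonBracket k (OddAlg k n)) : Prop where
  z_x : ∀ i, π.br z (x i) = C (-(p i / 2)) * z * x i
  z_y : ∀ i, π.br z (y i) = C (p i / 2) * z * y i
  y_y : ∀ i j, π.br (y i) (y j) = C (γ i j) * y i * y j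
  x_y_lt : ∀ i j, i < j → π.br (x i) (y j) = C (p j + γ j i) * x i * y j
  x_y_gt : ∀ i j, j < i → π.br (x i) (y j) = C (q j + γ j i) * x i * y j
  x_x : ∀ i j, i < j → π.br (x i) (x j) = C (q i - p j + γ i j) * x i * x j
  x_y : ∀ i, π.br (x i) (y i) =
    C (q i) * x i * y i + (∑ l ∈ Finset.Iio i, C (q l - p l) * x l * y l) + C lam * z ^ 2

/-- `h . x_i = h_i x_i`, `h . z_0 = h_{n+1} z_0` and `h . y_i = h_{n+1}² h_i⁻¹ y_i` for
`h ∈ (kˣ)^{n+1}`. -/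
def oddAction (k : Type u) [Field k] (n : ℕ) :
    (Fin (n + 1) → kˣ) →* (OddAlg k n ≃ₐ[k] OddAlg k n) :=
  scalingAction
    { toFun := fun h s => s.elim (h (Fin.last n)) (Sum.elim (fun i => h i.castSucc)
        (fun i => h (Fin.last n) ^ 2 * (h i.castSucc)⁻¹))
      map_one' := by
        funext s
        rcases s with _ | s | s <;> simp
      map_mul' := fun g h => by
        funext s
        rcases s with _ | s | s
        · rfl
        · rfl
        · simp only [Option.elim_some, Sum.elim_inr, Pi.mul_apply, mul_inv, mul_pow]
          ac_rfl }

/-! ### Quantum symmetric and antisymmetric matrices -/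

/-- `sgn a b` is `sign (a - b)`. -/
def sgn {n : ℕ} (a b : Fin n) : ℤ := Int.sign ((a : ℤ) - (b : ℤ))

/-- `k[y_ij | 1 ≤ i ≤ j ≤ n]`. -/
abbrev SymMatAlg (k : Type u) [Field k] (n : ℕ) : Type u :=
  MvPolynomial {s : Fin n × Fin n // s.1 ≤ s.2} k

/-- The variable `y_ij` for `i ≤ j`, extended by `y_ji = y_ij`. -/
def SymMatAlg.y {n : ℕ} (i j : Fin n) : SymMatAlg k n :=
  if h : i ≤ j then X ⟨(i, j), h⟩ else X ⟨(j, i), (not_le.mp h).le⟩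

open SymMatAlg in
/-- The Poisson bracket on `k[y_ij | i ≤ j]`, the semiclassical limit of quantum symmetric
matrices. -/
def IsSymBracket {n : ℕ} (π : PoissonBracket k (SymMatAlg k n)) : Prop :=
  ∀ i j l m : Fin n, i ≤ j → l ≤ m →
    π.br (y i j) (y l m) =
      ((sgn l j + sgn m i : ℤ) : SymMatAlg k n) * y i l * y j m +
        ((sgn l i + sgn m j : ℤ) : SymMatAlg k n) * y i m * y j l

/-- `h . y_ij = h_i h_j y_ij` for `h ∈ (kˣ)^n`. -/
def symAction (k : Type u) [Field k] (n : ℕ) :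
    (Fin n → kˣ) →* (SymMatAlg k n ≃ₐ[k] SymMatAlg k n) :=
  scalingAction
    { toFun := fun h s => h s.1.1 * h s.1.2
      map_one' := by ext; simp
      map_mul' := fun g h => by
        funext s
        exact mul_mul_mul_comm _ _ _ _ }

/-- `k[y_ij | 1 ≤ i < j ≤ n]`. -/
abbrev AntisymMatAlg (k : Type u) [Field k] (n : ℕ) : Type u :=
  MvPolynomial {s : Fin n × Fin n // s.1 < s.2} k

/-- The variable `y_ij` for `i < j`, extended by `y_ji = - y_ij` and `y_ii = 0`. -/
def AntisymMatAlg.y {n : ℕ} (i j : Fin n) : AntisymMatAlg k n :=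
  if h : i < j then X ⟨(i, j), h⟩ else if h' : j < i then -X ⟨(j, i), h'⟩ else 0

open AntisymMatAlg in
/-- The Poisson bracket on `k[y_ij | i < j]`, the semiclassical limit of quantum antisymmetric
matrices. -/
def IsAntisymBracket {n : ℕ} (π : PoissonBracket k (AntisymMatAlg k n)) : Prop :=
  ∀ i j l m : Fin n, i < j → l < m →
    π.br (y i j) (y l m) =
      ((sgn l j + sgn m i : ℤ) : AntisymMatAlg k n) * y i l * y j m -
        ((sgn l i + sgn m j : ℤ) : AntisymMatAlg k n) * y i m * y j l

/-- `h . y_ij = h_i h_j y_ij` for `h ∈ (kˣ)^n`. -/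
def antisymAction (k : Type u) [Field k] (n : ℕ) :
    (Fin n → kˣ) →* (AntisymMatAlg k n ≃ₐ[k] AntisymMatAlg k n) :=
  scalingAction
    { toFun := fun h s => h s.1.1 * h s.1.2
      map_one' := by ext; simp
      map_mul' := fun g h => by
        funext s
        exact mul_mul_mul_comm _ _ _ _ }

end Families

end PoissonDME

end

/-!
Each of the five algebras is an iterated Poisson–Ore extension: adjoining the next variable `x` to
the algebra `B` of the previous ones, `{x, b} = η b * x + δ b` where the derivation `η` is the
action of an element of the Lie algebra of the torus, whose eigenvalue on `x` itself is nonzero.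
Over a given torus-stable Poisson prime of `B` there are therefore at most two such primes of
`B[x]`: if `x` satisfies an algebraic relation modulo the prime, then a Tschirnhaus shift of `x` is
a Poisson eigenvector which is algebraic over the coefficients, and the nonzero eigenvalue forces
it to vanish. Hence at most `2 ^ N` torus-stable Poisson primes exist.

Torus-stable means homogeneous for the grading by characters, and finiteness of the set of
homogeneous Poisson primes makes every rational Poisson prime `P` locally closed. Indeed some
`s ∉ P` lies in all homogeneous Poisson primes not contained in `P`, so if a Poisson prime `P'`
contains `P` but not `s`, then its homogeneous elements lie in `P`. Divide an element of `P'` by one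
of its homogeneous components outside `P`: induction on the number of components shows that the
quotient is Poisson central, hence algebraic over `k`, and so the element lies in `P`. That locally
closed implies primitive and primitive implies rational holds in every affine Poisson algebra.
-/

namespace PoissonDME

section Derivations

open Finset.HasAntidiagonal (antidiagonal mem_antidiagonal)

variable {R A : Type*} [CommRing R] [CommRing A] [Algebra R A]

theorem derivation_iterate_mul (D : Derivation R A A) (n : ℕ) (a b : A) :
    D^[n] (a * b) =
      ∑ ij ∈ antidiagonal n, n.choose ij.1 • (D^[ij.1] a * D^[ij.2] b) := by
  induction n with
  | zero => simp
  | succ n ih =>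
    rw [Finset.sum_antidiagonal_choose_succ_nsmul (fun i j => D^[i] a * D^[j] b) n]
    simp only [Function.iterate_succ_apply', ih, map_sum, map_nsmul, Derivation.leibniz,
      smul_eq_mul, smul_add, Finset.sum_add_distrib]
    refine congrArg _ (Finset.sum_congr rfl fun ⟨i, j⟩ hij => ?_)
    rw [n.choose_symm_of_eq_add (mem_antidiagonal.1 hij).symm, mul_comm]

/-- The largest `D`-stable ideal contained in `P`: the elements all of whose iterated derivatives
lie in `P`. -/
def derivationCore (D : Derivation R A A) (P : Ideal A) : Ideal A where
  carrier := {a | ∀ n, D^[n] a ∈ P}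
  add_mem' {a b} ha hb n := by
    rw [iterate_map_add]
    exact P.add_mem (ha n) (hb n)
  zero_mem' n := by
    rw [iterate_map_zero]
    exact P.zero_mem
  smul_mem' c a ha n := by
    rw [smul_eq_mul, derivation_iterate_mul]
    exact P.sum_mem fun ij _ => nsmul_mem (P.mul_mem_left _ (ha ij.2)) _

theorem derivationCore_le (D : Derivation R A A) (P : Ideal A) : derivationCore D P ≤ P :=
  fun _ ha => ha 0

theorem le_derivationCore {D : Derivation R A A} {I P : Ideal A} (hI : ∀ a ∈ I, D a ∈ I)
    (hIP : I ≤ P) : I ≤ derivationCore D P := fun a ha n => by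
  refine hIP ?_
  induction n with
  | zero => exact ha
  | succ n ih =>
    rw [Function.iterate_succ_apply']
    exact hI _ ih

theorem nsmul_mem_iff_of_charZero_quotient {P : Ideal A} [P.IsPrime] [CharZero (A ⧸ P)] {n : ℕ}
    (hn : n ≠ 0) {a : A} : n • a ∈ P ↔ a ∈ P := by
  simp [← Ideal.Quotient.eq_zero_iff_mem, hn]

/- If `m` and `n` are the least orders of iterated derivatives of `a` and `b` outside `P`, then
`(m + n).choose m • (D^[m] a * D^[n] b)` is the only term of the Leibniz expansion of
`D^[m + n] (a * b)` outside `P`. -/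
theorem derivationCore_isPrime (D : Derivation R A A) (P : Ideal A) [hP : P.IsPrime]
    [CharZero (A ⧸ P)] : (derivationCore D P).IsPrime := by
  classical
  refine ⟨ne_top_of_le_ne_top hP.ne_top (derivationCore_le D P), fun {a b} hab => ?_⟩
  by_contra! hne
  have ha : ∃ m, D^[m] a ∉ P := not_forall.1 hne.1
  have hb : ∃ n, D^[n] b ∉ P := not_forall.1 hne.2
  set m := Nat.find ha
  set n := Nat.find hb
  have hrest : ∀ ij ∈ (antidiagonal (m + n)).erase (m, n),
      (m + n).choose ij.1 • (D^[ij.1] a * D^[ij.2] b) ∈ P := by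
    rintro ⟨i, j⟩ hij
    obtain ⟨hne, hsum⟩ : ¬(i = m ∧ j = n) ∧ i + j = m + n := by simpa using hij
    rcases lt_or_ge i m with hi | hi
    · exact nsmul_mem (P.mul_mem_right _ (not_not.1 (Nat.find_min ha hi))) _
    · have hj : j < n := by omega
      exact nsmul_mem (P.mul_mem_left _ (not_not.1 (Nat.find_min hb hj))) _
  have hmain : (m + n).choose m • (D^[m] a * D^[n] b) ∈ P := by
    have hsum := hab (m + n)
    rwa [derivation_iterate_mul, ← Finset.add_sum_erase _ _ (a := (m, n)) (by simp),
      Submodule.add_mem_iff_left _ (P.sum_mem hrest)] at hsum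
  rw [nsmul_mem_iff_of_charZero_quotient (Nat.choose_pos (Nat.le_add_right m n)).ne'] at hmain
  exact (hP.mem_or_mem hmain).elim (Nat.find_spec ha) (Nat.find_spec hb)

theorem derivation_mem_of_mem_minimalPrimes (D : Derivation R A A) {I P : Ideal A}
    [CharZero (A ⧸ P)] (hI : ∀ a ∈ I, D a ∈ I) (hP : P ∈ I.minimalPrimes) {a : A} (ha : a ∈ P) :
    D a ∈ P := by
  have := hP.1.1
  exact hP.2 ⟨derivationCore_isPrime D P, le_derivationCore hI hP.1.2⟩ (derivationCore_le D P) ha 1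

end Derivations

section PoissonIdeals

variable {k : Type*} {A : Type*} [Field k] [CommRing A] [Algebra k A]

namespace PoissonBracket

variable (π : PoissonBracket k A)

theorem antisymm (a b : A) : π.br a b = -π.br b a := by
  have h := π.self_eq_zero (a + b)
  simp only [map_add, LinearMap.add_apply, π.self_eq_zero, zero_add, add_zero] at h
  exact eq_neg_of_add_eq_zero_right h

theorem leibniz_left (a b c : A) : π.br (a * b) c = π.br a c * b + a * π.br b c := by
  rw [π.antisymm, π.leibniz, π.antisymm a c, π.antisymm b c]
  ring

/-- The Hamiltonian derivation `{a, -}`. -/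
noncomputable def ad (a : A) : Derivation k A A :=
  Derivation.mk' (π.br a) fun b c => by
    rw [π.leibniz, smul_eq_mul, smul_eq_mul, add_comm, mul_comm c]

@[simp]
theorem ad_apply (a b : A) : π.ad a b = π.br a b :=
  rfl

end PoissonBracket

variable {π : PoissonBracket k A}

theorem IsPoissonIdeal.br_mem_left {I : Ideal A} (hI : IsPoissonIdeal π I) {a : A} (ha : a ∈ I)
    (b : A) : π.br a b ∈ I := by
  rw [π.antisymm]
  exact I.neg_mem (hI b a ha)

theorem isPoissonIdeal_sSup {S : Set (Ideal A)} (hS : ∀ I ∈ S, IsPoissonIdeal π I) :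
    IsPoissonIdeal π (sSup S) := by
  intro a b hb
  rw [sSup_eq_iSup'] at hb
  induction hb using Submodule.iSup_induction' with
  | mem I x hx => exact Submodule.mem_sSup_of_mem I.2 (hS I I.2 a x hx)
  | zero => simp
  | add x y _ _ hx hy =>
    rw [map_add]
    exact Ideal.add_mem _ hx hy

theorem exists_isPoissonCore (J : Ideal A) : ∃ C, IsPoissonCore π J C :=
  ⟨sSup {I | IsPoissonIdeal π I ∧ I ≤ J},
    ⟨isPoissonIdeal_sSup fun _ hI => hI.1, sSup_le fun _ hI => hI.2⟩,
    fun _ hI => le_sSup hI⟩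

theorem IsPoissonIdeal.of_mem_minimalPrimes [CharZero k] {I P : Ideal A}
    (hI : IsPoissonIdeal π I) (hP : P ∈ I.minimalPrimes) : IsPoissonIdeal π P := by
  have := hP.1.1
  have : CharZero (A ⧸ P) := charZero_of_injective_algebraMap (algebraMap k (A ⧸ P)).injective
  exact fun a b hb => derivation_mem_of_mem_minimalPrimes (π.ad a) (hI a) hP hb

theorem IsPoissonCore.isPrime [CharZero k] {J C : Ideal A} [J.IsPrime]
    (hC : IsPoissonCore π J C) : C.IsPrime := by
  obtain ⟨P, hP, hPJ⟩ := Ideal.exists_minimalPrimes_le hC.1.2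
  have hCP : C = P := le_antisymm hP.1.2 (hC.2 ⟨hC.1.1.of_mem_minimalPrimes hP, hPJ⟩)
  exact hCP ▸ hP.1.1

theorem isLocallyClosedPoint_iff {P : Ideal A} :
    IsLocallyClosedPoint π P ↔ IsPoissonPrime π P ∧
      ∃ s ∉ P, ∀ P', IsPoissonPrime π P' → P ≤ P' → s ∉ P' → P' = P := by
  constructor
  · rintro ⟨⟨Q, hQ⟩, rfl, _, _, ⟨U, hU, rfl⟩, hclosed, hUZ⟩
    obtain ⟨Z, hZ, rfl⟩ := isClosed_induced_iff.1 hclosed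
    have hmem : ∀ Q' : PoissonSpectrum π, Q' = ⟨Q, hQ⟩ ↔ Q'.1 ∈ U ∧ Q'.1 ∈ Z := fun Q' =>
      Set.ext_iff.1 hUZ Q'
    obtain ⟨hQU, hQZ⟩ := (hmem _).1 rfl
    obtain ⟨_, ⟨s, rfl⟩, hsQ, hsU⟩ :=
      PrimeSpectrum.isTopologicalBasis_basic_opens.exists_subset_of_mem_open hQU hU
    refine ⟨⟨Q.2, hQ⟩, s, hsQ, fun P' hP' hle hsP' => ?_⟩
    have hspec : Q ⤳ ⟨P', hP'.1⟩ := (PrimeSpectrum.le_iff_specializes _ _).1 hle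
    exact congrArg (fun Q' => Q'.1.asIdeal)
      ((hmem ⟨⟨P', hP'.1⟩, hP'.2⟩).2 ⟨hsU hsP', hspec.mem_closed hZ hQZ⟩)
  · rintro ⟨hP, s, hsP, hs⟩
    refine ⟨⟨⟨P, hP.1⟩, hP.2⟩, rfl, Subtype.val ⁻¹' (PrimeSpectrum.basicOpen s : Set _),
      Subtype.val ⁻¹' PrimeSpectrum.zeroLocus (P : Set A),
      (PrimeSpectrum.basicOpen s).isOpen.preimage continuous_subtype_val,
      (PrimeSpectrum.isClosed_zeroLocus _).preimage continuous_subtype_val, ?_⟩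
    ext Q
    constructor
    · rintro rfl
      exact ⟨hsP, fun _ h => h⟩
    · rintro ⟨hsQ, hPQ⟩
      exact Subtype.ext (PrimeSpectrum.ext (hs _ ⟨Q.1.2, Q.2⟩ hPQ hsQ))

theorem IsLocallyClosedPoint.isPoissonPrimitive [CharZero k] [IsJacobsonRing A] {P : Ideal A}
    (h : IsLocallyClosedPoint π P) : IsPoissonPrimitive π P := by
  obtain ⟨hP, s, hsP, hs⟩ := isLocallyClosedPoint_iff.1 h
  obtain ⟨M, hPM, hM, hsM⟩ : ∃ M, P ≤ M ∧ M.IsMaximal ∧ s ∉ M := by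
    rw [← isJacobsonRing_iff_prime_eq.1 ‹_› P hP.1, Ideal.jacobson, Submodule.mem_sInf] at hsP
    simpa [and_assoc] using hsP
  have := hM.isPrime
  obtain ⟨C, hC⟩ := exists_isPoissonCore (π := π) M
  have hCP : C = P :=
    hs C ⟨hC.isPrime, hC.1.1⟩ (hC.2 ⟨hP.2, hPM⟩) fun hsC => hsM (hC.1.2 hsC)
  exact ⟨M, hM, hCP ▸ hC⟩

end PoissonIdeals

section BracketsOfDerivations

variable {k A : Type*} [Field k] [CommRing A] [Algebra k A]

/-- A derivation of `A` which vanishes on `S` is zero. Brackets are compared, and the Lie algebra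
axioms checked, on such a set: the variables of a polynomial algebra, or a domain inside its
fraction field. -/
def DeterminesDerivations (k : Type*) {A : Type*} [Field k] [CommRing A] [Algebra k A]
    (S : Set A) : Prop :=
  ∀ D : Derivation k A A, (∀ s ∈ S, D s = 0) → D = 0

namespace DeterminesDerivations

variable {S : Set A} (hS : DeterminesDerivations k S)

include hS

theorem derivation_ext {D D' : Derivation k A A} (h : ∀ s ∈ S, D s = D' s) : D = D' :=
  sub_eq_zero.1 (hS _ fun s hs => by rw [Derivation.sub_apply, h s hs, sub_self])

theorem poissonBracket_ext {π π' : PoissonBracket k A}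
    (h : ∀ s ∈ S, ∀ t ∈ S, π.br s t = π'.br s t) : π = π' := by
  have hleft : ∀ s ∈ S, π.ad s = π'.ad s := fun s hs => hS.derivation_ext (h s hs)
  have had : ∀ a, π.ad a = π'.ad a := fun a => hS.derivation_ext fun s hs => by
    rw [π.ad_apply, π.antisymm, ← π.ad_apply, hleft s hs, π'.ad_apply, π'.antisymm, neg_neg,
      π'.ad_apply]
  exact PoissonBracket.ext (LinearMap.ext₂ fun a b => DFunLike.congr_fun (had a) b)

end DeterminesDerivations

/-- Evaluation of derivations at `a`. -/
def derivationEval (k : Type*) {A : Type*} [Field k] [CommRing A] [Algebra k A] (a : A) :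
    Derivation k A A →ₗ[A] A where
  toFun D := D a
  map_add' _ _ := rfl
  map_smul' _ _ := rfl

variable {S : Set A}

theorem biderivation_antisymm (hS : DeterminesDerivations k S)
    (D : Derivation k A (Derivation k A A)) (h : ∀ s ∈ S, ∀ t ∈ S, D s t = -D t s) (a b : A) :
    D a b = -D b a := by
  have hleft : ∀ s ∈ S, D s = -(derivationEval k s).compDer D := fun s hs =>
    hS.derivation_ext fun t ht => h s hs t ht
  have had : D a = -(derivationEval k a).compDer D := hS.derivation_ext fun s hs =>
    eq_neg_of_add_eq_zero_right (eq_neg_iff_add_eq_zero.1 (DFunLike.congr_fun (hleft s hs) a))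
  exact DFunLike.congr_fun had b

/- By antisymmetry the Jacobi sum of `a`, `b`, `c` is the value at `c` of the derivation
`⁅D a, D b⁆ - D (D a b)`, and it is invariant under cyclic permutations. -/
theorem biderivation_jacobi (hS : DeterminesDerivations k S)
    (D : Derivation k A (Derivation k A A)) (hanti : ∀ a b, D a b = -D b a)
    (h : ∀ s ∈ S, ∀ t ∈ S, ∀ u ∈ S, D s (D t u) + D t (D u s) + D u (D s t) = 0) (a b c : A) :
    D a (D b c) + D b (D c a) + D c (D a b) = 0 := by
  have hextend : ∀ a b, (∀ s ∈ S, D a (D b s) + D b (D s a) + D s (D a b) = 0) →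
      ∀ c, D a (D b c) + D b (D c a) + D c (D a b) = 0 := by
    intro a b hab c
    have heq : ∀ c, (⁅D a, D b⁆ - D (D a b)) c = D a (D b c) + D b (D c a) + D c (D a b) := by
      intro c
      rw [Derivation.sub_apply, Derivation.commutator_apply, hanti c a, hanti c (D a b), map_neg]
      ring
    rw [← heq, hS _ fun s hs => (heq s).trans (hab s hs), Derivation.zero_apply]
  have hrot : ∀ a b c, D b (D c a) + D c (D a b) + D a (D b c) = 0 →
      D a (D b c) + D b (D c a) + D c (D a b) = 0 := fun a b c habc => by
    rwa [← add_rotate] at habc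
  exact hextend a b (fun s hs => hrot _ _ _ <| hrot _ _ _ <| hextend s a (fun t ht =>
    hrot _ _ _ <| hrot _ _ _ <| hextend t s (h t ht s hs) a) b) c

theorem exists_poissonBracket_of_derivation [NeZero (2 : k)] (hS : DeterminesDerivations k S)
    (D : Derivation k A (Derivation k A A)) (hanti : ∀ s ∈ S, ∀ t ∈ S, D s t = -D t s)
    (hjac : ∀ s ∈ S, ∀ t ∈ S, ∀ u ∈ S, D s (D t u) + D t (D u s) + D u (D s t) = 0) :
    ∃ π : PoissonBracket k A, ∀ a b, π.br a b = D a b := by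
  have hanti := biderivation_antisymm hS D hanti
  refine ⟨{ br := LinearMap.mk₂ k (fun a b => D a b) (by simp) (by simp) (by simp) (by simp)
            self_eq_zero a := ?_
            jacobi := biderivation_jacobi hS D hanti hjac
            leibniz a b c := ?_ }, fun _ _ => rfl⟩
  · have h : (2 : k) • D a a = 0 := by
      rw [two_smul]
      exact add_eq_zero_iff_eq_neg.2 (hanti a a)
    exact (smul_eq_zero.1 h).resolve_left two_ne_zero
  · simp only [LinearMap.mk₂_apply, Derivation.leibniz, smul_eq_mul]
    ring

end BracketsOfDerivations

section PolynomialBrackets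

variable {k σ : Type*} [Field k]

theorem determinesDerivations_range_X :
    DeterminesDerivations k (Set.range (X : σ → MvPolynomial σ k)) :=
  fun _ hD => derivation_ext fun s => hD _ ⟨s, rfl⟩

theorem poissonBracket_ext_X {π π' : PoissonBracket k (MvPolynomial σ k)}
    (h : ∀ s t, π.br (X s) (X t) = π'.br (X s) (X t)) : π = π' :=
  determinesDerivations_range_X.poissonBracket_ext <| by
    rintro _ ⟨s, rfl⟩ _ ⟨t, rfl⟩
    exact h s t

theorem exists_poissonBracket_X [NeZero (2 : k)] (c : σ → σ → MvPolynomial σ k)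
    (hanti : ∀ s t, c s t = -c t s)
    (hjac : ∀ s t u, mkDerivation k (c s) (c t u) + mkDerivation k (c t) (c u s) +
      mkDerivation k (c u) (c s t) = 0) :
    ∃ π : PoissonBracket k (MvPolynomial σ k), ∀ s t, π.br (X s) (X t) = c s t := by
  obtain ⟨π, hπ⟩ := exists_poissonBracket_of_derivation (k := k) determinesDerivations_range_X
    (mkDerivation k fun s => mkDerivation k (c s))
    (by
      rintro _ ⟨s, rfl⟩ _ ⟨t, rfl⟩
      simp only [mkDerivation_X]
      exact hanti s t)
    (by
      rintro _ ⟨s, rfl⟩ _ ⟨t, rfl⟩ _ ⟨u, rfl⟩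
      simp only [mkDerivation_X]
      exact hjac s t u)
  exact ⟨π, fun s t => by rw [hπ, mkDerivation_X, mkDerivation_X]⟩

end PolynomialBrackets

section FractionFields

variable {k A K : Type*} [Field k] [CommRing A] [Field K] [Algebra A K] [Algebra k K]

theorem determinesDerivations_range_algebraMap [IsFractionRing A K] :
    DeterminesDerivations k (Set.range (algebraMap A K)) := by
  refine fun D hD => Derivation.ext fun z => ?_
  obtain ⟨a, b, -, rfl⟩ := IsFractionRing.div_surjective (A := A) z
  rw [Derivation.leibniz_div, hD _ ⟨a, rfl⟩, hD _ ⟨b, rfl⟩]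
  simp only [smul_zero, sub_zero, Derivation.zero_apply]

variable [Algebra k A] [IsScalarTower k A K]

theorem exists_derivation_extension [Algebra.FormallyEtale A K] {M : Type*} [AddCommGroup M]
    [Module k M] [Module A M] [Module K M] [IsScalarTower k A M] [IsScalarTower k K M]
    [IsScalarTower A K M] (d : Derivation k A M) :
    ∃ D : Derivation k K M, ∀ a, D (algebraMap A K a) = d a := by
  let e := KaehlerDifferential.tensorKaehlerEquivOfFormallyEtale k A K
  let f : TensorProduct A K (Ω[A⁄k]) →ₗ[K] M := d.liftKaehlerDifferential.liftBaseChange K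
  refine ⟨(f ∘ₗ e.symm.toLinearMap).compDer (KaehlerDifferential.D k K), fun a => ?_⟩
  change f (e.symm (KaehlerDifferential.D k K (algebraMap A K a))) = d a
  rw [KaehlerDifferential.tensorKaehlerEquivOfFormallyEtale_symm_D_algebraMap,
    LinearMap.liftBaseChange_tmul, one_smul, Derivation.liftKaehlerDifferential_comp_D]

theorem exists_poissonBracket_fractionRing [NeZero (2 : k)] [IsFractionRing A K]
    (π : PoissonBracket k A) :
    ∃ β : PoissonBracket k K, ∀ a b, β.br (algebraMap A K a) (algebraMap A K b) =
      algebraMap A K (π.br a b) := by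
  have := Algebra.FormallyEtale.of_isLocalization (Rₘ := K) (nonZeroDivisors A)
  have hS : DeterminesDerivations k (Set.range (algebraMap A K)) :=
    determinesDerivations_range_algebraMap
  have had : ∀ a, ∃ D : Derivation k K K, ∀ b, D (algebraMap A K b) = algebraMap A K (π.br a b) :=
    fun a => exists_derivation_extension ((Algebra.linearMap A K).compDer (π.ad a))
  choose ad had using had
  have hext : ∀ D D' : Derivation k K K,
      (∀ a, D (algebraMap A K a) = D' (algebraMap A K a)) → D = D' := fun D D' h =>
    hS.derivation_ext (by rintro _ ⟨a, rfl⟩; exact h a)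
  let adDer : Derivation k A (Derivation k K K) := Derivation.mk'
    { toFun := ad
      map_add' a b := hext _ _ fun c => by simp [had]
      map_smul' r a := hext _ _ fun c => by
        rw [had, map_smul, LinearMap.smul_apply, Derivation.smul_apply, had]
        exact (Algebra.linearMap A K).map_smul_of_tower r _ }
    fun a b => hext _ _ fun c => by
      simp only [LinearMap.coe_mk, AddHom.coe_mk, Derivation.add_apply, Derivation.smul_apply, had,
        π.leibniz_left, map_add, map_mul, Algebra.smul_def]
      ring
  obtain ⟨D, hD⟩ := exists_derivation_extension (K := K) adDer
  have hD' : ∀ a b, D (algebraMap A K a) (algebraMap A K b) = algebraMap A K (π.br a b) :=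
    fun a b => by
      rw [hD]
      exact had a b
  obtain ⟨β, hβ⟩ := exists_poissonBracket_of_derivation hS D
    (by
      rintro _ ⟨a, rfl⟩ _ ⟨b, rfl⟩
      rw [hD', hD', π.antisymm, map_neg])
    (by
      rintro _ ⟨a, rfl⟩ _ ⟨b, rfl⟩ _ ⟨c, rfl⟩
      simp only [hD', ← map_add, π.jacobi, map_zero])
  exact ⟨β, fun a b => by rw [hβ, hD']⟩

end FractionFields

section QuotientBrackets

variable {k A : Type*} [Field k] [CommRing A] [Algebra k A] {π : PoissonBracket k A}

theorem IsPoissonIdeal.exists_quotient_bracket {I : Ideal A} (hI : IsPoissonIdeal π I) :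
    ∃ π' : PoissonBracket k (A ⧸ I), ∀ a b : A,
      π'.br (Ideal.Quotient.mk I a) (Ideal.Quotient.mk I b) = Ideal.Quotient.mk I (π.br a b) := by
  let I' : Submodule k A := I.restrictScalars k
  let ad : A →ₗ[k] A ⧸ I →ₗ[k] A ⧸ I :=
    { toFun a := I'.mapQ I' (π.br a) (hI a)
      map_add' a b := I'.linearMap_qext <| LinearMap.ext fun c =>
        congrArg I'.mkQ (π.br.map_add₂ a b c)
      map_smul' r a := I'.linearMap_qext <| LinearMap.ext fun c =>
        congrArg I'.mkQ (π.br.map_smul₂ r a c) }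
  let br : A ⧸ I →ₗ[k] A ⧸ I →ₗ[k] A ⧸ I := I'.liftQ ad fun a ha =>
    I'.linearMap_qext (LinearMap.ext fun b => (Submodule.Quotient.mk_eq_zero I').2
      (hI.br_mem_left ha b))
  have hbr : ∀ a b, br (Ideal.Quotient.mk I a) (Ideal.Quotient.mk I b) =
      Ideal.Quotient.mk I (π.br a b) := fun _ _ => rfl
  refine ⟨{ br := br, self_eq_zero := ?_, jacobi := ?_, leibniz := ?_ }, hbr⟩
  · refine Ideal.Quotient.mk_surjective.forall.2 fun a => ?_
    rw [hbr, π.self_eq_zero, map_zero]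
  · refine Ideal.Quotient.mk_surjective.forall₃.2 fun a b c => ?_
    simp only [hbr, ← map_add, π.jacobi, map_zero]
  · refine Ideal.Quotient.mk_surjective.forall₃.2 fun a b c => ?_
    simp only [hbr, ← map_mul, ← map_add, π.leibniz]

theorem IsPoissonIdeal.exists_isInducedOnFract [NeZero (2 : k)] {P : Ideal A} [P.IsPrime]
    (hP : IsPoissonIdeal π P) :
    ∃ β : PoissonBracket k (FractionRing (A ⧸ P)), IsInducedOnFract π P β := by
  obtain ⟨π', hπ'⟩ := hP.exists_quotient_bracket
  obtain ⟨β, hβ⟩ := exists_poissonBracket_fractionRing (K := FractionRing (A ⧸ P)) π'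
  exact ⟨β, fun a b => by rw [hβ, hπ']⟩

end QuotientBrackets

section PoissonCenter

variable {k K : Type*} [Field k] [Field K] [Algebra k K] {β : PoissonBracket k K} {z : K}

theorem inv_mem_poissonCenter (hz : z ∈ poissonCenter β) : z⁻¹ ∈ poissonCenter β := by
  intro b
  have hbz : β.ad b z = 0 := by rw [β.ad_apply, β.antisymm, hz, neg_zero]
  rw [β.antisymm, ← β.ad_apply, Derivation.leibniz_inv, hbz, smul_zero, neg_zero]

theorem aeval_mem_poissonCenter {B : Type*} [CommRing B] [Algebra k B] {β : PoissonBracket k B}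
    {z : B} (hz : z ∈ poissonCenter β) (p : Polynomial k) : p.aeval z ∈ poissonCenter β := by
  intro b
  rw [β.antisymm, ← β.ad_apply, Derivation.map_aeval, β.ad_apply, β.antisymm b z, hz b, neg_zero,
    smul_zero, neg_zero]

end PoissonCenter

section PoissonRational

variable {k A : Type*} [Field k] [CommRing A] [Algebra k A]

/-- The value `b ^ n * p (a / b)`, for `n` the degree of `p`, of the homogenization of `p`. -/
def homogenizedEval (p : Polynomial k) (a b : A) : A :=
  ∑ i ∈ Finset.range (p.natDegree + 1), p.coeff i • (a ^ i * b ^ (p.natDegree - i))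

theorem map_homogenizedEval {B : Type*} [CommRing B] [Algebra k B] (φ : A →ₐ[k] B) {a b : A} {z : B}
    (h : φ b * z = φ a) (p : Polynomial k) :
    φ (homogenizedEval p a b) = φ b ^ p.natDegree * p.aeval z := by
  rw [homogenizedEval, Polynomial.aeval_eq_sum_range, Finset.mul_sum, map_sum]
  refine Finset.sum_congr rfl fun i hi => ?_
  have hpow : φ b ^ p.natDegree = φ b ^ i * φ b ^ (p.natDegree - i) := by
    rw [← pow_add, Nat.add_sub_cancel' (Finset.mem_range_succ_iff.1 hi)]
  rw [map_smul, map_mul, map_pow, map_pow, ← h, mul_pow, mul_smul_comm, hpow]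
  ring_nf

/-- The canonical map from `A` to the fraction field of `A / P`. -/
def toFract (k : Type*) {A : Type*} [Field k] [CommRing A] [Algebra k A] (P : Ideal A) [P.IsPrime] :
    A →ₐ[k] FractionRing (A ⧸ P) :=
  (IsScalarTower.toAlgHom k (A ⧸ P) (FractionRing (A ⧸ P))).comp (Ideal.Quotient.mkₐ k P)

theorem toFract_eq_zero_iff (P : Ideal A) [P.IsPrime] {a : A} : toFract k P a = 0 ↔ a ∈ P :=
  (map_eq_zero_iff (algebraMap (A ⧸ P) (FractionRing (A ⧸ P)))
    (IsFractionRing.injective _ _)).trans Ideal.Quotient.eq_zero_iff_mem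

theorem exists_toFract_mul_eq (P : Ideal A) [P.IsPrime] (z : FractionRing (A ⧸ P)) :
    ∃ b ∉ P, ∃ a, toFract k P b * z = toFract k P a := by
  obtain ⟨a, b, hb, rfl⟩ := IsFractionRing.div_surjective (A := A ⧸ P) z
  have hb' : algebraMap (A ⧸ P) (FractionRing (A ⧸ P)) b ≠ 0 :=
    IsFractionRing.to_map_ne_zero_of_mem_nonZeroDivisors hb
  obtain ⟨a, rfl⟩ := Ideal.Quotient.mk_surjective a
  obtain ⟨b, rfl⟩ := Ideal.Quotient.mk_surjective b
  exact ⟨b, fun h => hb' ((toFract_eq_zero_iff (k := k) P).2 h), a, mul_div_cancel₀ _ hb'⟩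

/- If `p` is a nonzero polynomial with nonzero constant term which annihilates `a / g`, then
`g ^ n * p (a / g)` lies in `P`, hence in `P'`, and there it is congruent to `g ^ n * p 0`. -/
theorem mem_of_isAlgebraic_div {P P' : Ideal A} [P.IsPrime] [P'.IsPrime] (hle : P ≤ P') {a g : A}
    (ha : a ∈ P') (hg : g ∉ P') {z : FractionRing (A ⧸ P)}
    (hz : toFract k P g * z = toFract k P a) (halg : IsAlgebraic k z) : a ∈ P := by
  by_contra haP
  have hz0 : z ≠ 0 := by
    rintro rfl
    exact haP ((toFract_eq_zero_iff P).1 (by rw [← hz, mul_zero]))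
  obtain ⟨p, hp0, hpz⟩ := halg.exists_nonzero_coeff_and_aeval_eq_zero
    (mem_nonZeroDivisors_of_ne_zero hz0)
  have hmem : homogenizedEval p a g ∈ P := by
    rw [← toFract_eq_zero_iff (k := k), map_homogenizedEval _ hz, hpz, mul_zero]
  have ha0 : toFract k P' g * 0 = toFract k P' a := by
    rw [mul_zero, (toFract_eq_zero_iff P').2 ha]
  have hmem' := (toFract_eq_zero_iff (k := k) P').2 (hle hmem)
  rw [map_homogenizedEval _ ha0, ← Polynomial.coeff_zero_eq_aeval_zero'] at hmem'
  exact mul_ne_zero (pow_ne_zero _ (mt (toFract_eq_zero_iff P').1 hg))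
    ((map_ne_zero _).2 hp0) hmem'

variable {π : PoissonBracket k A}

theorem IsInducedOnFract.br_toFract {P : Ideal A} [P.IsPrime]
    {β : PoissonBracket k (FractionRing (A ⧸ P))} (hβ : IsInducedOnFract π P β) (a b : A) :
    β.br (toFract k P a) (toFract k P b) = toFract k P (π.br a b) :=
  hβ a b

theorem mem_poissonCenter_of_br_toFract {P : Ideal A} [P.IsPrime]
    {β : PoissonBracket k (FractionRing (A ⧸ P))} {z : FractionRing (A ⧸ P)}
    (h : ∀ a, β.br (toFract k P a) z = 0) : z ∈ poissonCenter β := by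
  have had : β.ad z = 0 := determinesDerivations_range_algebraMap (A := A ⧸ P) _ <| by
    rintro _ ⟨a, rfl⟩
    obtain ⟨a, rfl⟩ := Ideal.Quotient.mk_surjective a
    rw [β.ad_apply, β.antisymm]
    exact neg_eq_zero.2 (h a)
  exact DFunLike.congr_fun had

theorem IsInducedOnFract.div_mem_poissonCenter {P : Ideal A} [P.IsPrime]
    {β : PoissonBracket k (FractionRing (A ⧸ P))} (hβ : IsInducedOnFract π P β) {a g : A}
    (hg : g ∉ P) (h : ∀ b, π.br b a * g - a * π.br b g ∈ P) {z : FractionRing (A ⧸ P)}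
    (hz : toFract k P g * z = toFract k P a) : z ∈ poissonCenter β := by
  refine mem_poissonCenter_of_br_toFract fun b => ?_
  have hg0 : toFract k P g ≠ 0 := mt (toFract_eq_zero_iff P).1 hg
  have hb := (toFract_eq_zero_iff (k := k) P).2 (h b)
  rw [map_sub, map_mul, map_mul, ← hβ.br_toFract, ← hβ.br_toFract, ← hz, β.leibniz] at hb
  have hmul : toFract k P g * toFract k P g * β.br (toFract k P b) z = 0 := by
    linear_combination hb
  exact (mul_eq_zero.1 hmul).resolve_left (mul_ne_zero hg0 hg0)

/-- The ideal of denominators of `z`. -/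
def denominatorIdeal (P : Ideal A) [P.IsPrime] (z : FractionRing (A ⧸ P)) : Ideal A where
  carrier := {b | ∃ a, toFract k P b * z = toFract k P a}
  add_mem' := by
    rintro b b' ⟨a, ha⟩ ⟨a', ha'⟩
    exact ⟨a + a', by rw [map_add, map_add, add_mul, ha, ha']⟩
  zero_mem' := ⟨0, by rw [map_zero, zero_mul]⟩
  smul_mem' := by
    rintro c b ⟨a, ha⟩
    exact ⟨c * a, by rw [smul_eq_mul, map_mul, map_mul, mul_assoc, ha]⟩

theorem IsInducedOnFract.isPoissonIdeal_denominatorIdeal {P : Ideal A} [P.IsPrime]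
    {β : PoissonBracket k (FractionRing (A ⧸ P))} (hβ : IsInducedOnFract π P β)
    {z : FractionRing (A ⧸ P)} (hz : z ∈ poissonCenter β) :
    IsPoissonIdeal π (denominatorIdeal (k := k) P z) := by
  rintro c b ⟨a, ha⟩
  have h := β.leibniz (toFract k P c) (toFract k P b) z
  rw [ha, β.antisymm _ z, hz, neg_zero, mul_zero, add_zero, hβ.br_toFract, hβ.br_toFract] at h
  exact ⟨π.br c a, h.symm⟩

section Core

variable {M C : Ideal A} [C.IsPrime] {β : PoissonBracket k (FractionRing (A ⧸ C))}
  {z : FractionRing (A ⧸ C)}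

theorem IsPoissonCore.exists_denominator_notMem (hC : IsPoissonCore π M C)
    (hβ : IsInducedOnFract π C β) (hz : z ∈ poissonCenter β) :
    ∃ b ∉ M, ∃ a, toFract k C b * z = toFract k C a := by
  obtain ⟨b, hb, hbz⟩ := exists_toFract_mul_eq (k := k) C z
  have hne : ¬ denominatorIdeal (k := k) C z ≤ M := fun hM =>
    hb (hC.2 ⟨hβ.isPoissonIdeal_denominatorIdeal hz, hM⟩ hbz)
  obtain ⟨b', hb', hb'M⟩ := SetLike.not_le_iff_exists.1 hne
  exact ⟨b', hb'M, hb'⟩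

theorem IsPoissonCore.numerator_notMem [hM : M.IsPrime] (hC : IsPoissonCore π M C)
    (hβ : IsInducedOnFract π C β) (hz : z ∈ poissonCenter β) (hz0 : z ≠ 0) {a b : A} (hb : b ∉ M)
    (hab : toFract k C b * z = toFract k C a) : a ∉ M := by
  intro ha
  obtain ⟨b', hb', a', hab'⟩ := hC.exists_denominator_notMem hβ (inv_mem_poissonCenter hz)
  have hcross : toFract k C (b' * b - a' * a) = 0 := by
    rw [map_sub, map_mul, map_mul, ← hab, ← hab']
    field_simp
    ring
  have hmem : b' * b ∈ M :=
    (Submodule.sub_mem_iff_left M (M.mul_mem_left _ ha)).1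
      (hC.1.2 ((toFract_eq_zero_iff C).1 hcross))
  exact (hM.mem_or_mem hmem).elim hb' hb

/- By the two preceding lemmas a central `z = a / b` can be evaluated at `M`, and the evaluation is
an embedding of the Poisson center into the residue field `A ⧸ M`. -/
theorem IsPoissonCore.isAlgebraic_of_mem_poissonCenter [hM : M.IsPrime]
    [Algebra.IsAlgebraic k (FractionRing (A ⧸ M))] (hC : IsPoissonCore π M C)
    (hβ : IsInducedOnFract π C β) (hz : z ∈ poissonCenter β) : IsAlgebraic k z := by
  obtain ⟨b, hb, a, hab⟩ := hC.exists_denominator_notMem hβ hz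
  have hb0 : toFract k M b ≠ 0 := mt (toFract_eq_zero_iff M).1 hb
  obtain ⟨p, hp0, hp⟩ :=
    Algebra.IsAlgebraic.isAlgebraic (R := k) (toFract k M a / toFract k M b)
  have hmem : homogenizedEval p a b ∈ M := by
    rw [← toFract_eq_zero_iff (k := k), map_homogenizedEval _ (mul_div_cancel₀ _ hb0), hp, mul_zero]
  refine ⟨p, hp0, ?_⟩
  by_contra hpz
  refine hC.numerator_notMem hβ (aeval_mem_poissonCenter hz p) hpz
    (fun h => hb (hM.mem_of_pow_mem p.natDegree h)) ?_ hmem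
  rw [map_pow, map_homogenizedEval _ hab]

end Core

theorem IsPoissonPrimitive.isPoissonRational [CharZero k] [Algebra.FiniteType k A] {P : Ideal A}
    (h : IsPoissonPrimitive π P) : IsPoissonRational π P := by
  obtain ⟨M, hM, hP⟩ := h
  have := hM.isPrime
  have hPprime := hP.isPrime
  have : Module.Finite k (A ⧸ M) :=
    let _ := Ideal.Quotient.field M
    finite_of_finite_type_of_isJacobsonRing k (A ⧸ M)
  have : Algebra.IsAlgebraic k (FractionRing (A ⧸ M)) :=
    have := IsLocalization.isAlgebraic (FractionRing (A ⧸ M)) (nonZeroDivisors (A ⧸ M))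
    Algebra.IsAlgebraic.trans k (A ⧸ M) (FractionRing (A ⧸ M))
  obtain ⟨β, hβ⟩ := hP.1.1.exists_isInducedOnFract
  exact ⟨⟨hPprime, hP.1.1⟩, β, hβ, fun z hz => hP.isAlgebraic_of_mem_poissonCenter hβ hz⟩

end PoissonRational

section Graded

open SetLike

variable {k A ι : Type*} [Field k] [CommRing A] [Algebra k A] {π : PoissonBracket k A}
  {G : ι → Submodule k A}

/-- The bracket `π` is homogeneous of degree zero for the grading `G`. -/
def IsGradedBracket [Add ι] (π : PoissonBracket k A) (G : ι → Submodule k A) : Prop :=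
  ∀ ⦃i j a b⦄, a ∈ G i → b ∈ G j → π.br a b ∈ G (i + j)

theorem IsGradedBracket.isHomogeneousElem [Add ι] (hG : IsGradedBracket π G) {a b : A}
    (ha : IsHomogeneousElem G a) (hb : IsHomogeneousElem G b) :
    IsHomogeneousElem G (π.br a b) := by
  obtain ⟨i, ha⟩ := ha
  obtain ⟨j, hb⟩ := hb
  exact ⟨i + j, hG ha hb⟩

theorem br_sum_mul_sub_sum_mul_br {κ : Type*} [DecidableEq κ] (s : Finset κ) (f : κ → A) (g : κ)
    (b : A) : π.br b (∑ i ∈ s, f i) * f g - (∑ i ∈ s, f i) * π.br b (f g) =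
      ∑ i ∈ s.erase g, (π.br b (f i) * f g - f i * π.br b (f g)) := by
  rw [Finset.sum_erase _ (by ring), map_sum, Finset.sum_mul, Finset.sum_mul,
    Finset.sum_sub_distrib]

section Decomposition

variable [DecidableEq ι] [AddCommMonoid ι] [GradedAlgebra G]

theorem IsGradedBracket.isHomogeneousElem_br_mul_sub_mul_br (hG : IsGradedBracket π G) {a b c : A}
    (ha : IsHomogeneousElem G a) (hb : IsHomogeneousElem G b) (hc : IsHomogeneousElem G c) :
    IsHomogeneousElem G (π.br c a * b - a * π.br c b) := by
  obtain ⟨i, ha⟩ := ha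
  obtain ⟨j, hb⟩ := hb
  obtain ⟨l, hc⟩ := hc
  refine ⟨l + i + j, Submodule.sub_mem _ (mul_mem_graded (hG hc ha) hb) ?_⟩
  rw [add_assoc, add_left_comm]
  exact mul_mem_graded ha (hG hc hb)

/- If a summand `f g` is not in `P'`, then `{b, a} * f g - a * {b, f g}`, for `b` homogeneous and
`a` the sum, has fewer homogeneous summands than `a`. By induction it lies in `P`, so `a / f g` is a
Poisson central element of the fraction field of `A / P`, and as such algebraic. -/
theorem IsPoissonRational.sum_mem_of_le (hG : IsGradedBracket π G) {P P' : Ideal A}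
    (hP : IsPoissonRational π P) (hP' : IsPoissonPrime π P') (hle : P ≤ P')
    (hhom : ∀ a, IsHomogeneousElem G a → a ∈ P' → a ∈ P) {κ : Type*} (s : Finset κ) {f : κ → A}
    (hf : ∀ i ∈ s, IsHomogeneousElem G (f i)) (hs : ∑ i ∈ s, f i ∈ P') : ∑ i ∈ s, f i ∈ P := by
  classical
  have := hP.1.1
  have := hP'.1
  obtain ⟨-, β, hβ, halg⟩ := id hP
  induction s using Finset.strongInduction generalizing f with
  | H s ih =>
    by_cases hall : ∀ i ∈ s, f i ∈ P'
    · exact P.sum_mem fun i hi => hhom _ (hf i hi) (hall i hi)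
    push Not at hall
    obtain ⟨g, hgs, hg⟩ := hall
    set a := ∑ i ∈ s, f i
    have hcentral (b : A) : π.br b a * f g - a * π.br b (f g) ∈ P := by
      induction b using DirectSum.Decomposition.inductionOn G with
      | zero => simp
      | add b c hb hc =>
        rw [map_add, LinearMap.add_apply, LinearMap.add_apply, add_mul, mul_add, add_sub_add_comm]
        exact P.add_mem hb hc
      | homogeneous b =>
        rw [br_sum_mul_sub_sum_mul_br]
        refine ih _ (Finset.erase_ssubset hgs) (fun i hi => ?_) ?_
        · exact hG.isHomogeneousElem_br_mul_sub_mul_br (hf i (Finset.mem_of_mem_erase hi))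
            (hf g hgs) ⟨_, b.2⟩
        · rw [← br_sum_mul_sub_sum_mul_br]
          exact P'.sub_mem (P'.mul_mem_right _ (hP'.2 _ _ hs)) (P'.mul_mem_right _ hs)
    have hgP : f g ∉ P := fun h => hg (hle h)
    have hz : toFract k P (f g) * (toFract k P a / toFract k P (f g)) = toFract k P a :=
      mul_div_cancel₀ _ (mt (toFract_eq_zero_iff P).1 hgP)
    exact mem_of_isAlgebraic_div hle hs hg hz
      (halg _ (hβ.div_mem_poissonCenter hgP hcentral hz))

theorem IsPoissonRational.eq_of_homogeneous_mem (hG : IsGradedBracket π G) {P P' : Ideal A}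
    (hP : IsPoissonRational π P) (hP' : IsPoissonPrime π P') (hle : P ≤ P')
    (hhom : ∀ a, IsHomogeneousElem G a → a ∈ P' → a ∈ P) : P' = P := by
  classical
  refine le_antisymm (fun a ha => ?_) hle
  rw [← DirectSum.sum_support_decompose G a] at ha ⊢
  exact hP.sum_mem_of_le hG hP' hle hhom _ (fun i _ => ⟨i, Subtype.property _⟩) ha

theorem isPoissonIdeal_of_isHomogeneous {I : Ideal A} (hI : I.IsHomogeneous G)
    (h : ∀ a b, IsHomogeneousElem G a → IsHomogeneousElem G b → b ∈ I → π.br a b ∈ I) :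
    IsPoissonIdeal π I := by
  classical
  intro a b hb
  rw [← DirectSum.sum_support_decompose G b, map_sum]
  refine I.sum_mem fun j _ => ?_
  rw [← DirectSum.sum_support_decompose G a, map_sum, LinearMap.sum_apply]
  exact I.sum_mem fun i _ => h _ _ ⟨i, Subtype.property _⟩ ⟨j, Subtype.property _⟩ (hI j hb)

end Decomposition

variable [AddCommMonoid ι] [LinearOrder ι] [IsOrderedCancelAddMonoid ι] [GradedAlgebra G]

theorem IsPoissonPrime.homogeneousCore (hG : IsGradedBracket π G) {P : Ideal A}
    (hP : IsPoissonPrime π P) : IsPoissonPrime π (P.homogeneousCore G).toIdeal := by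
  refine ⟨hP.1.homogeneousCore, isPoissonIdeal_of_isHomogeneous (HomogeneousIdeal.isHomogeneous _)
    fun a b ha hb hbP => ?_⟩
  exact Ideal.mem_homogeneousCore_of_homogeneous_of_mem (hG.isHomogeneousElem ha hb)
    (hP.2 a b (Ideal.toIdeal_homogeneousCore_le G P hbP))

theorem IsPoissonRational.isLocallyClosedPoint (hG : IsGradedBracket π G)
    (hfin : {J | IsPoissonPrime π J ∧ J.IsHomogeneous G}.Finite) {P : Ideal A}
    (hP : IsPoissonRational π P) : IsLocallyClosedPoint π P := by
  classical
  have hprime := hP.1.1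
  let S := hfin.toFinset.filter fun J => ¬ J ≤ P
  have hS : ¬ S.inf id ≤ P := fun h => by
    obtain ⟨J, hJ, hJP⟩ := (Ideal.IsPrime.inf_le' hprime).1 h
    exact (Finset.mem_filter.1 hJ).2 hJP
  obtain ⟨s, hs, hsP⟩ := SetLike.not_le_iff_exists.1 hS
  refine isLocallyClosedPoint_iff.2 ⟨hP.1, s, hsP, fun P' hP' hle hsP' => ?_⟩
  have hcore : (P'.homogeneousCore G).toIdeal ≤ P := by
    by_contra h
    have hmem : (P'.homogeneousCore G).toIdeal ∈ S := Finset.mem_filter.2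
      ⟨hfin.mem_toFinset.2 ⟨hP'.homogeneousCore hG, HomogeneousIdeal.isHomogeneous _⟩, h⟩
    exact hsP' (Ideal.toIdeal_homogeneousCore_le G P' (Finset.inf_le (f := id) hmem hs))
  exact hP.eq_of_homogeneous_mem hG hP' hle fun a ha haP' =>
    hcore (Ideal.mem_homogeneousCore_of_homogeneous_of_mem ha haP')

theorem poissonDixmierMoeglin_of_finite_homogeneous [CharZero k] [Algebra.FiniteType k A]
    (hG : IsGradedBracket π G) (hfin : {J | IsPoissonPrime π J ∧ J.IsHomogeneous G}.Finite) :
    PoissonDixmierMoeglin π := by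
  have : IsJacobsonRing A := isJacobsonRing_of_finiteType (A := k)
  exact ⟨Set.ext fun P => ⟨fun h => h.isPoissonRational.isLocallyClosedPoint hG hfin,
      fun h => h.isPoissonPrimitive⟩,
    Set.ext fun P => ⟨fun h => h.isPoissonPrimitive.isPoissonRational,
      fun h => h.isLocallyClosedPoint hG hfin⟩⟩

end Graded

section DifferentialFields

open scoped Differential

variable {K L : Type*} [Field K] [Field L] [Algebra K L] [Differential K] [Differential L]
  [DifferentialAlgebra K L] {x : L} {s t : K}

theorem coeff_mapCoeffs_add_derivative_mul (p : Polynomial K) (n : K) (j : ℕ) :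
    (Differential.mapCoeffs p + p.derivative * (Polynomial.C s * Polynomial.X + Polynomial.C t)
      - Polynomial.C n * p).coeff j =
    (p.coeff j)′ + (s * (j * p.coeff j) + t * ((j + 1) * p.coeff (j + 1))) - n * p.coeff j := by
  rw [mul_add, ← mul_assoc, mul_right_comm]
  cases j with
  | zero =>
    simp only [Polynomial.coeff_sub, Polynomial.coeff_add, Differential.coeff_mapCoeffs,
      Polynomial.coeff_mul_X_zero, Polynomial.coeff_mul_C, Polynomial.coeff_C_mul,
      Polynomial.coeff_derivative]
    push_cast
    ring
  | succ j =>
    simp only [Polynomial.coeff_sub, Polynomial.coeff_add, Differential.coeff_mapCoeffs,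
      Polynomial.coeff_mul_X, Polynomial.coeff_mul_C, Polynomial.coeff_C_mul,
      Polynomial.coeff_derivative]
    push_cast
    ring

/- Differentiate `f x = 0` for the minimal polynomial `f`, of degree `m + 1`, and subtract
`(m + 1) * s * f x`: the result is a polynomial of degree at most `m` with root `x`, so it
vanishes. This is its coefficient of degree `m`. -/
theorem deriv_coeff_minpoly (hx : x′ = algebraMap K L s * x + algebraMap K L t) {m : ℕ}
    (hm : (minpoly K x).natDegree = m + 1) :
    ((minpoly K x).coeff m)′ = s * (minpoly K x).coeff m - (m + 1) * t := by
  set f := minpoly K x with hf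
  have hint : IsIntegral K x := by
    by_contra h
    rw [hf, minpoly.eq_zero h, Polynomial.natDegree_zero] at hm
    exact m.succ_ne_zero hm.symm
  have hlead : f.coeff (m + 1) = 1 := by rw [← hm]; exact minpoly.monic hint
  set q := Differential.mapCoeffs f + f.derivative * (Polynomial.C s * Polynomial.X +
    Polynomial.C t) - Polynomial.C ((m + 1) * s) * f with hq
  have hqx : q.aeval x = 0 := by
    have h := Differential.deriv_aeval_eq x f
    rw [minpoly.aeval, map_zero, hx] at h
    simp only [hq, map_sub, map_add, map_mul, Polynomial.aeval_C, Polynomial.aeval_X,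
      hf, minpoly.aeval]
    rw [mul_zero, sub_zero]
    exact h.symm
  have hcoeff : ∀ j, q.coeff j = _ := coeff_mapCoeffs_add_derivative_mul f _
  have hdeg : q.natDegree < f.natDegree := by
    rw [hm, Nat.lt_succ_iff, Polynomial.natDegree_le_iff_coeff_eq_zero]
    intro j hj
    have hj0 : f.coeff (j + 1) = 0 := Polynomial.coeff_eq_zero_of_natDegree_lt (by omega)
    rcases (Nat.succ_le_of_lt hj).eq_or_lt with rfl | hj
    · rw [hcoeff, hj0, Nat.succ_eq_add_one, hlead, Derivation.map_one_eq_zero]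
      push_cast
      ring
    · have hj1 : f.coeff j = 0 := Polynomial.coeff_eq_zero_of_natDegree_lt (by omega)
      rw [hcoeff, hj0, hj1, map_zero]
      ring
  have hq0 : q = 0 := by
    by_contra h
    exact (Polynomial.natDegree_le_natDegree (minpoly.degree_le_of_ne_zero K x h hqx)).not_gt hdeg
  have h := hcoeff m
  rw [hq0, Polynomial.coeff_zero, hlead] at h
  linear_combination -h

end DifferentialFields

section GeneratedSubfields

variable {k L : Type*} [Field k] [Field L] [Algebra k L] {S : Set L}

theorem derivation_mem_adjoin {D : Derivation k L L}
    (h : ∀ a ∈ S, D a ∈ IntermediateField.adjoin k S) {z : L}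
    (hz : z ∈ IntermediateField.adjoin k S) : D z ∈ IntermediateField.adjoin k S := by
  induction hz using IntermediateField.adjoin_induction with
  | mem a ha => exact h a ha
  | algebraMap r => rw [D.map_algebraMap]; exact zero_mem _
  | add a b _ _ ha hb => rw [map_add]; exact add_mem ha hb
  | inv a hmem ha =>
    rw [D.leibniz_inv]
    exact mul_mem (neg_mem (pow_mem (inv_mem hmem) 2)) ha
  | mul a b hmem hmem' ha hb =>
    rw [D.leibniz]
    exact add_mem (mul_mem hmem hb) (mul_mem hmem' ha)

theorem derivation_eq_zero_of_mem_adjoin {D : Derivation k L L} (h : ∀ a ∈ S, D a = 0) {z : L}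
    (hz : z ∈ IntermediateField.adjoin k S) : D z = 0 := by
  induction hz using IntermediateField.adjoin_induction with
  | mem a ha => exact h a ha
  | algebraMap r => exact D.map_algebraMap r
  | add a b _ _ ha hb => rw [map_add, ha, hb, add_zero]
  | inv a _ ha => rw [D.leibniz_inv, ha, smul_zero]
  | mul a b _ _ ha hb => rw [D.leibniz, ha, hb, smul_zero, smul_zero, add_zero]

theorem derivation_eq_zero_of_isAlgebraic [CharZero k] {D : Derivation k L L}
    (h : ∀ a ∈ S, D a = 0) {y : L} (hy : IsAlgebraic (IntermediateField.adjoin k S) y) :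
    D y = 0 := by
  let D' : Derivation (IntermediateField.adjoin k S) L L := Derivation.mk'
    { toFun := D
      map_add' := map_add D
      map_smul' a b := by
        rw [Algebra.smul_def, D.leibniz, IntermediateField.algebraMap_apply,
          derivation_eq_zero_of_mem_adjoin h a.2, smul_zero, add_zero, RingHom.id_apply]
        rfl } D.leibniz
  have := charZero_of_injective_algebraMap (algebraMap k L).injective
  have hD := D'.map_aeval (minpoly (IntermediateField.adjoin k S) y) y
  rw [minpoly.aeval, map_zero] at hD
  exact (smul_eq_zero.1 hD.symm).resolve_left
    ((minpoly.irreducible hy.isIntegral).separable.aeval_derivative_ne_zero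
      (minpoly.aeval _ _))

end GeneratedSubfields

section PoissonExtension

/-- `B[x]` is a Poisson-Ore extension of `B`: for a derivation `η`, which has `x` as an eigenvector
with nonzero eigenvalue `c`, and a map `δ`, one has `{x, b} = η(b) x + δ(b)` on `B`. The derivation
`η` is defined on all of the ambient algebra, and `x` may be algebraic over `B`. -/
structure IsPoissonExtension {k A : Type*} [Field k] [CommRing A] [Algebra k A]
    (π : PoissonBracket k A) (B : Subalgebra k A) (x : A) (η : Derivation k A A) (c : k) :
    Prop where
  br_mem : ∀ a ∈ B, ∀ b ∈ B, π.br a b ∈ B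
  eta_mem : ∀ b ∈ B, η b ∈ B
  eta_self : η x = c • x
  delta_mem : ∀ b ∈ B, π.br x b - η b * x ∈ B
  ne_zero : c ≠ 0

theorem PoissonBracket.ad_apply_eq {k A : Type*} [Field k] [CommRing A] [Algebra k A]
    (π : PoissonBracket k A) (b x : A) (η : Derivation k A A) :
    π.ad b x = -η b * x + -(π.br x b - η b * x) := by
  rw [π.ad_apply, π.antisymm]
  ring

section Fields

variable {k L : Type*} [Field k] [CharZero k] [Field L] [Algebra k L]

/- The derivation `{y, -} - y η` vanishes on the subfield generated by `S`, hence at `y`, where its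
value is `-c y ^ 2`. -/
theorem eq_zero_of_isAlgebraic_of_br_eq {β : PoissonBracket k L} {η : Derivation k L L} {c : k}
    (hc : c ≠ 0) {S : Set L} {y : L} (hS : ∀ a ∈ S, β.br y a = η a * y) (hy : η y = c • y)
    (halg : IsAlgebraic (IntermediateField.adjoin k S) y) : y = 0 := by
  let E : Derivation k L L := β.ad y - y • η
  have hE : ∀ a, E a = β.br y a - y * η a := fun _ => rfl
  have hEy : E y = 0 := derivation_eq_zero_of_isAlgebraic
    (fun a ha => by rw [hE, hS a ha, mul_comm, sub_self]) halg
  rw [hE, β.self_eq_zero, hy, zero_sub, neg_eq_zero, mul_smul_comm, smul_eq_zero] at hEy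
  exact mul_self_eq_zero.1 (hEy.resolve_left hc)

omit [CharZero k] in
theorem derivation_coeff_minpoly {F : IntermediateField k L} {D : Derivation k L L}
    (hD : ∀ a ∈ F, D a ∈ F) {x : L} {s t : F} (hx : D x = s * x + t) {m : ℕ}
    (hm : (minpoly F x).natDegree = m + 1) :
    D ((minpoly F x).coeff m) = s * (minpoly F x).coeff m - (m + 1) * t := by
  let d : Derivation k F F := Derivation.mk'
    ((D.toLinearMap ∘ₗ F.val.toLinearMap).codRestrict F.toSubmodule fun a => hD a a.2)
    fun a b => Subtype.ext (D.leibniz a b)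
  let : Differential F := ⟨d.restrictScalars ℤ⟩
  let : Differential L := ⟨D.restrictScalars ℤ⟩
  have : DifferentialAlgebra F L := ⟨fun _ => rfl⟩
  have h : D ((minpoly F x).coeff m) = algebraMap F L (s * (minpoly F x).coeff m - (m + 1) * t) :=
    congrArg (algebraMap F L) (deriv_coeff_minpoly hx hm)
  rw [h, map_sub, map_mul, map_mul, map_add, map_natCast, map_one]
  rfl

/- Completing the power: if `x ^ (m + 1) + b * x ^ m + ⋯` is the minimal polynomial of `x`, then
`x + b / (m + 1)` is an eigenvector of every derivation `D` with `D x = s * x + t`. -/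
theorem derivation_add_coeff_minpoly_div {F : IntermediateField k L} {D : Derivation k L L}
    (hD : ∀ a ∈ F, D a ∈ F) {x s t : L} (hs : s ∈ F) (ht : t ∈ F) (hx : D x = s * x + t) {m : ℕ}
    (hm : (minpoly F x).natDegree = m + 1) :
    D (x + (minpoly F x).coeff m / (m + 1)) = s * (x + (minpoly F x).coeff m / (m + 1)) := by
  have := charZero_of_injective_algebraMap (algebraMap k L).injective
  have hm0 : (m + 1 : L) ≠ 0 := m.cast_add_one_ne_zero
  have hDm : D (m + 1 : L) = 0 := by rw [map_add, D.map_natCast, D.map_one_eq_zero, add_zero]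
  have hDb := derivation_coeff_minpoly (s := ⟨s, hs⟩) (t := ⟨t, ht⟩) hD hx hm
  rw [map_add, D.leibniz_div, hDm, hx, hDb]
  simp only [smul_eq_mul]
  field_simp
  ring

theorem IsPoissonExtension.mem_adjoin {β : PoissonBracket k L} {B : Subalgebra k L} {x : L}
    {η : Derivation k L L} {c : k} (h : IsPoissonExtension β B x η c)
    (halg : IsAlgebraic (IntermediateField.adjoin k (B : Set L)) x) :
    x ∈ IntermediateField.adjoin k (B : Set L) := by
  set F := IntermediateField.adjoin k (B : Set L)
  have hBF : ∀ b ∈ B, b ∈ F := fun b hb => IntermediateField.subset_adjoin k _ hb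
  obtain ⟨m, hm⟩ := Nat.exists_eq_add_one.2 (minpoly.natDegree_pos halg.isIntegral)
  obtain ⟨u, hu, hD⟩ : ∃ u ∈ F, ∀ D : Derivation k L L, (∀ a ∈ B, D a ∈ B) → ∀ s ∈ B, ∀ t ∈ B,
      D x = s * x + t → D (x + u) = s * (x + u) :=
    ⟨(minpoly F x).coeff m / (m + 1),
      div_mem (SetLike.coe_mem _) (add_mem (natCast_mem F m) (one_mem F)),
      fun D hD s hs t ht hx => derivation_add_coeff_minpoly_div
        (fun _ => derivation_mem_adjoin fun a ha => hBF _ (hD a ha)) (hBF s hs) (hBF t ht) hx hm⟩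
  have hyalg : IsAlgebraic F (x + u) := halg.add (isAlgebraic_algebraMap (⟨u, hu⟩ : F))
  have hy : x + u = 0 := by
    refine eq_zero_of_isAlgebraic_of_br_eq (β := β) (η := η) h.ne_zero (fun a ha => ?_) ?_ hyalg
    · rw [β.antisymm, ← β.ad_apply, hD (β.ad a) (h.br_mem a ha) (-η a) (B.neg_mem (h.eta_mem a ha))
        _ (B.neg_mem (h.delta_mem a ha)) (β.ad_apply_eq a x η), neg_mul, neg_neg]
    · rw [hD η h.eta_mem (algebraMap k L c) (B.algebraMap_mem c) 0 B.zero_mem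
        (by rw [h.eta_self, Algebra.smul_def, add_zero]), Algebra.smul_def]
  rw [eq_neg_of_add_eq_zero_left hy]
  exact neg_mem hu

end Fields

variable {k A : Type*} [Field k] [CommRing A] [Algebra k A] {π : PoissonBracket k A}
  {B : Subalgebra k A} {x : A} {η : Derivation k A A} {c : k} {P P' : Ideal A}

theorem exists_derivation_toFract [P.IsPrime] (hη : ∀ a ∈ P, η a ∈ P) :
    ∃ η' : Derivation k (FractionRing (A ⧸ P)) (FractionRing (A ⧸ P)),
      ∀ a, η' (toFract k P a) = toFract k P (η a) := by
  let d : Derivation k (A ⧸ P) (A ⧸ P) := Derivation.liftOfSurjective (d := η)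
    (f := Ideal.Quotient.mkₐ k P) Ideal.Quotient.mk_surjective fun a ha =>
      Ideal.Quotient.eq_zero_iff_mem.2 (hη a (Ideal.Quotient.eq_zero_iff_mem.1 ha))
  have := Algebra.FormallyEtale.of_isLocalization (Rₘ := FractionRing (A ⧸ P))
    (nonZeroDivisors (A ⧸ P))
  obtain ⟨η', hη'⟩ := exists_derivation_extension (K := FractionRing (A ⧸ P))
    ((Algebra.linearMap (A ⧸ P) (FractionRing (A ⧸ P))).compDer d)
  have hd (a : A) : d (Ideal.Quotient.mk P a) = Ideal.Quotient.mk P (η a) :=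
    Derivation.liftOfSurjective_apply _ _ a
  exact ⟨η', fun a => (hη' (Ideal.Quotient.mk P a)).trans <|
    congrArg (algebraMap (A ⧸ P) (FractionRing (A ⧸ P))) (hd a)⟩

theorem IsPoissonExtension.map_toFract [P.IsPrime] (h : IsPoissonExtension π B x η c)
    {β : PoissonBracket k (FractionRing (A ⧸ P))} (hβ : IsInducedOnFract π P β)
    {η' : Derivation k (FractionRing (A ⧸ P)) (FractionRing (A ⧸ P))}
    (hη' : ∀ a, η' (toFract k P a) = toFract k P (η a)) :
    IsPoissonExtension β (B.map (toFract k P)) (toFract k P x) η' c where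
  br_mem := by
    rintro _ ⟨a, ha, rfl⟩ _ ⟨b, hb, rfl⟩
    exact ⟨_, h.br_mem a ha b hb, (hβ a b).symm⟩
  eta_mem := by
    rintro _ ⟨b, hb, rfl⟩
    exact ⟨_, h.eta_mem b hb, (hη' b).symm⟩
  eta_self := by rw [hη', h.eta_self, map_smul]
  delta_mem := by
    rintro _ ⟨b, hb, rfl⟩
    refine ⟨_, h.delta_mem b hb, ?_⟩
    simp only [RingHom.coe_coe, hη', hβ.br_toFract, map_sub, map_mul]
  ne_zero := h.ne_zero

/-- `x` is algebraic over `B` modulo `P`: the ideal `P` contains a value at `x` of a polynomial over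
`B` not all of whose coefficients lie in `P`. -/
def IsAlgebraicMod (B : Subalgebra k A) (x : A) (P : Ideal A) : Prop :=
  ∃ p : Polynomial B, p.aeval x ∈ P ∧ ∃ i, (p.coeff i : A) ∉ P

theorem IsAlgebraicMod.isAlgebraic_toFract [P.IsPrime] (h : IsAlgebraicMod B x P) :
    IsAlgebraic (IntermediateField.adjoin k (B.map (toFract k P) : Set (FractionRing (A ⧸ P))))
      (toFract k P x) := by
  obtain ⟨p, hp, i, hi⟩ := h
  let φ : B →+* IntermediateField.adjoin k (B.map (toFract k P) : Set (FractionRing (A ⧸ P))) :=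
    ((toFract k P : A →+* FractionRing (A ⧸ P)).comp B.toSubring.subtype).codRestrict _ fun b =>
      IntermediateField.subset_adjoin k _ ⟨b, b.2, rfl⟩
  refine ⟨p.map φ, fun h0 => hi ?_, ?_⟩
  · have h := congrArg (fun q => algebraMap _ (FractionRing (A ⧸ P)) (q.coeff i)) h0
    simp only [Polynomial.coeff_map, Polynomial.coeff_zero, map_zero] at h
    exact (toFract_eq_zero_iff P).1 h
  · have h : (algebraMap _ (FractionRing (A ⧸ P))).comp φ =
        (toFract k P : A →+* FractionRing (A ⧸ P)).comp (algebraMap B A) := rfl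
    exact (Polynomial.map_aeval_eq_aeval_map h p x).symm.trans
      ((toFract_eq_zero_iff (k := k) P).2 hp)

theorem IsPoissonExtension.exists_linear_mem [CharZero k] (h : IsPoissonExtension π B x η c)
    (hP : IsPoissonPrime π P) (hη : ∀ a ∈ P, η a ∈ P) (halg : IsAlgebraicMod B x P) :
    ∃ a ∈ B, a ∉ P ∧ ∃ b ∈ B, a * x + b ∈ P := by
  have := hP.1
  obtain ⟨β, hβ⟩ := hP.2.exists_isInducedOnFract
  obtain ⟨η', hη'⟩ := exists_derivation_toFract hη
  have hmem := (h.map_toFract hβ hη').mem_adjoin halg.isAlgebraic_toFract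
  rw [IntermediateField.mem_adjoin_iff_div, Algebra.adjoin_eq] at hmem
  obtain ⟨_, ⟨b, hb, rfl⟩, _, ⟨a, ha, rfl⟩, hx⟩ := hmem
  simp only [RingHom.coe_coe] at hx
  by_cases haP : a ∈ P
  · rw [(toFract_eq_zero_iff P).2 haP, div_zero, toFract_eq_zero_iff] at hx
    exact ⟨1, B.one_mem, hP.1.one_notMem, 0, B.zero_mem, by rwa [one_mul, add_zero]⟩
  · refine ⟨a, ha, haP, -b, B.neg_mem hb, (toFract_eq_zero_iff (k := k) P).1 ?_⟩
    rw [map_add, map_mul, map_neg, hx, mul_div_cancel₀ _ (mt (toFract_eq_zero_iff P).1 haP),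
      add_neg_cancel]

theorem derivation_mem_of_linear_mem {D : Derivation k A A} (hD : ∀ a ∈ P, D a ∈ P) {a b s t : A}
    (hab : a * x + b ∈ P) (hx : D x = s * x + t) :
    a * D b - b * D a - s * a * b + t * a ^ 2 ∈ P := by
  convert P.sub_mem (P.mul_mem_left a (hD _ hab)) (P.mul_mem_left (D a + s * a) hab) using 1
  rw [map_add, D.leibniz, hx, smul_eq_mul, smul_eq_mul]
  ring

theorem derivation_toFract_add_div [P.IsPrime] {D : Derivation k A A}
    {D' : Derivation k (FractionRing (A ⧸ P)) (FractionRing (A ⧸ P))}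
    (hD' : ∀ y, D' (toFract k P y) = toFract k P (D y)) {a b s t : A} (ha : a ∉ P)
    (hrel : a * D b - b * D a - s * a * b + t * a ^ 2 ∈ P) (hx : D x = s * x + t) :
    D' (toFract k P x + toFract k P b / toFract k P a) =
      toFract k P s * (toFract k P x + toFract k P b / toFract k P a) := by
  have ha0 : toFract k P a ≠ 0 := mt (toFract_eq_zero_iff P).1 ha
  rw [← toFract_eq_zero_iff (k := k)] at hrel
  simp only [map_add, map_sub, map_mul, map_pow] at hrel
  rw [map_add, D'.leibniz_div, hD', hD', hD', hx]
  simp only [map_add, map_mul, smul_eq_mul]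
  field_simp
  linear_combination hrel

/- Let `D x = s * x + t`. That `x + b / a` is an eigenvector of `D` modulo `P` with eigenvalue `s`
is expressed by an element of `B` lying in `P`. -/
theorem IsPoissonExtension.linear_mem_of_linear_mem [CharZero k]
    (h : IsPoissonExtension π B x η c) (hP : IsPoissonPrime π P) (hη : ∀ a ∈ P, η a ∈ P)
    (hP' : IsPoissonPrime π P') (hη' : ∀ a ∈ P', η a ∈ P') (hB : ∀ a ∈ B, (a ∈ P ↔ a ∈ P'))
    (halg : IsAlgebraicMod B x P') {a b : A} (ha : a ∈ B) (hb : b ∈ B) (haP : a ∉ P)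
    (hab : a * x + b ∈ P) : a * x + b ∈ P' := by
  have := hP'.1
  obtain ⟨β, hβ⟩ := hP'.2.exists_isInducedOnFract
  obtain ⟨θ, hθ⟩ := exists_derivation_toFract hη'
  have haP' : a ∉ P' := mt (hB a ha).2 haP
  have ha0 : toFract k P' a ≠ 0 := mt (toFract_eq_zero_iff P').1 haP'
  set y := toFract k P' x + toFract k P' b / toFract k P' a with hy
  have hD : ∀ (D : Derivation k A A) (D' : Derivation k (FractionRing (A ⧸ P')) _),
      (∀ y, D' (toFract k P' y) = toFract k P' (D y)) → (∀ y ∈ P, D y ∈ P) → (∀ y ∈ B, D y ∈ B) →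
      ∀ s ∈ B, ∀ t ∈ B, D x = s * x + t → D' y = toFract k P' s * y := by
    refine fun D D' hD' hDP hDB s hs t ht hx =>
      derivation_toFract_add_div hD' haP' ((hB _ ?_).1 (derivation_mem_of_linear_mem hDP hab hx)) hx
    exact add_mem (sub_mem (sub_mem (mul_mem ha (hDB b hb)) (mul_mem hb (hDB a ha)))
      (mul_mem (mul_mem hs ha) hb)) (mul_mem ht (pow_mem ha 2))
  have hba : toFract k P' b / toFract k P' a ∈
      IntermediateField.adjoin k (B.map (toFract k P') : Set (FractionRing (A ⧸ P'))) :=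
    div_mem (IntermediateField.subset_adjoin k _ ⟨b, hb, rfl⟩)
      (IntermediateField.subset_adjoin k _ ⟨a, ha, rfl⟩)
  have hyalg : IsAlgebraic
      (IntermediateField.adjoin k (B.map (toFract k P') : Set (FractionRing (A ⧸ P')))) y :=
    halg.isAlgebraic_toFract.add (isAlgebraic_algebraMap
      (⟨_, hba⟩ : IntermediateField.adjoin k (B.map (toFract k P') : Set (FractionRing (A ⧸ P')))))
  have hy0 : y = 0 := by
    refine eq_zero_of_isAlgebraic_of_br_eq (β := β) (η := θ) h.ne_zero ?_ ?_ hyalg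
    · rintro _ ⟨d, hd, rfl⟩
      rw [RingHom.coe_coe, hθ, β.antisymm, ← β.ad_apply, hD (π.ad d) _ (hβ.br_toFract d) (hP.2 d)
        (h.br_mem d hd) _ (neg_mem (h.eta_mem d hd)) _ (neg_mem (h.delta_mem d hd))
        (π.ad_apply_eq d x η), map_neg, neg_mul, neg_neg]
    · rw [hD η θ hθ hη h.eta_mem _ (B.algebraMap_mem c) 0 B.zero_mem
        (by rw [h.eta_self, Algebra.smul_def, add_zero]), AlgHom.commutes, Algebra.smul_def]
  rw [← toFract_eq_zero_iff (k := k), map_add, map_mul, ← mul_div_cancel₀ (toFract k P' b) ha0,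
    ← mul_add, ← hy, hy0, mul_zero]

/- Eliminate `x` using `a * x = -b`. -/
theorem exists_pow_mul_sub_mem_span {a b f : A} (ha : a ∈ B) (hb : b ∈ B)
    (hf : f ∈ Algebra.adjoin B {x}) :
    ∃ n : ℕ, ∃ g ∈ B, a ^ n * f - g ∈ Ideal.span {a * x + b} := by
  induction hf using Algebra.adjoin_induction with
  | mem y hy =>
    obtain rfl : y = x := hy
    refine ⟨1, -b, B.neg_mem hb, ?_⟩
    rw [pow_one, sub_neg_eq_add]
    exact Ideal.mem_span_singleton_self _
  | algebraMap r => exact ⟨0, r, r.2, by simp⟩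
  | add y z _ _ hy hz =>
    obtain ⟨n, g, hg, hn⟩ := hy
    obtain ⟨m, g', hg', hm⟩ := hz
    refine ⟨n + m, a ^ m * g + a ^ n * g', B.add_mem (B.mul_mem (B.pow_mem ha _) hg)
      (B.mul_mem (B.pow_mem ha _) hg'), ?_⟩
    convert Ideal.add_mem _ (Ideal.mul_mem_left _ (a ^ m) hn) (Ideal.mul_mem_left _ (a ^ n) hm)
      using 1
    ring
  | mul y z _ _ hy hz =>
    obtain ⟨n, g, hg, hn⟩ := hy
    obtain ⟨m, g', hg', hm⟩ := hz
    refine ⟨n + m, g * g', B.mul_mem hg hg', ?_⟩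
    convert Ideal.add_mem _ (Ideal.mul_mem_left _ (a ^ m * z) hn) (Ideal.mul_mem_left _ g hm)
      using 1
    ring

theorem mem_of_not_isAlgebraicMod (h : ¬IsAlgebraicMod B x P) (hB : ∀ a ∈ B, a ∈ P → a ∈ P')
    {f : A} (hf : f ∈ Algebra.adjoin B {x}) (hfP : f ∈ P) : f ∈ P' := by
  rw [Algebra.adjoin_singleton_eq_range_aeval] at hf
  obtain ⟨p, rfl⟩ := hf
  have hcoeff : ∀ i, (p.coeff i : A) ∈ P := by
    by_contra! hne
    exact h ⟨p, hfP, hne⟩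
  change Polynomial.aeval x p ∈ P'
  simp only [Polynomial.aeval_eq_sum_range, Subalgebra.smul_def, smul_eq_mul]
  exact P'.sum_mem fun i _ => P'.mul_mem_right _ (hB _ (p.coeff i).2 (hcoeff i))

theorem IsPoissonExtension.mem_of_isAlgebraicMod_iff [CharZero k]
    (h : IsPoissonExtension π B x η c) (hP : IsPoissonPrime π P) (hη : ∀ a ∈ P, η a ∈ P)
    (hP' : IsPoissonPrime π P') (hη' : ∀ a ∈ P', η a ∈ P') (hB : ∀ a ∈ B, (a ∈ P ↔ a ∈ P'))
    (hiff : IsAlgebraicMod B x P ↔ IsAlgebraicMod B x P') {f : A} (hf : f ∈ Algebra.adjoin B {x})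
    (hfP : f ∈ P) : f ∈ P' := by
  by_cases halg : IsAlgebraicMod B x P
  · obtain ⟨a, ha, haP, b, hb, hab⟩ := h.exists_linear_mem hP hη halg
    have hab' := h.linear_mem_of_linear_mem hP hη hP' hη' hB (hiff.1 halg) ha hb haP hab
    obtain ⟨n, g, hg, hn⟩ := exists_pow_mul_sub_mem_span ha hb hf
    have hgP : g ∈ P := (Submodule.sub_mem_iff_right P (P.mul_mem_left _ hfP)).1 <|
      (Ideal.span_singleton_le_iff_mem P).2 hab hn
    have hfP' : a ^ n * f ∈ P' := (Submodule.sub_mem_iff_left P' ((hB g hg).1 hgP)).1 <|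
      (Ideal.span_singleton_le_iff_mem P').2 hab' hn
    exact (hP'.1.mem_or_mem hfP').resolve_left fun h =>
      haP ((hB a ha).2 (hP'.1.mem_of_pow_mem n h))
  · exact mem_of_not_isAlgebraicMod halg (fun a ha => (hB a ha).1) hf hfP

end PoissonExtension

section Weights

variable {k σ M : Type*} [Field k] [AddCommMonoid M] {w : σ → M}

theorem isWeightedHomogeneous_induction {motive : MvPolynomial σ k → M → Prop}
    (zero : ∀ γ, motive 0 γ) (add : ∀ f g γ, motive f γ → motive g γ → motive (f + g) γ)
    (C : ∀ r, motive (C r) 0) (X : ∀ s, motive (X s) (w s))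
    (mul : ∀ f g γ δ, motive f γ → motive g δ → motive (f * g) (γ + δ)) {f : MvPolynomial σ k}
    {γ : M} (hf : IsWeightedHomogeneous w f γ) : motive f γ := by
  have monomial_one (d : σ →₀ ℕ) : motive (monomial d 1) (Finsupp.weight w d) := by
    induction d using Finsupp.induction_linear with
    | zero => rw [map_zero]; exact C 1
    | add d d' hd hd' => simpa only [monomial_mul, mul_one, map_add] using mul _ _ _ _ hd hd'
    | single s n =>
      rw [Finsupp.weight_single, ← X_pow_eq_monomial]
      induction n with
      | zero => simpa only [pow_zero, zero_smul, C_1] using C 1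
      | succ n ih => simpa only [pow_succ, succ_nsmul] using mul _ _ _ _ ih (X s)
  induction hf using IsWeightedHomogeneous.induction_on with
  | zero => exact zero γ
  | add p q _ _ hp hq => exact add p q γ hp hq
  | monomial d r hd =>
    simpa only [C_mul_monomial, mul_one, zero_add, hd] using mul _ _ _ _ (C r) (monomial_one d)

theorem isWeightedHomogeneous_derivation {D : Derivation k (MvPolynomial σ k) (MvPolynomial σ k)}
    {f : MvPolynomial σ k} {γ δ : M} (hD : ∀ s, IsWeightedHomogeneous w (D (X s)) (w s + δ))
    (hf : IsWeightedHomogeneous w f γ) : IsWeightedHomogeneous w (D f) (γ + δ) := by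
  suffices h : IsWeightedHomogeneous w f γ ∧ IsWeightedHomogeneous w (D f) (γ + δ) from h.2
  refine isWeightedHomogeneous_induction
    (motive := fun f γ => IsWeightedHomogeneous w f γ ∧ IsWeightedHomogeneous w (D f) (γ + δ))
    (fun γ => ?_) (fun f g γ hf hg => ?_) (fun r => ?_)
    (fun s => ⟨isWeightedHomogeneous_X k w s, hD s⟩)
    (fun f g γ γ' hf hg => ⟨hf.1.mul hg.1, ?_⟩) hf
  · simpa only [map_zero] using
      ⟨isWeightedHomogeneous_zero k w γ, isWeightedHomogeneous_zero k w (γ + δ)⟩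
  · simpa only [map_add] using ⟨hf.1.add hg.1, hf.2.add hg.2⟩
  · simpa only [derivation_C] using
      ⟨isWeightedHomogeneous_C w r, isWeightedHomogeneous_zero k w (0 + δ)⟩
  · have hfg := hf.1.mul hg.2
    have hgf := hg.1.mul hf.2
    rw [← add_assoc] at hfg
    rw [add_left_comm, ← add_assoc] at hgf
    rw [D.leibniz, smul_eq_mul, smul_eq_mul]
    exact hfg.add hgf

theorem isGradedBracket_of_X {π : PoissonBracket k (MvPolynomial σ k)}
    (h : ∀ s t, IsWeightedHomogeneous w (π.br (X s) (X t)) (w s + w t)) :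
    IsGradedBracket π (weightedHomogeneousSubmodule k w) := by
  intro γ δ f g hf hg
  rw [add_comm]
  refine isWeightedHomogeneous_derivation (D := π.ad f) (fun t => ?_) hg
  rw [π.ad_apply, π.antisymm, ← π.ad_apply, add_comm]
  exact (isWeightedHomogeneous_derivation (fun s => add_comm (w t) (w s) ▸ h t s) hf).neg

/-- The derivation of `k[X_s | s]` which multiplies the polynomials of weight `γ` by `ℓ γ`. For the
weights of a torus, these are the derivations by which its Lie algebra acts. -/
noncomputable def weightDerivation (ℓ : M →+ k) (w : σ → M) :
    Derivation k (MvPolynomial σ k) (MvPolynomial σ k) :=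
  mkDerivation k fun s => ℓ (w s) • X s

variable {ℓ : M →+ k}

theorem weightDerivation_X (s : σ) : weightDerivation ℓ w (X s) = ℓ (w s) • X s :=
  mkDerivation_X _ _ _

theorem weightDerivation_eq_smul {f : MvPolynomial σ k} {γ : M}
    (hf : IsWeightedHomogeneous w f γ) : weightDerivation ℓ w f = ℓ γ • f := by
  refine isWeightedHomogeneous_induction (motive := fun f γ => weightDerivation ℓ w f = ℓ γ • f)
    (fun γ => ?_) (fun f g γ hf hg => ?_) (fun r => ?_) weightDerivation_X
    (fun f g γ δ hf hg => ?_) hf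
  · rw [map_zero, smul_zero]
  · rw [map_add, hf, hg, smul_add]
  · rw [derivation_C, map_zero, zero_smul]
  · simp only [Derivation.leibniz, hf, hg, map_add, add_smul, smul_eq_mul, mul_smul_comm]
    rw [mul_comm g, add_comm]

variable [DecidableEq M]

attribute [local instance] weightedGradedAlgebra

theorem weightDerivation_mem {P : Ideal (MvPolynomial σ k)}
    (hP : P.IsHomogeneous (weightedHomogeneousSubmodule k w)) {f : MvPolynomial σ k} (hf : f ∈ P) :
    weightDerivation ℓ w f ∈ P := by
  rw [← sum_weightedHomogeneousComponent w f,
    finsum_eq_sum _ (weightedHomogeneousComponent_finsupp f), map_sum]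
  refine P.sum_mem fun γ _ => ?_
  rw [weightDerivation_eq_smul (weightedHomogeneousComponent_isWeightedHomogeneous γ f)]
  exact P.smul_of_tower_mem _ (weightedHomogeneousComponent_mem_of_mem k w hP hf γ)

end Weights

section IteratedExtensions

variable {k σ M α : Type*} [Field k] [AddCommMonoid M] [LinearOrder α]
  {π : PoissonBracket k (MvPolynomial σ k)} {w : σ → M} {rk : σ → α} {e : σ → M →+ k}

theorem derivation_mem_adjoin_of_forall_mem {A : Type*} [CommRing A] [Algebra k A] {S : Set A}
    {D : Derivation k A A} (h : ∀ a ∈ S, D a ∈ Algebra.adjoin k S) {f : A}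
    (hf : f ∈ Algebra.adjoin k S) : D f ∈ Algebra.adjoin k S := by
  induction hf using Algebra.adjoin_induction with
  | mem a ha => exact h a ha
  | algebraMap r => rw [D.map_algebraMap]; exact zero_mem _
  | add a b _ _ ha hb => rw [map_add]; exact add_mem ha hb
  | mul a b ha' hb' ha hb => rw [D.leibniz]; exact add_mem (mul_mem ha' hb) (mul_mem hb' ha)

theorem derivation_mem_supported {S : Set σ}
    {D : Derivation k (MvPolynomial σ k) (MvPolynomial σ k)}
    (h : ∀ s ∈ S, D (X s) ∈ supported k S) {f : MvPolynomial σ k} (hf : f ∈ supported k S) :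
    D f ∈ supported k S :=
  derivation_mem_adjoin_of_forall_mem (Set.forall_mem_image.2 h) hf

theorem br_mem_supported {S : Set σ} (h : ∀ s ∈ S, ∀ t ∈ S, π.br (X s) (X t) ∈ supported k S)
    {a b : MvPolynomial σ k} (ha : a ∈ supported k S) (hb : b ∈ supported k S) :
    π.br a b ∈ supported k S := by
  refine derivation_mem_supported (D := π.ad a) (fun t ht => ?_) hb
  rw [π.ad_apply, π.antisymm]
  exact neg_mem (derivation_mem_supported (D := π.ad (X t)) (h t ht) ha)

/-- The Poisson algebra `k[X_s | s]` is an iterated Poisson–Ore extension, the variables being added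
in the order of `rk`. The step which adds `X s` is twisted by `weightDerivation (e s) w`, which is
nonzero at `X s`. -/
structure IsIteratedPoissonExtension (π : PoissonBracket k (MvPolynomial σ k)) (w : σ → M)
    (rk : σ → α) (e : σ → M →+ k) : Prop where
  injective : Function.Injective rk
  br_sub_mem : ∀ s t, rk t < rk s →
    π.br (X s) (X t) - C (e s (w t)) * X t * X s ∈ supported k {u | rk u < rk s}
  ne_zero : ∀ s, e s (w s) ≠ 0

namespace IsIteratedPoissonExtension

variable (h : IsIteratedPoissonExtension π w rk e)

include h

theorem br_mem_supported {a b : MvPolynomial σ k} (m : α) (ha : a ∈ supported k {u | rk u < m})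
    (hb : b ∈ supported k {u | rk u < m}) : π.br a b ∈ supported k {u | rk u < m} := by
  have br_mem_of_lt (s t : σ) (hs : rk s < m) (hts : rk t < rk s) :
      π.br (X s) (X t) ∈ supported k {u | rk u < m} := by
    have hδ := supported_mono (fun _ hu => lt_trans hu hs) (h.br_sub_mem s t hts)
    rw [← sub_add_cancel (π.br (X s) (X t)) (C (e s (w t)) * X t * X s)]
    exact add_mem hδ (mul_mem (mul_mem (Subalgebra.algebraMap_mem _ _)
      (X_mem_supported.2 (hts.trans hs))) (X_mem_supported.2 hs))
  refine PoissonDME.br_mem_supported (fun s hs t ht => ?_) ha hb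
  rcases lt_trichotomy (rk s) (rk t) with hst | hst | hst
  · rw [π.antisymm]
    exact neg_mem (br_mem_of_lt t s ht hst)
  · rw [h.injective hst, π.self_eq_zero]
    exact zero_mem _
  · exact br_mem_of_lt s t hs hst

theorem isPoissonExtension (s : σ) : IsPoissonExtension π (supported k {u | rk u < rk s}) (X s)
    (weightDerivation (e s) w) (e s (w s)) where
  br_mem _ ha _ hb := h.br_mem_supported _ ha hb
  eta_mem b hb := by
    refine derivation_mem_supported (fun t ht => ?_) hb
    rw [weightDerivation_X]
    exact Subalgebra.smul_mem _ (X_mem_supported.2 ht) _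
  eta_self := weightDerivation_X s
  delta_mem b hb := by
    rw [mul_comm]
    refine derivation_mem_supported
      (D := π.ad (X s) - (X s : MvPolynomial σ k) • weightDerivation (e s) w) (fun t ht => ?_) hb
    convert h.br_sub_mem s t ht using 1
    rw [Derivation.sub_apply, Derivation.smul_apply, weightDerivation_X, π.ad_apply, smul_eq_mul,
      smul_eq_C_mul, mul_comm (X s)]
  ne_zero := h.ne_zero s

end IsIteratedPoissonExtension

theorem algebraMap_mem_iff_of_isPrime {A : Type*} [CommRing A] [Algebra k A] {P : Ideal A}
    [P.IsPrime] {c : k} : algebraMap k A c ∈ P ↔ c = 0 := by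
  rw [← Ideal.mem_comap, Ideal.eq_bot_of_prime (P.comap (algebraMap k A)), Ideal.mem_bot]

theorem supported_insert_le_adjoin (S : Set σ) (s : σ) {f : MvPolynomial σ k}
    (hf : f ∈ supported k (insert s S)) : f ∈ Algebra.adjoin (supported k S) {X s} := by
  rw [supported_eq_adjoin_X, Set.image_insert_eq, Set.insert_eq, Set.union_comm,
    Algebra.adjoin_union_eq_adjoin_adjoin] at hf
  exact hf

variable [DecidableEq M]

attribute [local instance] weightedGradedAlgebra

namespace IsIteratedPoissonExtension

theorem injOn_isAlgebraicMod [CharZero k] [Finite σ] (h : IsIteratedPoissonExtension π w rk e) :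
    Set.InjOn (fun P => {s | IsAlgebraicMod (supported k {u | rk u < rk s}) (X s) P})
      {P | IsPoissonPrime π P ∧ P.IsHomogeneous (weightedHomogeneousSubmodule k w)} := by
  classical
  cases nonempty_fintype σ
  intro P ⟨hP, hPw⟩ P' ⟨hP', hPw'⟩ hPP'
  have := hP.1
  have := hP'.1
  have mem_iff (S : Finset σ) : (∀ s ∈ S, ∀ u, rk u < rk s → u ∈ S) →
      ∀ f ∈ supported k (S : Set σ), (f ∈ P ↔ f ∈ P') := by
    induction S using Finset.induction_on_max_value rk with
    | empty =>
      intro _ f hf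
      rw [Finset.coe_empty, supported_empty, Algebra.mem_bot] at hf
      obtain ⟨c, rfl⟩ := hf
      rw [algebraMap_mem_iff_of_isPrime, algebraMap_mem_iff_of_isPrime]
    | insert s S hs hmax ih =>
      intro hlower f hf
      have hS : (S : Set σ) = {u | rk u < rk s} := by
        ext u
        refine ⟨fun hu => (hmax u hu).lt_of_ne fun hus => hs (h.injective hus ▸ hu), fun hu => ?_⟩
        exact (Finset.mem_insert.1 (hlower s (Finset.mem_insert_self s S) u hu)).resolve_left
          fun hus => (hus ▸ hu : rk s < rk s).false
      have ihS := ih fun t ht u hu => hS.symm.subset (hu.trans_le (hmax t ht))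
      rw [Finset.coe_insert] at hf
      have hf := supported_insert_le_adjoin _ s hf
      rw [hS] at hf ihS
      have hiff := Set.ext_iff.1 hPP' s
      exact ⟨(h.isPoissonExtension s).mem_of_isAlgebraicMod_iff hP
          (fun _ => weightDerivation_mem hPw) hP' (fun _ => weightDerivation_mem hPw') ihS hiff hf,
        (h.isPoissonExtension s).mem_of_isAlgebraicMod_iff hP' (fun _ => weightDerivation_mem hPw')
          hP (fun _ => weightDerivation_mem hPw) (fun a ha => (ihS a ha).symm) hiff.symm hf⟩
  ext f
  exact mem_iff Finset.univ (fun _ _ u _ => Finset.mem_univ u) f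
    (by rw [Finset.coe_univ, supported_univ]; trivial)

theorem finite_isHomogeneous [CharZero k] [Finite σ] (h : IsIteratedPoissonExtension π w rk e) :
    {P | IsPoissonPrime π P ∧ P.IsHomogeneous (weightedHomogeneousSubmodule k w)}.Finite :=
  Set.Finite.of_injOn (Set.mapsTo_univ _ _) h.injOn_isAlgebraicMod Set.finite_univ

theorem ncard_isHomogeneous_le [CharZero k] [Finite σ] (h : IsIteratedPoissonExtension π w rk e) :
    {P | IsPoissonPrime π P ∧ P.IsHomogeneous (weightedHomogeneousSubmodule k w)}.ncard ≤
      2 ^ Nat.card σ := by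
  classical
  cases nonempty_fintype σ
  refine (Set.ncard_le_ncard_of_injOn _ (fun _ _ => Set.mem_univ _)
    h.injOn_isAlgebraicMod Set.finite_univ).trans_eq ?_
  rw [Set.ncard_univ, Nat.card_eq_fintype_card, Fintype.card_set, Nat.card_eq_fintype_card]

end IsIteratedPoissonExtension

end IteratedExtensions

section TorusActions

variable {k σ : Type*} [Field k] {r : ℕ}

/-- The character `h ↦ h₁ ^ γ₁ ⋯ h_r ^ γ_r` of the torus `(kˣ)^r`. The weights `γ` are ordered
lexicographically. -/
def torusCharacter (k : Type*) [Field k] {r : ℕ} (γ : Lex (Fin r → ℤ)) : (Fin r → kˣ) →* kˣ :=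
  ∏ i, (zpowGroupHom (ofLex γ i)).comp (Pi.evalMonoidHom _ i)

theorem torusCharacter_apply (γ : Lex (Fin r → ℤ)) (h : Fin r → kˣ) :
    torusCharacter k γ h = ∏ i, h i ^ ofLex γ i :=
  MonoidHom.finsetProd_apply _ _ _

theorem torusCharacter_zero : torusCharacter k (0 : Lex (Fin r → ℤ)) = 1 := by
  refine MonoidHom.ext fun h => ?_
  simp only [torusCharacter_apply, ofLex_zero, Pi.zero_apply, zpow_zero, Finset.prod_const_one,
    MonoidHom.one_apply]

theorem torusCharacter_add (γ δ : Lex (Fin r → ℤ)) :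
    torusCharacter k (γ + δ) = torusCharacter k γ * torusCharacter k δ := by
  refine MonoidHom.ext fun h => ?_
  simp only [torusCharacter_apply, ofLex_add, Pi.add_apply, zpow_add, Finset.prod_mul_distrib,
    MonoidHom.mul_apply]

theorem torusCharacter_neg (γ : Lex (Fin r → ℤ)) :
    torusCharacter k (-γ) = (torusCharacter k γ)⁻¹ := by
  refine MonoidHom.ext fun h => ?_
  simp only [torusCharacter_apply, ofLex_neg, Pi.neg_apply, zpow_neg, Finset.prod_inv_distrib,
    MonoidHom.inv_apply]

theorem torusCharacter_mulSingle (γ : Lex (Fin r → ℤ)) (i : Fin r) (u : kˣ) :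
    torusCharacter k γ (Pi.mulSingle i u) = u ^ ofLex γ i := by
  rw [torusCharacter_apply, Finset.prod_eq_single i (fun j _ hj => ?_) (by simp),
    Pi.mulSingle_eq_same]
  rw [Pi.mulSingle_eq_of_ne hj, one_zpow]

theorem torusCharacter_injective [CharZero k] :
    Function.Injective (torusCharacter k : Lex (Fin r → ℤ) → (Fin r → kˣ) →* kˣ) := by
  intro γ δ h
  refine ofLex.injective (funext fun i => ?_)
  have two_zpow := congrArg Units.val
    (DFunLike.congr_fun h (Pi.mulSingle i (Units.mk0 (2 : k) two_ne_zero)))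
  simp only [torusCharacter_mulSingle, Units.val_zpow_eq_zpow_val, Units.val_mk0] at two_zpow
  refine zpow_right_injective₀ (a := (2 : ℚ)) two_pos (by norm_num) ?_
  exact Rat.cast_injective (α := k) (by push_cast; exact two_zpow)

/-- The weight of the `i`-th coordinate character of the torus. -/
def unitWeight (i : Fin r) : Lex (Fin r → ℤ) :=
  toLex (Pi.single i 1)

theorem torusCharacter_unitWeight (i : Fin r) (h : Fin r → kˣ) :
    torusCharacter k (unitWeight i) h = h i := by
  rw [torusCharacter_apply, Finset.prod_eq_single i (fun j _ hj => ?_) (by simp)]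
  · rw [unitWeight, ofLex_toLex, Pi.single_eq_same, zpow_one]
  · rw [unitWeight, ofLex_toLex, Pi.single_eq_of_ne hj, zpow_zero]

theorem torusCharacter_unitWeight_add_unitWeight (i j : Fin r) (h : Fin r → kˣ) :
    torusCharacter k (unitWeight i + unitWeight j) h = h i * h j := by
  rw [torusCharacter_add, MonoidHom.mul_apply, torusCharacter_unitWeight,
    torusCharacter_unitWeight]

/-- The derivative of the character of weight `γ` at the element `e` of the Lie algebra of the
torus, as a function of `γ`. -/
def lieWeight (e : Fin r → k) : Lex (Fin r → ℤ) →+ k where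
  toFun γ := ∑ i, e i * (ofLex γ i : k)
  map_zero' := by
    simp only [ofLex_zero, Pi.zero_apply, Int.cast_zero, mul_zero, Finset.sum_const_zero]
  map_add' γ δ := by
    simp only [ofLex_add, Pi.add_apply, Int.cast_add, mul_add, Finset.sum_add_distrib]

theorem lieWeight_unitWeight (e : Fin r → k) (i : Fin r) : lieWeight e (unitWeight i) = e i := by
  change ∑ j, e j * ((Pi.single i 1 : Fin r → ℤ) j : k) = e i
  rw [Finset.sum_eq_single i (fun j _ hj => ?_) (by simp), Pi.single_eq_same, Int.cast_one,
    mul_one]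
  rw [Pi.single_eq_of_ne hj, Int.cast_zero, mul_zero]

variable {w : σ → Lex (Fin r → ℤ)} {χ : (Fin r → kˣ) →* (σ → kˣ)}
  {π : PoissonBracket k (MvPolynomial σ k)}

theorem scalingAction_of_isWeightedHomogeneous (hχ : ∀ h s, χ h s = torusCharacter k (w s) h)
    {f : MvPolynomial σ k} {γ : Lex (Fin r → ℤ)} (hf : IsWeightedHomogeneous w f γ)
    (h : Fin r → kˣ) : scalingAction χ h f = (torusCharacter k γ h : k) • f := by
  refine isWeightedHomogeneous_induction
    (motive := fun f γ => scalingAction χ h f = (torusCharacter k γ h : k) • f)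
    (fun γ => ?_) (fun f g γ hf hg => ?_) (fun c => ?_) (fun s => ?_) (fun f g γ δ hf hg => ?_) hf
  · rw [map_zero, smul_zero]
  · rw [map_add, hf, hg, smul_add]
  · rw [torusCharacter_zero, MonoidHom.one_apply, Units.val_one, one_smul, ← algebraMap_eq]
    exact (scalingAction χ h).commutes c
  · rw [scalingAction_X, hχ, C_mul']
  · rw [map_mul, hf, hg, torusCharacter_add, MonoidHom.mul_apply, Units.val_mul,
      smul_mul_smul_comm]

theorem scalingAction_eq_sum (hχ : ∀ h s, χ h s = torusCharacter k (w s) h) (h : Fin r → kˣ)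
    {f : MvPolynomial σ k}
    (hfin : (Function.support fun γ => weightedHomogeneousComponent w γ f).Finite) :
    scalingAction χ h f = ∑ γ ∈ hfin.toFinset,
      (torusCharacter k γ h : k) • weightedHomogeneousComponent w γ f := by
  conv_lhs => rw [← sum_weightedHomogeneousComponent w f, finsum_eq_sum _ hfin, map_sum]
  exact Finset.sum_congr rfl fun γ _ => scalingAction_of_isWeightedHomogeneous hχ
    (weightedHomogeneousComponent_isWeightedHomogeneous γ f) h

theorem weightedHomogeneousComponent_mem_of_stable [CharZero k]
    (hχ : ∀ h s, χ h s = torusCharacter k (w s) h) {V : Submodule k (MvPolynomial σ k)}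
    (hV : ∀ h, ∀ f ∈ V, scalingAction χ h f ∈ V) {f : MvPolynomial σ k} (hf : f ∈ V)
    (γ : Lex (Fin r → ℤ)) : weightedHomogeneousComponent w γ f ∈ V := by
  by_contra hγ
  obtain ⟨φ, hφ, hφV⟩ := Submodule.exists_le_ker_of_notMem hγ
  have hfin : (Function.support fun δ => weightedHomogeneousComponent w δ f).Finite :=
    weightedHomogeneousComponent_finsupp f
  -- Dedekind: distinct characters of the torus are linearly independent.
  have characters_independent := (linearIndependent_monoidHom (Fin r → kˣ) k).comp
    (fun γ : Lex (Fin r → ℤ) => (Units.coeHom k).comp (torusCharacter k γ))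
    fun γ δ h => torusCharacter_injective
      (MonoidHom.ext fun x => Units.ext (DFunLike.congr_fun h x))
  refine hφ (linearIndependent_iff'.1 characters_independent hfin.toFinset
    (fun δ => φ (weightedHomogeneousComponent w δ f)) ?_ γ ?_)
  · funext h
    have hφh : φ (scalingAction χ h f) = 0 := hφV (hV h f hf)
    rw [scalingAction_eq_sum hχ h hfin, map_sum] at hφh
    rw [Finset.sum_apply, Pi.zero_apply, ← hφh]
    refine Finset.sum_congr rfl fun δ _ => ?_
    rw [map_smul, smul_eq_mul, mul_comm]
    rfl
  · rw [Set.Finite.mem_toFinset, Function.mem_support]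
    exact fun h => hγ (h ▸ V.zero_mem)

attribute [local instance] weightedGradedAlgebra

theorem stablePoissonPrimes_scalingAction [CharZero k]
    (hχ : ∀ h s, χ h s = torusCharacter k (w s) h) :
    stablePoissonPrimes π (scalingAction χ) =
      {P | IsPoissonPrime π P ∧ P.IsHomogeneous (weightedHomogeneousSubmodule k w)} := by
  ext P
  refine and_congr_right fun _ => ⟨fun hP γ f hf => ?_, fun hP h f hf => ?_⟩
  · rw [← DirectSum.Decomposition.decompose'_eq, weightedDecomposition.decompose'_apply]
    exact weightedHomogeneousComponent_mem_of_stable hχ (V := P.restrictScalars k) hP hf γ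
  · rw [scalingAction_eq_sum hχ h (weightedHomogeneousComponent_finsupp f)]
    exact P.sum_mem fun γ _ => P.smul_of_tower_mem _
      (weightedHomogeneousComponent_mem_of_mem k w hP hf γ)

theorem isRationalPoissonAction_scalingAction (hχ : ∀ h s, χ h s = torusCharacter k (w s) h)
    (hw : ∀ s t, IsWeightedHomogeneous w (π.br (X s) (X t)) (w s + w t)) :
    IsRationalPoissonAction π (scalingAction χ) := by
  refine ⟨?_, fun h a b => ?_⟩
  · rw [IsRationalAction, eq_top_iff, ← adjoin_range_X]
    refine Algebra.adjoin_mono ?_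
    rintro _ ⟨s, rfl⟩
    refine ⟨ofLex (w s), fun h => ?_⟩
    rw [scalingAction_X, hχ, C_mul', torusCharacter_apply]
  · induction a using MvPolynomial.induction_on' with
    | add p q hp hq => simp only [map_add, LinearMap.add_apply, hp, hq]
    | monomial d c =>
      induction b using MvPolynomial.induction_on' with
      | add p q hp hq => simp only [map_add, hp, hq]
      | monomial d' c' =>
        have hd := isWeightedHomogeneous_monomial w d c rfl
        have hd' := isWeightedHomogeneous_monomial w d' c' rfl
        rw [scalingAction_of_isWeightedHomogeneous hχ (isGradedBracket_of_X hw hd hd'),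
          scalingAction_of_isWeightedHomogeneous hχ hd,
          scalingAction_of_isWeightedHomogeneous hχ hd', torusCharacter_add, MonoidHom.mul_apply,
          Units.val_mul, map_smul, LinearMap.map_smul₂, smul_smul, mul_comm]

end TorusActions

section BracketTables

variable {k σ α : Type*} [Field k] {r : ℕ} {w : σ → Lex (Fin r → ℤ)}

theorem isWeightedHomogeneous_C_mul_X_mul_X (a : k) {s t : σ} {γ : Lex (Fin r → ℤ)}
    (h : w s + w t = γ) : IsWeightedHomogeneous w (C a * X s * X t) γ := by
  rw [mul_assoc, ← h]
  exact ((isWeightedHomogeneous_X k w s).mul (isWeightedHomogeneous_X k w t)).C_mul a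

theorem C_mul_X_mul_X_mem_supported {S : Set σ} (a : k) {s t : σ} (hs : s ∈ S) (ht : t ∈ S) :
    C a * X s * X t ∈ supported k S :=
  mul_mem (mul_mem (Subalgebra.algebraMap_mem _ a) (X_mem_supported.2 hs)) (X_mem_supported.2 ht)

/-- The values `c s t` prescribed for the brackets `{X s, X t}` satisfy the Lie algebra axioms, are
homogeneous for the weights `w` of an action of a torus, and make `k[X_s | s]` an iterated
Poisson–Ore extension in the order of `rk`, where the step which adds `X s` is twisted by the action
of the element `e s` of the Lie algebra of the torus. -/
structure IsTorusPoissonTable [LT α] (c : σ → σ → MvPolynomial σ k)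
    (w : σ → Lex (Fin r → ℤ)) (rk : σ → α) (e : σ → Fin r → k) : Prop where
  antisymm : ∀ s t, c s t = -c t s
  jacobi : ∀ s t u, mkDerivation k (c s) (c t u) + mkDerivation k (c t) (c u s) +
    mkDerivation k (c u) (c s t) = 0
  isWeightedHomogeneous : ∀ s t, IsWeightedHomogeneous w (c s t) (w s + w t)
  injective : Function.Injective rk
  sub_mem : ∀ s t, rk t < rk s →
    c s t - C (lieWeight (e s) (w t)) * X t * X s ∈ supported k {u | rk u < rk s}
  ne_zero : ∀ s, lieWeight (e s) (w s) ≠ 0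

namespace IsTorusPoissonTable

variable [LinearOrder α] {c : σ → σ → MvPolynomial σ k} {rk : σ → α} {e : σ → Fin r → k}
  (h : IsTorusPoissonTable c w rk e)

include h

theorem existsUnique_poissonBracket [NeZero (2 : k)] :
    ∃! π : PoissonBracket k (MvPolynomial σ k), ∀ s t, π.br (X s) (X t) = c s t := by
  obtain ⟨π, hπ⟩ := exists_poissonBracket_X c h.antisymm h.jacobi
  exact ⟨π, hπ, fun π' hπ' => poissonBracket_ext_X fun s t => by rw [hπ', hπ]⟩

variable {π : PoissonBracket k (MvPolynomial σ k)}

theorem isIteratedPoissonExtension (hπ : ∀ s t, π.br (X s) (X t) = c s t) :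
    IsIteratedPoissonExtension π w rk fun s => lieWeight (e s) where
  injective := h.injective
  br_sub_mem s t hst := hπ s t ▸ h.sub_mem s t hst
  ne_zero := h.ne_zero

attribute [local instance] weightedGradedAlgebra

theorem existsUnique_and_poissonDixmierMoeglin [CharZero k] [Finite σ]
    {IsBr : PoissonBracket k (MvPolynomial σ k) → Prop} {χ : (Fin r → kˣ) →* (σ → kˣ)} {N : ℕ}
    (hIs : ∀ π, IsBr π ↔ ∀ s t, π.br (X s) (X t) = c s t)
    (hχ : ∀ h s, χ h s = torusCharacter k (w s) h) (hN : Nat.card σ = N) :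
    (∃! π, IsBr π) ∧ ∀ π, IsBr π → IsRationalPoissonAction π (scalingAction χ) ∧
      (stablePoissonPrimes π (scalingAction χ)).Finite ∧
      (stablePoissonPrimes π (scalingAction χ)).ncard ≤ 2 ^ N ∧ PoissonDixmierMoeglin π := by
  refine ⟨(existsUnique_congr hIs).2 h.existsUnique_poissonBracket, fun π hIsπ => ?_⟩
  have hπ := (hIs π).1 hIsπ
  have hw : ∀ s t, IsWeightedHomogeneous w (π.br (X s) (X t)) (w s + w t) := fun s t =>
    hπ s t ▸ h.isWeightedHomogeneous s t
  have extension := h.isIteratedPoissonExtension hπ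
  rw [stablePoissonPrimes_scalingAction hχ]
  refine ⟨isRationalPoissonAction_scalingAction hχ hw, ?_, ?_, ?_⟩
  · exact extension.finite_isHomogeneous
  · rw [← hN]
    exact extension.ncard_isHomogeneous_le
  · refine poissonDixmierMoeglin_of_finite_homogeneous (isGradedBracket_of_X hw) ?_
    -- The two sets only differ in the instance `DecidableEq (Lex (Fin r → ℤ))`.
    convert extension.finite_isHomogeneous

end IsTorusPoissonTable

end BracketTables

section Signs

variable {n : ℕ}

theorem sgn_swap (a b : Fin n) : sgn b a = -sgn a b := by
  rw [sgn, sgn, ← Int.sign_neg, neg_sub]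

theorem sgn_self (a : Fin n) : sgn a a = 0 := by
  rw [sgn, sub_self, Int.sign_zero]

theorem sgn_of_lt {a b : Fin n} (h : a < b) : sgn a b = -1 :=
  Int.sign_eq_neg_one_of_neg (sub_neg_of_lt (Nat.cast_lt.2 h))

theorem sgn_of_gt {a b : Fin n} (h : b < a) : sgn a b = 1 :=
  Int.sign_eq_one_of_pos (sub_pos_of_lt (Nat.cast_lt.2 h))

theorem sgn_mul_cyclic_sum (a b c : Fin n) :
    (a = b ∧ b = c) ∨ sgn a b * sgn b c + sgn b c * sgn c a + sgn c a * sgn a b = -1 := by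
  rcases lt_trichotomy a b with hab | hab | hab <;>
  rcases lt_trichotomy b c with hbc | hbc | hbc <;>
  rcases lt_trichotomy a c with hac | hac | hac <;>
  first
  | exfalso; order
  | exact Or.inl ⟨hab, hbc⟩
  | exact Or.inr (by simp [sgn_swap a c, *, sgn_of_lt, sgn_of_gt, sgn_self])

/-- Up to terms which vanish by commutativity, the cyclic sum of signs does not depend on the three
indices. This is the relation between signs behind all Jacobi identities for matrix algebras. -/
theorem sgn_mul_cyclic_sum_sub_mul {A : Type*} [CommRing A] {m : ℕ} (y : Fin n → Fin m → A)
    (a c e : Fin n) (b d f : Fin m) :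
    (((sgn a c * sgn c e + sgn c e * sgn e a + sgn e a * sgn a c : ℤ) : A) -
      ((sgn b d * sgn d f + sgn d f * sgn f b + sgn f b * sgn b d : ℤ) : A)) *
      (y a d * y c f * y e b - y a f * y c b * y e d) = 0 := by
  rcases sgn_mul_cyclic_sum a c e with ⟨rfl, rfl⟩ | hrow
  · ring
  rcases sgn_mul_cyclic_sum b d f with ⟨rfl, rfl⟩ | hcol
  · ring
  rw [hrow, hcol, sub_self, zero_mul]

end Signs

section Jacobi

variable {k A : Type*} [Field k] [CommRing A] [Algebra k A] {n : ℕ}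

theorem jacobi_matrix {y : Fin n → Fin n → A} {h : k} {τ τ' : Fin n → Fin n → k}
    (hτ : ∀ i j, τ j i = -τ i j) (hτ' : ∀ i j, τ' j i = -τ' i j)
    {D : Fin n → Fin n → Derivation k A A}
    (hD : ∀ l m i j, D l m (y i j) = algebraMap k A (τ l i + τ' m j) * y i j * y l m +
      algebraMap k A h * ((sgn l i + sgn m j : ℤ) : A) * y i m * y l j) (a b c d e f : Fin n) :
    D a b (D c d (y e f)) + D c d (D e f (y a b)) + D e f (D a b (y c d)) = 0 := by
  have signs := sgn_mul_cyclic_sum_sub_mul y a c e b d f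
  simp only [hD, map_add, Derivation.leibniz, Derivation.map_algebraMap, Derivation.map_intCast,
    smul_eq_mul]
  rw [hτ c a, hτ e a, hτ e c, hτ' d b, hτ' f b, hτ' f d, sgn_swap a c, sgn_swap a e, sgn_swap c e,
    sgn_swap b d, sgn_swap b f, sgn_swap d f]
  rw [sgn_swap a e, sgn_swap b f] at signs
  push_cast at signs ⊢
  linear_combination -(algebraMap k A h) ^ 2 * signs

theorem jacobi_symmetric {y : Fin n → Fin n → A} {ε : ℤ} (hε : ε * ε = 1)
    (hy : ∀ i j, y j i = ε * y i j) {D : Fin n → Fin n → Derivation k A A}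
    (hD : ∀ i j l m, D i j (y l m) = ((sgn l j + sgn m i : ℤ) : A) * y i l * y j m +
      ε * ((sgn l i + sgn m j : ℤ) : A) * y i m * y j l) (a b c d e f : Fin n) :
    D a b (D c d (y e f)) + D c d (D e f (y a b)) + D e f (D a b (y c d)) = 0 := by
  have signs₁ := sgn_mul_cyclic_sum_sub_mul y a c e b d f
  have signs₂ := sgn_mul_cyclic_sum_sub_mul y b c e a d f
  have signs₃ := sgn_mul_cyclic_sum_sub_mul y a d e b c f
  have signs₄ := sgn_mul_cyclic_sum_sub_mul y a c f b d e
  simp only [hD, map_add, Derivation.leibniz, Derivation.map_intCast, smul_eq_mul]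
  simp only [hy a c, hy a d, hy a e, hy a f, hy b c, hy b d, hy b e, hy b f, hy c e, hy c f,
    hy d e, hy d f] at signs₁ signs₂ signs₃ signs₄ ⊢
  simp only [sgn_swap a c, sgn_swap a d, sgn_swap a e, sgn_swap a f, sgn_swap b c, sgn_swap b d,
    sgn_swap b e, sgn_swap b f, sgn_swap c e, sgn_swap c f,
    sgn_swap d e, sgn_swap d f] at signs₁ signs₂ signs₃ signs₄ ⊢
  push_cast at signs₁ signs₂ signs₃ signs₄ ⊢
  rcases mul_self_eq_one_iff.1 hε with rfl | rfl
  · push_cast at signs₁ signs₂ signs₃ signs₄ ⊢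
    linear_combination -signs₁ - signs₂ - signs₃ - signs₄
  · push_cast at signs₁ signs₂ signs₃ signs₄ ⊢
    linear_combination -signs₁ + signs₂ + signs₃ + signs₄

theorem jacobi_log {σ : Type*} {y : σ → A} {a : σ → σ → k} {o : σ → σ → A}
    {D : σ → Derivation k A A} (ha : ∀ s t, a t s = -a s t) (ho : ∀ s t, o t s = -o s t)
    (hD : ∀ s t, D s (y t) = algebraMap k A (a s t) * y s * y t + o s t)
    (hself : ∀ s, D s (y s) = 0)
    (hDo : ∀ s t u, s ≠ t → s ≠ u → D s (o t u) = algebraMap k A (a s t + a s u) * y s * o t u)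
    (s t u : σ) : D s (D t (y u)) + D t (D u (y s)) + D u (D s (y t)) = 0 := by
  have hanti (s t : σ) : D t (y s) = -D s (y t) := by
    rw [hD, hD, ha, ho, map_neg]
    ring
  rcases eq_or_ne s t with rfl | hst
  · rw [hself, map_zero, add_zero, ← map_add, hanti s u, add_neg_cancel, map_zero]
  rcases eq_or_ne s u with rfl | hsu
  · rw [hself, map_zero, add_zero, ← map_add, hanti s t, neg_add_cancel, map_zero]
  rcases eq_or_ne t u with rfl | htu
  · rw [hself, map_zero, zero_add, ← map_add, hanti s t, neg_add_cancel, map_zero]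
  simp only [hD, map_add, Derivation.leibniz, Derivation.map_algebraMap, smul_eq_mul,
    hDo s t u hst hsu, hDo t u s htu hst.symm, hDo u s t hsu.symm htu.symm]
  rw [ha s t, ha t u, ha s u, ho t s, ho u s, ho u t]
  simp only [map_neg]
  ring

theorem derivation_add_sum_of_forall {ι : Type*} {D : Derivation k A A} {t : ι → A} {ω p u : A}
    {s : Finset ι} (hω : D ω = p * u * ω) (ht : ∀ l ∈ s, D (t l) = p * u * t l) :
    D (ω + ∑ l ∈ s, t l) = p * u * (ω + ∑ l ∈ s, t l) := by
  rw [map_add, map_sum, hω, Finset.sum_congr rfl ht, ← Finset.mul_sum, mul_add]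

/-- The value of `D` on `t j` makes up for the terms before `j`, on which `D` acts by `p` instead of
`q`. -/
theorem derivation_add_sum_Iio {D : Derivation k A A} {t : Fin n → A} {ω u p q : A} {j : Fin n}
    (hω : D ω = p * u * ω) (hlt : ∀ l < j, D (t l) = p * u * t l)
    (hgt : ∀ l, j < l → D (t l) = q * u * t l)
    (hj : D (t j) = u * (q * t j + (q - p) * (ω + ∑ l ∈ Finset.Iio j, t l))) (i : Fin n) :
    D (ω + ∑ l ∈ Finset.Iio i, t l) =
      (if j < i then q else p) * u * (ω + ∑ l ∈ Finset.Iio i, t l) := by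
  split_ifs with hji
  · have hsplit (f : Fin n → A) :
        ∑ l ∈ Finset.Iio i, f l = ∑ l ∈ Finset.Iio j, f l + f j + ∑ l ∈ Finset.Ioo j i, f l := by
      rw [Finset.sum_Iio_add_eq_sum_Iic, ← Finset.sum_union
        (Finset.disjoint_left.2 fun l hl hl' =>
          (Finset.mem_Ioo.1 hl').1.not_ge (Finset.mem_Iic.1 hl))]
      refine Finset.sum_congr (Finset.ext fun l => ?_) fun _ _ => rfl
      simp only [Finset.mem_union, Finset.mem_Iio, Finset.mem_Iic, Finset.mem_Ioo]
      grind
    have below := derivation_add_sum_of_forall (s := Finset.Iio j) hω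
      fun l hl => hlt l (Finset.mem_Iio.1 hl)
    have above : D (∑ l ∈ Finset.Ioo j i, t l) = q * u * ∑ l ∈ Finset.Ioo j i, t l := by
      rw [map_sum, Finset.mul_sum]
      exact Finset.sum_congr rfl fun l hl => hgt l (Finset.mem_Ioo.1 hl).1
    rw [hsplit, ← add_assoc, ← add_assoc, map_add, map_add, below, above, hj]
    ring
  · exact derivation_add_sum_of_forall hω
      fun l hl => hlt l ((Finset.mem_Iio.1 hl).trans_le (not_lt.1 hji))

end Jacobi

section QuantumMatrices

variable {k : Type*} [Field k] {n : ℕ}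

/-- The bracket `{X s, X t}` on `O(M_n(k))` for `lam = h + h`, in a form which is antisymmetric in
`s` and `t`. -/
noncomputable def matrixValue (h : k) (p : Matrix (Fin n) (Fin n) k) (s t : Fin n × Fin n) :
    MatrixAlg k n :=
  C ((p s.1 t.1 + h * sgn s.1 t.1) + (-p s.2 t.2 - h * sgn s.2 t.2)) * X t * X s +
    C h * ((sgn s.1 t.1 + sgn s.2 t.2 : ℤ) : MatrixAlg k n) * X (t.1, s.2) * X (s.1, t.2)

theorem matrixValue_eq (h : k) (p : Matrix (Fin n) (Fin n) k) (l m i j : Fin n) :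
    matrixValue h p (l, m) (i, j) =
      C ((p l i + h * sgn l i) + (-p m j - h * sgn m j)) * X (i, j) * X (l, m) +
        C (h * ((sgn l i + sgn m j : ℤ) : k)) * X (i, m) * X (l, j) := by
  rw [C_mul, map_intCast]
  rfl

theorem isWeightedHomogeneous_matrixValue {r : ℕ} {a b : Fin n → Lex (Fin r → ℤ)} (h : k)
    (p : Matrix (Fin n) (Fin n) k) (s t : Fin n × Fin n) :
    IsWeightedHomogeneous (fun s => a s.1 + b s.2) (matrixValue h p s t)
      (a s.1 + b s.2 + (a t.1 + b t.2)) := by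
  rw [matrixValue_eq]
  exact (isWeightedHomogeneous_C_mul_X_mul_X _ (add_comm _ _)).add
    (isWeightedHomogeneous_C_mul_X_mul_X _ (by simp only; abel))

variable {p : Matrix (Fin n) (Fin n) k} (hp : ∀ i j, p j i = -p i j)

include hp

theorem matrixValue_antisymm (h : k) (s t : Fin n × Fin n) :
    matrixValue h p s t = -matrixValue h p t s := by
  obtain ⟨l, m⟩ := s
  obtain ⟨i, j⟩ := t
  rw [matrixValue_eq, matrixValue_eq, hp l i, hp m j, sgn_swap l i, sgn_swap m j]
  push_cast
  simp only [C_add, C_mul, C_neg, C_sub]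
  ring

theorem matrixValue_jacobi (h : k) (s t u : Fin n × Fin n) :
    mkDerivation k (matrixValue h p s) (matrixValue h p t u) +
      mkDerivation k (matrixValue h p t) (matrixValue h p u s) +
      mkDerivation k (matrixValue h p u) (matrixValue h p s t) = 0 := by
  have jacobi := jacobi_matrix (y := fun i j => (X (i, j) : MatrixAlg k n)) (h := h)
    (τ := fun i j => p i j + h * sgn i j) (τ' := fun i j => -p i j - h * sgn i j)
    (fun i j => by rw [hp i j, sgn_swap i j]; push_cast; ring)
    (fun i j => by rw [hp i j, sgn_swap i j]; push_cast; ring)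
    (D := fun l m => mkDerivation k (matrixValue h p (l, m))) (fun l m i j => mkDerivation_X _ _ _)
    s.1 s.2 t.1 t.2 u.1 u.2
  simpa only [mkDerivation_X] using jacobi

theorem matrixValue_gt_gt (h : k) {l m i j : Fin n} (hil : i < l) (hjm : j < m) :
    matrixValue h p (l, m) (i, j) =
      C (p l i + p j m) * X (i, j) * X (l, m) + C (h + h) * X (i, m) * X (l, j) := by
  rw [matrixValue_eq, sgn_of_gt hil, sgn_of_gt hjm, hp m j]
  simp only [Int.cast_add, Int.cast_one, C_add, C_mul, C_neg, C_sub, C_1]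
  ring

variable [CharZero k]

theorem matrixValue_gt_le (h : k) {l m i j : Fin n} (hil : i < l) (hmj : m ≤ j) :
    matrixValue h p (l, m) (i, j) = C (h + h + p l i + p j m) * X (i, j) * X (l, m) := by
  rw [matrixValue_eq, sgn_of_gt hil]
  rcases hmj.eq_or_lt with rfl | hmj
  · rw [sgn_self, self_eq_neg.1 (hp m m)]
    simp only [Int.cast_add, Int.cast_one, Int.cast_zero, C_add, C_mul, C_neg, C_sub, C_1, C_0]
    ring
  · rw [sgn_of_lt hmj, hp m j]
    simp only [Int.cast_add, Int.cast_one, Int.cast_neg, C_add, C_mul, C_neg, C_sub, C_1]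
    ring

theorem matrixValue_eq_gt (h : k) (l : Fin n) {m j : Fin n} (hjm : j < m) :
    matrixValue h p (l, m) (l, j) = C (p j m) * X (l, j) * X (l, m) := by
  rw [matrixValue_eq, sgn_self, sgn_of_gt hjm, self_eq_neg.1 (hp l l), hp m j]
  simp only [Int.cast_add, Int.cast_one, Int.cast_zero, C_add, C_mul, C_neg, C_sub, C_1, C_0]
  ring

theorem IsMatrixBracket.br_eq {h : k} {π : PoissonBracket k (MatrixAlg k n)}
    (hπ : IsMatrixBracket (h + h) p π) (s t : Fin n × Fin n) :
    π.br (X s) (X t) = matrixValue h p s t := by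
  have br_eq_of_lt (l m i j : Fin n) (hlt : toLex (i, j) < toLex (l, m)) :
      π.br (X (l, m)) (X (i, j)) = matrixValue h p (l, m) (i, j) := by
    rcases Prod.Lex.toLex_lt_toLex.1 hlt with hil | ⟨rfl, hjm⟩
    · rcases lt_or_ge j m with hjm | hmj
      · rw [hπ.gt_gt l m i j hil hjm, matrixValue_gt_gt hp h hil hjm]
      · rw [hπ.gt_le l m i j hil hmj, matrixValue_gt_le hp h hil hmj]
    · rw [hπ.eq_gt i m i j rfl hjm, matrixValue_eq_gt hp h i hjm]
  rcases lt_trichotomy (toLex s) (toLex t) with hst | hst | hst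
  · rw [π.antisymm, matrixValue_antisymm hp, br_eq_of_lt _ _ _ _ hst]
  · rw [toLex.injective hst, π.self_eq_zero, self_eq_neg.1 (matrixValue_antisymm hp h t t)]
  · exact br_eq_of_lt _ _ _ _ hst

theorem isMatrixBracket_iff (h : k) (π : PoissonBracket k (MatrixAlg k n)) :
    IsMatrixBracket (h + h) p π ↔ ∀ s t, π.br (X s) (X t) = matrixValue h p s t := by
  refine ⟨fun hπ => hπ.br_eq hp, fun hπ =>
    ⟨fun l m i j hil hjm => ?_, fun l m i j hil hmj => ?_, ?_⟩⟩
  · rw [hπ, matrixValue_gt_gt hp h hil hjm]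
  · rw [hπ, matrixValue_gt_le hp h hil hmj]
  · rintro l m i j rfl hjm
    rw [hπ, matrixValue_eq_gt hp h l hjm]

theorem isTorusPoissonTable_matrixValue {h : k} (hh : h ≠ 0) :
    IsTorusPoissonTable (matrixValue h p)
      (fun s => unitWeight (Fin.castAdd n s.1) + unitWeight (Fin.natAdd n s.2)) toLex
      (fun s => Fin.append (fun i => p s.1 i) fun j => p j s.2 + if s.2 ≤ j then h + h else 0) where
  antisymm := matrixValue_antisymm hp h
  jacobi := matrixValue_jacobi hp h
  isWeightedHomogeneous := isWeightedHomogeneous_matrixValue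
    (a := fun i => unitWeight (Fin.castAdd n i)) (b := fun j => unitWeight (Fin.natAdd n j)) h p
  injective := toLex.injective
  sub_mem := by
    rintro ⟨l, m⟩ ⟨i, j⟩ hlt
    simp only [map_add (lieWeight _), lieWeight_unitWeight, Fin.append_left, Fin.append_right]
    rcases Prod.Lex.toLex_lt_toLex.1 hlt with hil | ⟨rfl, hjm⟩
    · rcases lt_or_ge j m with hjm | hmj
      · rw [if_neg (not_le.2 hjm), add_zero, matrixValue_gt_gt hp h hil hjm,
          add_sub_cancel_left]
        exact C_mul_X_mul_X_mem_supported _ (Prod.Lex.toLex_lt_toLex.2 (Or.inl hil))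
          (Prod.Lex.toLex_lt_toLex.2 (Or.inr ⟨rfl, hjm⟩))
      · rw [if_pos hmj, matrixValue_gt_le hp h hil hmj, add_assoc, add_comm (h + h),
          add_assoc (p l i), sub_self]
        exact zero_mem _
    · rw [if_neg (not_le.2 hjm), matrixValue_eq_gt hp h i hjm, self_eq_neg.1 (hp i i),
        add_zero, zero_add, sub_self]
      exact zero_mem _
  ne_zero := by
    rintro ⟨l, m⟩
    simp only [map_add, lieWeight_unitWeight, Fin.append_left, Fin.append_right,
      self_eq_neg.1 (hp _ _), le_refl, if_true, zero_add]
    rwa [← two_mul, mul_ne_zero_iff_left two_ne_zero]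

end QuantumMatrices

section SymmetricFamilies

variable {k σ : Type*} [Field k] {n : ℕ}

theorem isWeightedHomogeneous_intCast_mul {M : Type*} [AddCommMonoid M] {w : σ → M}
    {φ : MvPolynomial σ k} {γ : M} (z : ℤ) (hφ : IsWeightedHomogeneous w φ γ) :
    IsWeightedHomogeneous w ((z : MvPolynomial σ k) * φ) γ := by
  rw [← map_intCast (C : k →+* MvPolynomial σ k)]
  exact hφ.C_mul _

/-- The variables of a polynomial algebra are indexed by the pairs `i ≤ j` (for `ε = 1`) or `i < j`
(for `ε = -1`), and extended to a family `y` of all entries of a symmetric or antisymmetric matrix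
by `y j i = ε * y i j`. -/
structure IsSymmetricFamily (ε : ℤ) (emb : σ → Fin n × Fin n)
    (y : Fin n → Fin n → MvPolynomial σ k) : Prop where
  sign : ε * ε = 1
  injective : Function.Injective emb
  le : ∀ s, (emb s).1 ≤ (emb s).2
  X_eq : ∀ s, X s = y (emb s).1 (emb s).2
  swap : ∀ i j, y j i = ε * y i j
  exists_or_eq_zero : ∀ i j, i ≤ j → (∃ s, emb s = (i, j)) ∨ (i = j ∧ y i j = 0 ∧ ε = -1)

/-- The bracket `{y i j, y l m}` for symmetric (`ε = 1`) and antisymmetric (`ε = -1`) matrices. -/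
noncomputable def symValue (ε : ℤ) (y : Fin n → Fin n → MvPolynomial σ k) (i j l m : Fin n) :
    MvPolynomial σ k :=
  ((sgn l j + sgn m i : ℤ) : MvPolynomial σ k) * y i l * y j m +
    ε * ((sgn l i + sgn m j : ℤ) : MvPolynomial σ k) * y i m * y j l

/-- The element of the Lie algebra of the torus which twists the step adding `y l m`. -/
def symTwist (k : Type*) [Field k] (l m i : Fin n) : k :=
  -(if i = l then 1 else 0) - if i = m then 1 else 0

theorem symValue_swap {ε : ℤ} (hε : ε * ε = 1) (y : Fin n → Fin n → MvPolynomial σ k)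
    (i j l m : Fin n) : symValue ε y i j m l = ε * symValue ε y i j l m := by
  rw [symValue, symValue]
  rcases mul_self_eq_one_iff.1 hε with rfl | rfl <;> push_cast <;> ring

namespace IsSymmetricFamily

variable {ε : ℤ} {emb : σ → Fin n × Fin n} {y : Fin n → Fin n → MvPolynomial σ k}
  (hy : IsSymmetricFamily ε emb y)

include hy

theorem symValue_antisymm (i j l m : Fin n) : symValue ε y i j l m = -symValue ε y l m i j := by
  rw [symValue, symValue, hy.swap i l, hy.swap j m, hy.swap i m, hy.swap j l, sgn_swap l j,
    sgn_swap m i, sgn_swap l i, sgn_swap m j]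
  rcases mul_self_eq_one_iff.1 hy.sign with rfl | rfl <;> push_cast <;> ring

theorem y_induction {p : Fin n → Fin n → Prop} (generator : ∀ s, p (emb s).1 (emb s).2)
    (diagonal : ∀ i, y i i = 0 → ε = -1 → p i i) (swap : ∀ i j, p i j → p j i) (i j : Fin n) :
    p i j := by
  have of_le (i j : Fin n) (hij : i ≤ j) : p i j := by
    rcases hy.exists_or_eq_zero i j hij with ⟨s, hs⟩ | ⟨rfl, hzero, hneg⟩
    · simpa only [hs] using generator s
    · exact diagonal i hzero hneg
  exact (le_total i j).elim (of_le i j) fun hji => swap j i (of_le j i hji)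

theorem mkDerivation_y (a b i j : Fin n) :
    mkDerivation k (fun t => symValue ε y a b (emb t).1 (emb t).2) (y i j) =
      symValue ε y a b i j := by
  induction i, j using hy.y_induction with
  | generator s => rw [← hy.X_eq, mkDerivation_X]
  | diagonal i hzero hneg =>
    rw [hzero, map_zero, symValue, hneg]
    push_cast
    ring
  | swap i j hij =>
    rw [hy.swap i j, symValue_swap hy.sign, Derivation.leibniz, Derivation.map_intCast, hij,
      smul_zero, add_zero, smul_eq_mul]

theorem symValue_jacobi (s t u : σ) :
    mkDerivation k (fun t => symValue ε y (emb s).1 (emb s).2 (emb t).1 (emb t).2)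
        (symValue ε y (emb t).1 (emb t).2 (emb u).1 (emb u).2) +
      mkDerivation k (fun u => symValue ε y (emb t).1 (emb t).2 (emb u).1 (emb u).2)
        (symValue ε y (emb u).1 (emb u).2 (emb s).1 (emb s).2) +
      mkDerivation k (fun s => symValue ε y (emb u).1 (emb u).2 (emb s).1 (emb s).2)
        (symValue ε y (emb s).1 (emb s).2 (emb t).1 (emb t).2) = 0 := by
  have jacobi := jacobi_symmetric hy.sign hy.swap hy.mkDerivation_y
    (emb s).1 (emb s).2 (emb t).1 (emb t).2 (emb u).1 (emb u).2
  simpa only [hy.mkDerivation_y] using jacobi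

theorem isWeightedHomogeneous_y {M : Type*} [AddCommMonoid M] (a : Fin n → M) (i j : Fin n) :
    IsWeightedHomogeneous (fun s => a (emb s).1 + a (emb s).2) (y i j) (a i + a j) := by
  induction i, j using hy.y_induction with
  | generator s =>
    rw [← hy.X_eq]
    exact isWeightedHomogeneous_X k _ s
  | diagonal i hzero =>
    rw [hzero]
    exact isWeightedHomogeneous_zero k _ _
  | swap i j hij =>
    rw [hy.swap i j, add_comm]
    exact isWeightedHomogeneous_intCast_mul ε hij

theorem isWeightedHomogeneous_symValue {M : Type*} [AddCommMonoid M] (a : Fin n → M)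
    (i j l m : Fin n) :
    IsWeightedHomogeneous (fun s => a (emb s).1 + a (emb s).2) (symValue ε y i j l m)
      (a i + a j + (a l + a m)) := by
  have homogeneous (i j l m : Fin n) (z : ℤ) :
      IsWeightedHomogeneous (fun s => a (emb s).1 + a (emb s).2)
        ((z : MvPolynomial σ k) * y i l * y j m) (a i + a j + (a l + a m)) := by
    rw [mul_assoc, add_add_add_comm]
    exact isWeightedHomogeneous_intCast_mul z
      ((hy.isWeightedHomogeneous_y a i l).mul (hy.isWeightedHomogeneous_y a j m))
  refine (homogeneous i j l m _).add ?_
  rw [← Int.cast_mul, add_comm (a l)]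
  exact homogeneous i j m l _

theorem y_mem_supported {i j l m : Fin n} (hij : i ≤ j) (hlt : toLex (i, j) < toLex (l, m)) :
    y i j ∈ supported k {u | toLex (emb u) < toLex (l, m)} := by
  rcases hy.exists_or_eq_zero i j hij with ⟨s, hs⟩ | ⟨-, hzero, -⟩
  · have hX := hy.X_eq s
    rw [hs] at hX
    rw [← hX]
    exact X_mem_supported.2 (show toLex (emb s) < toLex (l, m) by rwa [hs])
  · rw [hzero]
    exact zero_mem _

theorem y_swap_mem_supported {i j l m : Fin n} (hij : i ≤ j)
    (hlt : toLex (i, j) < toLex (l, m)) :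
    y j i ∈ supported k {u | toLex (emb u) < toLex (l, m)} := by
  rw [hy.swap i j]
  exact mul_mem (intCast_mem _ ε) (hy.y_mem_supported hij hlt)

theorem sgn_mul_y_mul_y_add_mem_supported {i l m : Fin n} (j : Fin n) (hlm : l ≤ m)
    (hil : i ≤ l) (him : i < m) :
    ((sgn i m + sgn j l : ℤ) : MvPolynomial σ k) * y l i * y m j +
        C (if j = l then 1 else 0) * y i j * y l m ∈
      supported k {u | toLex (emb u) < toLex (l, m)} := by
  have hy_il : y l i ∈ supported k {u | toLex (emb u) < toLex (l, m)} :=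
    hy.y_swap_mem_supported hil (Prod.Lex.toLex_lt_toLex.2 (by grind))
  rw [sgn_of_lt him]
  rcases lt_trichotomy j l with hjl | rfl | hlj
  · rw [if_neg hjl.ne, C_0, zero_mul, zero_mul, add_zero]
    exact mul_mem (mul_mem (intCast_mem _ _) hy_il) (hy.y_swap_mem_supported (hjl.le.trans hlm)
      (Prod.Lex.toLex_lt_toLex.2 (Or.inl hjl)))
  · have hcancel : y i j * y j m = y j i * y m j := by
      rw [hy.swap i j, hy.swap j m, mul_mul_mul_comm, ← Int.cast_mul, hy.sign, Int.cast_one,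
        one_mul]
    rw [sgn_self, if_pos rfl, C_1, one_mul, hcancel, add_zero, Int.cast_neg, Int.cast_one,
      neg_one_mul, neg_mul, neg_add_cancel]
    exact zero_mem _
  · rw [sgn_of_gt hlj, if_neg hlj.ne', C_0, neg_add_cancel, Int.cast_zero]
    simp only [zero_mul, add_zero]
    exact zero_mem _

theorem sign_mul_sgn_mul_y_mul_y_add_mem_supported {i l m : Fin n} (j : Fin n) (hil : i < l)
    (hlm : l ≤ m) :
    (ε : MvPolynomial σ k) * ((sgn i l + sgn j m : ℤ) : MvPolynomial σ k) * y l j * y m i +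
        C (if j = m then 1 else 0) * y i j * y l m ∈
      supported k {u | toLex (emb u) < toLex (l, m)} := by
  have hy_mi : y m i ∈ supported k {u | toLex (emb u) < toLex (l, m)} :=
    hy.y_swap_mem_supported (hil.le.trans hlm) (Prod.Lex.toLex_lt_toLex.2 (Or.inl hil))
  rw [sgn_of_lt hil]
  rcases lt_trichotomy j m with hjm | rfl | hmj
  · have hy_lj : y l j ∈ supported k {u | toLex (emb u) < toLex (l, m)} := by
      rcases lt_or_ge j l with hjl | hlj
      · exact hy.y_swap_mem_supported hjl.le (Prod.Lex.toLex_lt_toLex.2 (Or.inl hjl))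
      · exact hy.y_mem_supported hlj (Prod.Lex.toLex_lt_toLex.2 (Or.inr ⟨rfl, hjm⟩))
    rw [if_neg hjm.ne, C_0, zero_mul, zero_mul, add_zero, ← Int.cast_mul]
    exact mul_mem (mul_mem (intCast_mem _ _) hy_lj) hy_mi
  · rw [sgn_self, if_pos rfl, C_1, hy.swap j i]
    push_cast
    convert Subalgebra.zero_mem _ using 1
    ring
  · rw [sgn_of_gt hmj, if_neg hmj.ne', C_0, neg_add_cancel, Int.cast_zero]
    simp only [mul_zero, zero_mul, add_zero]
    exact zero_mem _

theorem symValue_sub_mem_supported {i j l m : Fin n} (hij : i ≤ j) (hlm : l ≤ m)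
    (hlt : toLex (i, j) < toLex (l, m)) :
    symValue ε y l m i j - C (symTwist k l m i + symTwist k l m j) * y i j * y l m ∈
      supported k {u | toLex (emb u) < toLex (l, m)} := by
  rcases Prod.Lex.toLex_lt_toLex.1 hlt with (hil : i < l) | ⟨rfl : i = l, hjm : j < m⟩
  · have him : i < m := hil.trans_le hlm
    convert add_mem (hy.sgn_mul_y_mul_y_add_mem_supported j hlm hil.le him)
      (hy.sign_mul_sgn_mul_y_mul_y_add_mem_supported j hil hlm) using 1
    rw [symValue, symTwist, symTwist, if_neg hil.ne, if_neg him.ne, neg_zero, sub_zero, zero_add]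
    simp only [C_sub, C_neg]
    ring
  · convert hy.sgn_mul_y_mul_y_add_mem_supported j hlm le_rfl (hij.trans_lt hjm) using 1
    rw [symValue, symTwist, symTwist, sgn_self, sgn_of_lt hjm, if_pos rfl,
      if_neg (hij.trans_lt hjm).ne, if_neg hjm.ne, hy.swap i m]
    rcases mul_self_eq_one_iff.1 hy.sign with rfl | rfl <;>
      simp only [C_add, C_sub, C_neg, C_0, C_1] <;> push_cast <;> ring

theorem isTorusPoissonTable [CharZero k] :
    IsTorusPoissonTable (fun s t => symValue ε y (emb s).1 (emb s).2 (emb t).1 (emb t).2)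
      (fun s => unitWeight (emb s).1 + unitWeight (emb s).2) (fun s => toLex (emb s))
      (fun s => symTwist k (emb s).1 (emb s).2) where
  antisymm s t := hy.symValue_antisymm _ _ _ _
  jacobi := hy.symValue_jacobi
  isWeightedHomogeneous s t := hy.isWeightedHomogeneous_symValue unitWeight _ _ _ _
  injective := toLex.injective.comp hy.injective
  sub_mem s t hts := by
    rw [map_add, lieWeight_unitWeight, lieWeight_unitWeight, hy.X_eq s, hy.X_eq t]
    exact hy.symValue_sub_mem_supported (hy.le t) (hy.le s) hts
  ne_zero s := by
    simp only [map_add, lieWeight_unitWeight, symTwist]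
    split_ifs <;> norm_num

end IsSymmetricFamily

theorem SymMatAlg.y_of_le {i j : Fin n} (h : i ≤ j) : SymMatAlg.y (k := k) i j = X ⟨(i, j), h⟩ :=
  dif_pos h

theorem isSymmetricFamily_symMatAlg :
    IsSymmetricFamily 1 Subtype.val (SymMatAlg.y (k := k) (n := n)) where
  sign := one_mul 1
  injective := Subtype.val_injective
  le s := s.2
  X_eq s := (SymMatAlg.y_of_le s.2).symm
  swap i j := by
    rw [Int.cast_one, one_mul]
    rcases lt_trichotomy i j with hij | rfl | hji
    · rw [SymMatAlg.y_of_le hij.le, SymMatAlg.y, dif_neg hij.not_ge]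
    · rfl
    · rw [SymMatAlg.y_of_le hji.le, SymMatAlg.y, dif_neg hji.not_ge]
  exists_or_eq_zero i j hij := Or.inl ⟨⟨(i, j), hij⟩, rfl⟩

theorem card_fin_le_pairs (n : ℕ) :
    Nat.card {s : Fin n × Fin n // s.1 ≤ s.2} = n * (n + 1) / 2 := by
  rw [Nat.card_eq_fintype_card, ← Fintype.card_congr (Sym2.sortEquiv (α := Fin n)), Sym2.card,
    Fintype.card_fin, Nat.choose_two_right, Nat.add_sub_cancel, mul_comm]

theorem isSymBracket_iff (π : PoissonBracket k (SymMatAlg k n)) :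
    IsSymBracket π ↔
      ∀ s t, π.br (X s) (X t) = symValue 1 SymMatAlg.y s.1.1 s.1.2 t.1.1 t.1.2 := by
  refine ⟨fun hπ s t => ?_, fun hπ i j l m hij hlm => ?_⟩
  · rw [isSymmetricFamily_symMatAlg.X_eq s, isSymmetricFamily_symMatAlg.X_eq t,
      hπ _ _ _ _ s.2 t.2, symValue, Int.cast_one, one_mul]
  · rw [SymMatAlg.y_of_le hij, SymMatAlg.y_of_le hlm, hπ, symValue, Int.cast_one, one_mul]

theorem AntisymMatAlg.y_of_lt {i j : Fin n} (h : i < j) :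
    AntisymMatAlg.y (k := k) i j = X ⟨(i, j), h⟩ :=
  dif_pos h

theorem AntisymMatAlg.y_of_gt {i j : Fin n} (h : j < i) :
    AntisymMatAlg.y (k := k) i j = -X ⟨(j, i), h⟩ := by
  rw [AntisymMatAlg.y, dif_neg h.not_gt, dif_pos h]

theorem AntisymMatAlg.y_self (i : Fin n) : AntisymMatAlg.y (k := k) i i = 0 := by
  rw [AntisymMatAlg.y, dif_neg (lt_irrefl i), dif_neg (lt_irrefl i)]

theorem isSymmetricFamily_antisymMatAlg :
    IsSymmetricFamily (-1) Subtype.val (AntisymMatAlg.y (k := k) (n := n)) where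
  sign := neg_one_mul (-1)
  injective := Subtype.val_injective
  le s := s.2.le
  X_eq s := (AntisymMatAlg.y_of_lt s.2).symm
  swap i j := by
    rw [Int.cast_neg, Int.cast_one, neg_one_mul]
    rcases lt_trichotomy i j with hij | rfl | hji
    · rw [AntisymMatAlg.y_of_lt hij, AntisymMatAlg.y_of_gt hij]
    · rw [AntisymMatAlg.y_self, neg_zero]
    · rw [AntisymMatAlg.y_of_lt hji, AntisymMatAlg.y_of_gt hji, neg_neg]
  exists_or_eq_zero i j hij := hij.eq_or_lt.elim
    (fun h => h ▸ Or.inr ⟨rfl, AntisymMatAlg.y_self i, rfl⟩) fun h => Or.inl ⟨⟨(i, j), h⟩, rfl⟩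

theorem card_fin_lt_pairs (n : ℕ) :
    Nat.card {s : Fin n × Fin n // s.1 < s.2} = n * (n - 1) / 2 := by
  rw [Nat.card_eq_fintype_card, Fintype.card_subtype, Fintype.card_product_filter_lt,
    Fintype.card_fin, Nat.choose_two_right]

theorem isAntisymBracket_iff (π : PoissonBracket k (AntisymMatAlg k n)) :
    IsAntisymBracket π ↔
      ∀ s t, π.br (X s) (X t) = symValue (-1) AntisymMatAlg.y s.1.1 s.1.2 t.1.1 t.1.2 := by
  have symValue_neg (i j l m : Fin n) : symValue (-1) (AntisymMatAlg.y (k := k)) i j l m =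
      ((sgn l j + sgn m i : ℤ) : AntisymMatAlg k n) * AntisymMatAlg.y i l * AntisymMatAlg.y j m -
      ((sgn l i + sgn m j : ℤ) : AntisymMatAlg k n) * AntisymMatAlg.y i m *
        AntisymMatAlg.y j l := by
    rw [symValue, Int.cast_neg, Int.cast_one]
    ring
  refine ⟨fun hπ s t => ?_, fun hπ i j l m hij hlm => ?_⟩
  · rw [isSymmetricFamily_antisymMatAlg.X_eq s, isSymmetricFamily_antisymMatAlg.X_eq t,
      hπ _ _ _ _ s.2 t.2, symValue_neg]
  · rw [AntisymMatAlg.y_of_lt hij, AntisymMatAlg.y_of_lt hlm, hπ, symValue_neg]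

end SymmetricFamilies

section PairBrackets

variable {k : Type*} [Field k] {n : ℕ}

/-- The coefficients of the logarithmic parts of the brackets of the variables `x i` (`Sum.inl i`)
and `y i` (`Sum.inr i`). -/
def pairCoeff (γ : Matrix (Fin n) (Fin n) k) (p q : Fin n → k) :
    Fin n ⊕ Fin n → Fin n ⊕ Fin n → k
  | Sum.inl i, Sum.inl j =>
    if i < j then q i - p j + γ i j else if j < i then -(q j - p i + γ j i) else 0
  | Sum.inl i, Sum.inr j => if i < j then p j + γ j i else q j + γ j i
  | Sum.inr i, Sum.inl j => -(if j < i then p i + γ i j else q i + γ i j)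
  | Sum.inr i, Sum.inr j => γ i j

/-- The coefficient by which a variable acts on the term `ω` common to all brackets
`{x i, y i}`. -/
def offsetCoeff (p : Fin n → k) : Fin n ⊕ Fin n → k :=
  Sum.elim p (-p)

variable {R : Type*} [CommRing R] [Algebra k R]

/-- The partial sums `ω + ∑ l < i, (q l - p l) * x l * y l`. -/
def pairSum (p q : Fin n → k) (v : Fin n ⊕ Fin n → R) (ω : R) (i : Fin n) : R :=
  ω + ∑ l ∈ Finset.Iio i, algebraMap k R (q l - p l) * v (Sum.inl l) * v (Sum.inr l)

/-- The non-logarithmic parts of the brackets of the variables `x i` and `y i`. -/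
def pairOffset (p q : Fin n → k) (v : Fin n ⊕ Fin n → R) (ω : R) :
    Fin n ⊕ Fin n → Fin n ⊕ Fin n → R
  | Sum.inl i, Sum.inr j => if i = j then pairSum p q v ω i else 0
  | Sum.inr i, Sum.inl j => -(if j = i then pairSum p q v ω j else 0)
  | _, _ => 0

/-- The brackets of the variables `x i` and `y i`, with an arbitrary term `ω` common to all brackets
`{x i, y i}`: the even-dimensional algebras have `ω = 0`, their odd-dimensional analogues
`ω = lam * z ^ 2`. -/
def pairValue (γ : Matrix (Fin n) (Fin n) k) (p q : Fin n → k) (v : Fin n ⊕ Fin n → R) (ω : R)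
    (s t : Fin n ⊕ Fin n) : R :=
  algebraMap k R (pairCoeff γ p q s t) * v s * v t + pairOffset p q v ω s t

theorem pairOffset_induction {P : Fin n ⊕ Fin n → Fin n ⊕ Fin n → R → Prop} (p q : Fin n → k)
    (v : Fin n ⊕ Fin n → R) (ω : R) (zero : ∀ s t, P s t 0)
    (x_y : ∀ i, P (Sum.inl i) (Sum.inr i) (pairSum p q v ω i))
    (y_x : ∀ i, P (Sum.inr i) (Sum.inl i) (-pairSum p q v ω i)) (s t : Fin n ⊕ Fin n) :
    P s t (pairOffset p q v ω s t) := by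
  rcases s with i | i <;> rcases t with j | j
  · exact zero _ _
  · rw [pairOffset]
    split_ifs with hij
    · exact hij ▸ x_y i
    · exact zero _ _
  · rw [pairOffset]
    split_ifs with hji
    · exact hji ▸ y_x j
    · rw [neg_zero]
      exact zero _ _
  · exact zero _ _

theorem pairOffset_antisymm (p q : Fin n → k) (v : Fin n ⊕ Fin n → R) (ω : R)
    (s t : Fin n ⊕ Fin n) : pairOffset p q v ω t s = -pairOffset p q v ω s t := by
  rcases s with i | i <;> rcases t with j | j
  · exact neg_zero.symm
  · rfl
  · exact (neg_neg _).symm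
  · exact neg_zero.symm

theorem pairCoeff_y_add_pairCoeff_y (γ : Matrix (Fin n) (Fin n) k) (p q : Fin n → k) {j i : Fin n}
    (hji : j ≠ i) :
    pairCoeff γ p q (Sum.inr j) (Sum.inl i) + pairCoeff γ p q (Sum.inr j) (Sum.inr i) =
      if j < i then -q j else -p j := by
  rcases hji.lt_or_gt with h | h
  · simp only [pairCoeff, if_pos h, if_neg h.not_gt]
    ring
  · simp only [pairCoeff, if_neg h.not_gt, if_pos h]
    ring

section Values

variable (γ : Matrix (Fin n) (Fin n) k) (p q : Fin n → k) (v : Fin n ⊕ Fin n → R) (ω : R)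

theorem pairValue_y_y (i j : Fin n) :
    pairValue γ p q v ω (Sum.inr i) (Sum.inr j) =
      algebraMap k R (γ i j) * v (Sum.inr i) * v (Sum.inr j) :=
  add_zero _

theorem pairValue_x_y_of_lt {i j : Fin n} (h : i < j) :
    pairValue γ p q v ω (Sum.inl i) (Sum.inr j) =
      algebraMap k R (p j + γ j i) * v (Sum.inl i) * v (Sum.inr j) := by
  simp only [pairValue, pairCoeff, pairOffset, if_pos h, if_neg h.ne, add_zero]

theorem pairValue_x_y_of_gt {i j : Fin n} (h : j < i) :
    pairValue γ p q v ω (Sum.inl i) (Sum.inr j) =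
      algebraMap k R (q j + γ j i) * v (Sum.inl i) * v (Sum.inr j) := by
  simp only [pairValue, pairCoeff, pairOffset, if_neg h.not_gt, if_neg h.ne', add_zero]

theorem pairValue_x_x_of_lt {i j : Fin n} (h : i < j) :
    pairValue γ p q v ω (Sum.inl i) (Sum.inl j) =
      algebraMap k R (q i - p j + γ i j) * v (Sum.inl i) * v (Sum.inl j) := by
  simp only [pairValue, pairCoeff, pairOffset, if_pos h, add_zero]

end Values

section Antisymmetric

variable {γ : Matrix (Fin n) (Fin n) k} (hγ : ∀ i j, γ j i = -γ i j) {p q : Fin n → k}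
  {v : Fin n ⊕ Fin n → R} {ω : R}

include hγ

theorem pairCoeff_antisymm (p q : Fin n → k) (s t : Fin n ⊕ Fin n) :
    pairCoeff γ p q t s = -pairCoeff γ p q s t := by
  rcases s with i | i <;> rcases t with j | j
  · rcases lt_trichotomy i j with hij | rfl | hji
    · simp only [pairCoeff, if_neg hij.not_gt, if_pos hij]
    · simp only [pairCoeff, lt_irrefl, if_false, neg_zero]
    · simp only [pairCoeff, if_neg hji.not_gt, if_pos hji, neg_neg]
  · rfl
  · exact (neg_neg _).symm
  · exact hγ i j

theorem pairValue_antisymm (p q : Fin n → k) (v : Fin n ⊕ Fin n → R) (ω : R)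
    (s t : Fin n ⊕ Fin n) : pairValue γ p q v ω s t = -pairValue γ p q v ω t s := by
  rw [pairValue, pairValue, pairCoeff_antisymm hγ p q t s, pairOffset_antisymm p q v ω t s,
    map_neg]
  ring

theorem pairCoeff_x_add_pairCoeff_y {j i : Fin n} (hji : j ≠ i) :
    pairCoeff γ p q (Sum.inl j) (Sum.inl i) + pairCoeff γ p q (Sum.inl j) (Sum.inr i) =
      if j < i then q j else p j := by
  rcases hji.lt_or_gt with h | h
  · simp only [pairCoeff, if_pos h, hγ i j]
    ring
  · simp only [pairCoeff, if_neg h.not_gt, if_pos h, hγ i j]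
    ring

variable [CharZero k]

theorem pairValue_x_y_self (p q : Fin n → k) (v : Fin n ⊕ Fin n → R) (ω : R) (i : Fin n) :
    pairValue γ p q v ω (Sum.inl i) (Sum.inr i) =
      algebraMap k R (q i) * v (Sum.inl i) * v (Sum.inr i) + pairSum p q v ω i := by
  simp only [pairValue, pairCoeff, pairOffset, lt_irrefl, if_false, if_true,
    self_eq_neg.1 (hγ i i), add_zero]

theorem pairValue_self (p q : Fin n → k) (v : Fin n ⊕ Fin n → R) (ω : R) (s : Fin n ⊕ Fin n) :
    pairValue γ p q v ω s s = 0 := by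
  rcases s with i | i
  · simp only [pairValue, pairCoeff, pairOffset, lt_irrefl, if_false, map_zero, zero_mul, add_zero]
  · rw [pairValue_y_y, self_eq_neg.1 (hγ i i), map_zero, zero_mul, zero_mul]

theorem br_eq_pairValue {π : PoissonBracket k R}
    (y_y : ∀ i j, π.br (v (Sum.inr i)) (v (Sum.inr j)) =
      algebraMap k R (γ i j) * v (Sum.inr i) * v (Sum.inr j))
    (x_y_lt : ∀ i j, i < j → π.br (v (Sum.inl i)) (v (Sum.inr j)) =
      algebraMap k R (p j + γ j i) * v (Sum.inl i) * v (Sum.inr j))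
    (x_y_gt : ∀ i j, j < i → π.br (v (Sum.inl i)) (v (Sum.inr j)) =
      algebraMap k R (q j + γ j i) * v (Sum.inl i) * v (Sum.inr j))
    (x_x : ∀ i j, i < j → π.br (v (Sum.inl i)) (v (Sum.inl j)) =
      algebraMap k R (q i - p j + γ i j) * v (Sum.inl i) * v (Sum.inl j))
    (x_y : ∀ i, π.br (v (Sum.inl i)) (v (Sum.inr i)) =
      algebraMap k R (q i) * v (Sum.inl i) * v (Sum.inr i) + pairSum p q v ω i)
    (s t : Fin n ⊕ Fin n) : π.br (v s) (v t) = pairValue γ p q v ω s t := by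
  have br_x_y (i j : Fin n) : π.br (v (Sum.inl i)) (v (Sum.inr j)) =
      pairValue γ p q v ω (Sum.inl i) (Sum.inr j) := by
    rcases lt_trichotomy i j with hij | rfl | hji
    · rw [x_y_lt i j hij, pairValue_x_y_of_lt _ _ _ _ _ hij]
    · rw [x_y, pairValue_x_y_self hγ]
    · rw [x_y_gt i j hji, pairValue_x_y_of_gt _ _ _ _ _ hji]
  rcases s with i | i <;> rcases t with j | j
  · rcases lt_trichotomy i j with hij | rfl | hji
    · rw [x_x i j hij, pairValue_x_x_of_lt _ _ _ _ _ hij]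
    · rw [π.self_eq_zero, pairValue_self hγ]
    · rw [π.antisymm, pairValue_antisymm hγ, x_x j i hji, pairValue_x_x_of_lt _ _ _ _ _ hji]
  · exact br_x_y i j
  · rw [π.antisymm, pairValue_antisymm hγ, br_x_y]
  · rw [y_y, pairValue_y_y]

end Antisymmetric

theorem derivation_algebraMap_mul_mul (D : Derivation k R R) (c : k) (a b : R) :
    D (algebraMap k R c * a * b) = algebraMap k R c * (a * D b + b * D a) := by
  rw [mul_assoc, Derivation.leibniz, Derivation.leibniz, Derivation.map_algebraMap, smul_zero,
    add_zero]
  rfl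

section Derivations

variable {γ : Matrix (Fin n) (Fin n) k} (hγ : ∀ i j, γ j i = -γ i j) {p q : Fin n → k}
  {v : Fin n ⊕ Fin n → R} {ω : R} [CharZero k] {D : Derivation k R R}

include hγ

theorem derivation_pairSum_of_x {j : Fin n}
    (hD : ∀ t, D (v t) = pairValue γ p q v ω (Sum.inl j) t)
    (hω : D ω = algebraMap k R (p j) * v (Sum.inl j) * ω) (i : Fin n) :
    D (pairSum p q v ω i) =
      algebraMap k R (if j < i then q j else p j) * v (Sum.inl j) * pairSum p q v ω i := by
  rw [apply_ite (algebraMap k R)]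
  refine derivation_add_sum_Iio hω (fun l hl => ?_) (fun l hl => ?_) ?_ i
  · rw [derivation_algebraMap_mul_mul, hD, hD, pairValue_x_y_of_gt _ _ _ _ _ hl,
      pairValue_antisymm hγ, pairValue_x_x_of_lt _ _ _ _ _ hl]
    simp only [map_add, map_sub]
    ring
  · rw [derivation_algebraMap_mul_mul, hD, hD, pairValue_x_y_of_lt _ _ _ _ _ hl,
      pairValue_x_x_of_lt _ _ _ _ _ hl, hγ j l]
    simp only [map_add, map_sub, map_neg]
    ring
  · rw [derivation_algebraMap_mul_mul, hD, hD, pairValue_x_y_self hγ, pairValue_self hγ, pairSum]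
    simp only [map_sub]
    ring

theorem derivation_pairSum_of_y {j : Fin n}
    (hD : ∀ t, D (v t) = pairValue γ p q v ω (Sum.inr j) t)
    (hω : D ω = algebraMap k R (-p j) * v (Sum.inr j) * ω) (i : Fin n) :
    D (pairSum p q v ω i) =
      algebraMap k R (if j < i then -q j else -p j) * v (Sum.inr j) * pairSum p q v ω i := by
  rw [apply_ite (algebraMap k R)]
  refine derivation_add_sum_Iio hω (fun l hl => ?_) (fun l hl => ?_) ?_ i
  · rw [derivation_algebraMap_mul_mul, hD, hD, pairValue_y_y, pairValue_antisymm hγ,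
      pairValue_x_y_of_lt _ _ _ _ _ hl]
    simp only [map_add, map_sub, map_neg]
    ring
  · rw [derivation_algebraMap_mul_mul, hD, hD, pairValue_y_y, pairValue_antisymm hγ,
      pairValue_x_y_of_gt _ _ _ _ _ hl]
    simp only [map_add, map_sub, map_neg]
    ring
  · rw [derivation_algebraMap_mul_mul, hD, hD, pairValue_antisymm hγ _ _ _ _ _ (Sum.inl j),
      pairValue_x_y_self hγ, pairValue_self hγ, pairSum]
    simp only [map_sub, map_neg]
    ring

theorem derivation_pairSum {s : Fin n ⊕ Fin n} (hD : ∀ t, D (v t) = pairValue γ p q v ω s t)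
    (hω : D ω = algebraMap k R (offsetCoeff p s) * v s * ω) {i : Fin n} (hx : s ≠ Sum.inl i)
    (hy : s ≠ Sum.inr i) :
    D (pairSum p q v ω i) =
      algebraMap k R (pairCoeff γ p q s (Sum.inl i) + pairCoeff γ p q s (Sum.inr i)) * v s *
        pairSum p q v ω i := by
  rcases s with j | j
  · rw [derivation_pairSum_of_x hγ hD hω,
      pairCoeff_x_add_pairCoeff_y hγ fun h : j = i => hx (congrArg Sum.inl h)]
  · rw [derivation_pairSum_of_y hγ hD hω,
      pairCoeff_y_add_pairCoeff_y γ p q fun h : j = i => hy (congrArg Sum.inr h)]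

theorem derivation_pairOffset {s t u : Fin n ⊕ Fin n}
    (hD : ∀ t, D (v t) = pairValue γ p q v ω s t)
    (hω : D ω = algebraMap k R (offsetCoeff p s) * v s * ω) (hst : s ≠ t) (hsu : s ≠ u) :
    D (pairOffset p q v ω t u) =
      algebraMap k R (pairCoeff γ p q s t + pairCoeff γ p q s u) * v s *
        pairOffset p q v ω t u := by
  revert hst hsu
  refine pairOffset_induction (P := fun t u f => s ≠ t → s ≠ u → D f =
    algebraMap k R (pairCoeff γ p q s t + pairCoeff γ p q s u) * v s * f) p q v ω
    (fun t u _ _ => ?_) (fun i hx hy => ?_) (fun i hy hx => ?_) t u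
  · rw [map_zero, mul_zero]
  · exact derivation_pairSum hγ hD hω hx hy
  · rw [map_neg, derivation_pairSum hγ hD hω hx hy,
      add_comm (pairCoeff γ p q s (Sum.inl i)), mul_neg]

end Derivations

section Weights

variable {σ M : Type*} [AddCommMonoid M] {w : σ → M} {v : Fin n ⊕ Fin n → MvPolynomial σ k}
  {ω : MvPolynomial σ k} {d : Fin n ⊕ Fin n → M} {δ : M}

theorem isWeightedHomogeneous_pairSum (p q : Fin n → k)
    (hv : ∀ t, IsWeightedHomogeneous w (v t) (d t))
    (hd : ∀ i, d (Sum.inl i) + d (Sum.inr i) = δ) (hω : IsWeightedHomogeneous w ω δ) (i : Fin n) :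
    IsWeightedHomogeneous w (pairSum p q v ω i) δ :=
  hω.add <| IsWeightedHomogeneous.sum _ _ _ fun l _ => by
    rw [mul_assoc, ← hd l]
    exact ((hv _).mul (hv _)).C_mul _

theorem isWeightedHomogeneous_pairOffset (p q : Fin n → k)
    (hv : ∀ t, IsWeightedHomogeneous w (v t) (d t))
    (hd : ∀ i, d (Sum.inl i) + d (Sum.inr i) = δ) (hω : IsWeightedHomogeneous w ω δ)
    (s t : Fin n ⊕ Fin n) : IsWeightedHomogeneous w (pairOffset p q v ω s t) (d s + d t) := by
  refine pairOffset_induction (P := fun s t f => IsWeightedHomogeneous w f (d s + d t)) p q v ω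
    (fun s t => isWeightedHomogeneous_zero k w _) (fun i => ?_) (fun i => ?_) s t
  · rw [hd]
    exact isWeightedHomogeneous_pairSum p q hv hd hω i
  · rw [add_comm, hd]
    exact (weightedHomogeneousSubmodule k w δ).neg_mem <|
      isWeightedHomogeneous_pairSum p q hv hd hω i

end Weights

/-- The order `y 0, x 0, y 1, x 1, …` in which the variables are adjoined; the rank `0` is left to
the additional variable of the odd-dimensional algebras. -/
def pairRank : Fin n ⊕ Fin n → ℕ :=
  Sum.elim (fun i => 2 * i.val + 2) (fun i => 2 * i.val + 1)

theorem pairRank_pos (s : Fin n ⊕ Fin n) : 0 < pairRank s := by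
  rcases s with i | i <;> exact Nat.succ_pos _

theorem pairRank_injective : Function.Injective (pairRank (n := n)) := by
  rintro (i | i) (j | j) h <;> simp only [pairRank, Sum.elim_inl, Sum.elim_inr] at h
  · rw [Fin.ext (by omega : i.val = j.val)]
  · omega
  · omega
  · rw [Fin.ext (by omega : i.val = j.val)]

theorem pairRank_x_lt_x {i j : Fin n} :
    pairRank (Sum.inl i) < pairRank (Sum.inl j) ↔ i < j := by
  simp only [pairRank, Sum.elim_inl, Fin.lt_def]
  omega

theorem pairRank_x_lt_y {i j : Fin n} :
    pairRank (Sum.inl i) < pairRank (Sum.inr j) ↔ i < j := by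
  simp only [pairRank, Sum.elim_inl, Sum.elim_inr, Fin.lt_def]
  omega

theorem pairRank_y_lt_x {i j : Fin n} :
    pairRank (Sum.inr i) < pairRank (Sum.inl j) ↔ i ≤ j := by
  simp only [pairRank, Sum.elim_inl, Sum.elim_inr, Fin.le_def]
  omega

theorem pairRank_y_lt_y {i j : Fin n} :
    pairRank (Sum.inr i) < pairRank (Sum.inr j) ↔ i < j := by
  simp only [pairRank, Sum.elim_inr, Fin.lt_def]
  omega

theorem pairOffset_mem (S : Subalgebra k R) {p q : Fin n → k} {v : Fin n ⊕ Fin n → R} {ω : R}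
    (hω : ω ∈ S) {s t : Fin n ⊕ Fin n} (hv : ∀ u, pairRank u < pairRank s → v u ∈ S)
    (hst : pairRank t < pairRank s) : pairOffset p q v ω s t ∈ S := by
  revert hv hst
  refine pairOffset_induction (P := fun s t f => (∀ u, pairRank u < pairRank s → v u ∈ S) →
    pairRank t < pairRank s → f ∈ S) p q v ω (fun _ _ _ _ => S.zero_mem) (fun i hv _ => ?_)
    (fun i _ h => (pairRank_x_lt_y.1 h).false.elim) s t
  refine S.add_mem hω (S.sum_mem fun l hl => ?_)
  have hl := Finset.mem_Iio.1 hl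
  exact S.mul_mem (S.mul_mem (S.algebraMap_mem _) (hv _ (pairRank_x_lt_x.2 hl)))
    (hv _ (pairRank_y_lt_x.2 hl.le))

section Lie

variable {γ : Matrix (Fin n) (Fin n) k} {p q : Fin n → k}

/-- The eigenvalues on the variables `x j` of the element of the Lie algebra of the torus attached
to the variable `s`: those prescribed by the brackets with the preceding variables, and a nonzero
one on `s` itself. -/
def pairLie (γ : Matrix (Fin n) (Fin n) k) (p q : Fin n → k) : Fin n ⊕ Fin n → Fin n → k
  | Sum.inl i, j => if j < i then pairCoeff γ p q (Sum.inl i) (Sum.inl j) else p i - q i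
  | Sum.inr i, j => if j < i then pairCoeff γ p q (Sum.inr i) (Sum.inl j) else -p i - 1

/-- The eigenvalues of that element on all variables: they have to add up to `offsetCoeff p s` on
each of the products `x j * y j`. -/
def pairLieWeight (γ : Matrix (Fin n) (Fin n) k) (p q : Fin n → k) (s : Fin n ⊕ Fin n) :
    Fin n ⊕ Fin n → k :=
  Sum.elim (pairLie γ p q s) fun j => offsetCoeff p s - pairLie γ p q s j

theorem pairLieWeight_eq [CharZero k] (hγ : ∀ i j, γ j i = -γ i j) {s t : Fin n ⊕ Fin n}
    (hst : pairRank t < pairRank s) : pairLieWeight γ p q s t = pairCoeff γ p q s t := by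
  rcases s with i | i <;> rcases t with j | j
  · exact if_pos (pairRank_x_lt_x.1 hst)
  · rcases (pairRank_y_lt_x.1 hst).eq_or_lt with rfl | h
    · simp only [pairLieWeight, pairLie, pairCoeff, offsetCoeff, Sum.elim_inl, Sum.elim_inr,
        lt_irrefl, if_false, self_eq_neg.1 (hγ j j)]
      ring
    · simp only [pairLieWeight, pairLie, pairCoeff, offsetCoeff, Sum.elim_inl, Sum.elim_inr,
        if_pos h, if_neg h.not_gt]
      ring
  · exact if_pos (pairRank_x_lt_y.1 hst)
  · simp only [pairLieWeight, pairLie, pairCoeff, offsetCoeff, Sum.elim_inr, Pi.neg_apply,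
      if_pos (pairRank_y_lt_y.1 hst)]
    ring

theorem pairLieWeight_self_ne_zero (hpq : ∀ i, p i ≠ q i) (s : Fin n ⊕ Fin n) :
    pairLieWeight γ p q s s ≠ 0 := by
  rcases s with i | i
  · simpa [pairLieWeight, pairLie] using sub_ne_zero.2 (hpq i)
  · simp [pairLieWeight, pairLie, offsetCoeff]

end Lie

end PairBrackets

section EvenDimensional

variable {k : Type*} [Field k] {n : ℕ} {γ : Matrix (Fin n) (Fin n) k} {p q : Fin n → k}

/-- The weights of the variables under the torus action on the even-dimensional algebras. -/
def evenWeight (n : ℕ) : Fin n ⊕ Fin n → Lex (Fin (n + 1) → ℤ) :=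
  Sum.elim (fun i => unitWeight i.castSucc)
    fun i => unitWeight 0 + unitWeight (Fin.last n) + -unitWeight i.castSucc

/-- The element of the Lie algebra of the torus attached to a variable of the even-dimensional
algebras, with eigenvalues `pairLieWeight`. -/
def evenLie [NeZero n] (γ : Matrix (Fin n) (Fin n) k) (p q : Fin n → k) (s : Fin n ⊕ Fin n) :
    Fin (n + 1) → k :=
  Fin.snoc (α := fun _ => k) (pairLie γ p q s) (offsetCoeff p s - pairLie γ p q s 0)

theorem lieWeight_evenLie [NeZero n] (γ : Matrix (Fin n) (Fin n) k) (p q : Fin n → k)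
    (s t : Fin n ⊕ Fin n) :
    lieWeight (evenLie γ p q s) (evenWeight n t) = pairLieWeight γ p q s t := by
  rcases t with j | j
  · simp only [evenWeight, evenLie, pairLieWeight, Sum.elim_inl, lieWeight_unitWeight,
      Fin.snoc_castSucc]
  · simp only [evenWeight, evenLie, pairLieWeight, Sum.elim_inr, map_add, map_neg,
      lieWeight_unitWeight, Fin.snoc_castSucc, Fin.snoc_last, ← Fin.castSucc_zero']
    ring

theorem torusCharacter_evenWeight (h : Fin (n + 1) → kˣ) (s : Fin n ⊕ Fin n) :
    torusCharacter k (evenWeight n s) h = Sum.elim (fun i : Fin n => h i.castSucc)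
      (fun i : Fin n => h 0 * h (Fin.last n) * (h i.castSucc)⁻¹) s := by
  rcases s with i | i
  · exact torusCharacter_unitWeight _ _
  · simp only [evenWeight, Sum.elim_inr, torusCharacter_add, torusCharacter_neg,
      MonoidHom.mul_apply, MonoidHom.inv_apply, torusCharacter_unitWeight]

variable [CharZero k] (hγ : ∀ i j, γ j i = -γ i j)

include hγ

theorem isEvenBracket_iff (π : PoissonBracket k (EvenAlg k n)) :
    IsEvenBracket γ p q π ↔ ∀ s t, π.br (X s) (X t) = pairValue γ p q X 0 s t := by
  constructor
  · intro hπ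
    refine br_eq_pairValue hγ hπ.y_y hπ.x_y_lt hπ.x_y_gt hπ.x_x fun i => ?_
    rw [pairSum, zero_add]
    exact hπ.x_y i
  · intro hπ
    exact
    { y_y := fun i j => (hπ _ _).trans (pairValue_y_y _ _ _ _ _ i j)
      x_y_lt := fun i j hij => (hπ _ _).trans (pairValue_x_y_of_lt _ _ _ _ _ hij)
      x_y_gt := fun i j hji => (hπ _ _).trans (pairValue_x_y_of_gt _ _ _ _ _ hji)
      x_x := fun i j hij => (hπ _ _).trans (pairValue_x_x_of_lt _ _ _ _ _ hij)
      x_y := fun i => by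
        refine (hπ _ _).trans ((pairValue_x_y_self hγ _ _ _ _ i).trans ?_)
        rw [pairSum, zero_add]
        rfl }

theorem isTorusPoissonTable_pairValue_zero [NeZero n] (hpq : ∀ i, p i ≠ q i) :
    IsTorusPoissonTable (pairValue γ p q (X : _ → EvenAlg k n) 0) (evenWeight n) pairRank
      (evenLie γ p q) where
  antisymm := pairValue_antisymm hγ p q _ _
  jacobi s t u := by
    have jacobi := jacobi_log (y := (X : _ → EvenAlg k n)) (a := pairCoeff γ p q)
      (o := pairOffset p q X 0) (D := fun s => mkDerivation k (pairValue γ p q X 0 s))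
      (pairCoeff_antisymm hγ p q) (pairOffset_antisymm p q X 0) (fun s t => mkDerivation_X _ _ _)
      (fun s => (mkDerivation_X _ _ _).trans (pairValue_self hγ _ _ _ _ s))
      (fun s t u => derivation_pairOffset hγ (fun t => mkDerivation_X _ _ _)
        ((map_zero _).trans (mul_zero _).symm)) s t u
    simpa only [mkDerivation_X] using jacobi
  isWeightedHomogeneous s t :=
    (isWeightedHomogeneous_C_mul_X_mul_X _ rfl).add <|
      isWeightedHomogeneous_pairOffset (δ := unitWeight 0 + unitWeight (Fin.last n)) p q
        (isWeightedHomogeneous_X k _)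
        (fun i => by simp only [evenWeight, Sum.elim_inl, Sum.elim_inr]; abel)
        (isWeightedHomogeneous_zero k _ _) s t
  injective := pairRank_injective
  sub_mem s t hts := by
    rw [lieWeight_evenLie, pairLieWeight_eq hγ hts]
    have offset_mem := pairOffset_mem (supported k {u | pairRank u < pairRank s}) (p := p) (q := q)
      (zero_mem _) (fun u hu => X_mem_supported.2 hu) hts
    convert offset_mem using 1
    rw [pairValue, algebraMap_eq]
    ring
  ne_zero s := by
    rw [lieWeight_evenLie]
    exact pairLieWeight_self_ne_zero hpq s

end EvenDimensional

section OddDimensional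

variable {k : Type*} [Field k] {n : ℕ} {γ : Matrix (Fin n) (Fin n) k} {p q : Fin n → k}

/-- The coefficients of the logarithmic parts of the brackets of the variables `z` (`none`), `x i`
and `y i`. -/
def oddCoeff (γ : Matrix (Fin n) (Fin n) k) (p q : Fin n → k) :
    Option (Fin n ⊕ Fin n) → Option (Fin n ⊕ Fin n) → k
  | none, none => 0
  | none, some t => -(offsetCoeff p t / 2)
  | some s, none => offsetCoeff p s / 2
  | some s, some t => pairCoeff γ p q s t

/-- The non-logarithmic parts of the brackets of the variables `z`, `x i` and `y i`. -/
noncomputable def oddOffset (p q : Fin n → k) (lam : k) :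
    Option (Fin n ⊕ Fin n) → Option (Fin n ⊕ Fin n) → OddAlg k n
  | some s, some t => pairOffset p q (fun s => X (some s)) (C lam * X none ^ 2) s t
  | _, _ => 0

/-- The brackets of the variables `z`, `x i` and `y i`. -/
noncomputable def oddValue (γ : Matrix (Fin n) (Fin n) k) (p q : Fin n → k) (lam : k)
    (s t : Option (Fin n ⊕ Fin n)) : OddAlg k n :=
  C (oddCoeff γ p q s t) * X s * X t + oddOffset p q lam s t

/-- The weights of the variables under the torus action on the odd-dimensional algebras. -/
def oddWeight (n : ℕ) : Option (Fin n ⊕ Fin n) → Lex (Fin (n + 1) → ℤ)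
  | none => unitWeight (Fin.last n)
  | some (Sum.inl i) => unitWeight i.castSucc
  | some (Sum.inr i) =>
    unitWeight (Fin.last n) + unitWeight (Fin.last n) + -unitWeight i.castSucc

/-- The order `z, y 0, x 0, y 1, x 1, …` in which the variables are adjoined. -/
def oddRank (s : Option (Fin n ⊕ Fin n)) : ℕ :=
  s.elim 0 pairRank

/-- The element of the Lie algebra of the torus attached to a variable of the odd-dimensional
algebras; on `x i` and `y i` it has the eigenvalues `pairLieWeight`. -/
def oddLie (γ : Matrix (Fin n) (Fin n) k) (p q : Fin n → k) :
    Option (Fin n ⊕ Fin n) → Fin (n + 1) → k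
  | none => 1
  | some s => Fin.snoc (α := fun _ => k) (pairLie γ p q s) (offsetCoeff p s / 2)

theorem oddOffset_antisymm (p q : Fin n → k) (lam : k) (s t : Option (Fin n ⊕ Fin n)) :
    oddOffset p q lam t s = -oddOffset p q lam s t := by
  rcases s with _ | s <;> rcases t with _ | t
  · exact neg_zero.symm
  · exact neg_zero.symm
  · exact neg_zero.symm
  · exact pairOffset_antisymm p q _ _ s t

theorem oddValue_z_y (γ : Matrix (Fin n) (Fin n) k) (p q : Fin n → k) (lam : k) (i : Fin n) :
    oddValue γ p q lam none (some (Sum.inr i)) = C (p i / 2) * OddAlg.z * OddAlg.y i := by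
  simp only [oddValue, oddCoeff, oddOffset, offsetCoeff, Sum.elim_inr, Pi.neg_apply, neg_div,
    neg_neg, add_zero]
  rfl

theorem oddRank_injective : Function.Injective (oddRank (n := n)) := by
  rintro (_ | s) (_ | t) h
  · rfl
  · exact absurd h (pairRank_pos t).ne
  · exact absurd h (pairRank_pos s).ne'
  · exact congrArg some (pairRank_injective h)

theorem oddOffset_mem_supported (p q : Fin n → k) (lam : k) {s t : Option (Fin n ⊕ Fin n)}
    (hts : oddRank t < oddRank s) :
    oddOffset p q lam s t ∈ supported k {u | oddRank u < oddRank s} := by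
  rcases s with _ | s
  · exact zero_mem _
  rcases t with _ | t
  · exact zero_mem _
  have z_mem : (X none : OddAlg k n) ∈ supported k {u | oddRank u < oddRank (some s)} :=
    X_mem_supported.2 (pairRank_pos s)
  exact pairOffset_mem _ (mul_mem (Subalgebra.algebraMap_mem _ lam) (pow_mem z_mem 2))
    (fun u hu => X_mem_supported.2 hu) hts

theorem isWeightedHomogeneous_oddOffset (p q : Fin n → k) (lam : k)
    (s t : Option (Fin n ⊕ Fin n)) :
    IsWeightedHomogeneous (oddWeight n) (oddOffset p q lam s t)
      (oddWeight n s + oddWeight n t) := by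
  rcases s with _ | s
  · exact isWeightedHomogeneous_zero k _ _
  rcases t with _ | t
  · exact isWeightedHomogeneous_zero k _ _
  refine isWeightedHomogeneous_pairOffset (d := fun s => oddWeight n (some s))
    (δ := unitWeight (Fin.last n) + unitWeight (Fin.last n)) p q
    (fun t => isWeightedHomogeneous_X k _ (some t))
    (fun i => by simp only [oddWeight]; abel) ?_ s t
  rw [sq, ← mul_assoc]
  exact isWeightedHomogeneous_C_mul_X_mul_X lam rfl

theorem torusCharacter_oddWeight (h : Fin (n + 1) → kˣ) (s : Option (Fin n ⊕ Fin n)) :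
    torusCharacter k (oddWeight n s) h = s.elim (h (Fin.last n))
      (Sum.elim (fun i : Fin n => h i.castSucc)
        fun i : Fin n => h (Fin.last n) ^ 2 * (h i.castSucc)⁻¹) := by
  rcases s with _ | i | i
  · exact torusCharacter_unitWeight _ _
  · exact torusCharacter_unitWeight _ _
  · simp only [oddWeight, Option.elim_some, Sum.elim_inr, torusCharacter_add, torusCharacter_neg,
      MonoidHom.mul_apply, MonoidHom.inv_apply, torusCharacter_unitWeight, sq]

variable (hγ : ∀ i j, γ j i = -γ i j)

section Antisymmetric

include hγ

theorem oddCoeff_antisymm (p q : Fin n → k) (s t : Option (Fin n ⊕ Fin n)) :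
    oddCoeff γ p q t s = -oddCoeff γ p q s t := by
  rcases s with _ | s <;> rcases t with _ | t
  · exact neg_zero.symm
  · exact (neg_neg _).symm
  · rfl
  · exact pairCoeff_antisymm hγ p q s t

theorem oddValue_antisymm (p q : Fin n → k) (lam : k) (s t : Option (Fin n ⊕ Fin n)) :
    oddValue γ p q lam s t = -oddValue γ p q lam t s := by
  rw [oddValue, oddValue, oddCoeff_antisymm hγ p q t s, oddOffset_antisymm p q lam t s, C_neg]
  ring

end Antisymmetric

variable [CharZero k]

theorem lieWeight_oddLie_some (γ : Matrix (Fin n) (Fin n) k) (p q : Fin n → k)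
    (s t : Fin n ⊕ Fin n) :
    lieWeight (oddLie γ p q (some s)) (oddWeight n (some t)) = pairLieWeight γ p q s t := by
  rcases t with j | j
  · simp only [oddLie, oddWeight, pairLieWeight, Sum.elim_inl, lieWeight_unitWeight,
      Fin.snoc_castSucc]
  · simp only [oddLie, oddWeight, pairLieWeight, Sum.elim_inr, map_add, map_neg,
      lieWeight_unitWeight, Fin.snoc_castSucc, Fin.snoc_last]
    ring

theorem lieWeight_oddLie_self_ne_zero (hpq : ∀ i, p i ≠ q i) (s : Option (Fin n ⊕ Fin n)) :
    lieWeight (oddLie γ p q s) (oddWeight n s) ≠ 0 := by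
  rcases s with _ | s
  · rw [oddLie, oddWeight, lieWeight_unitWeight]
    exact one_ne_zero
  · rw [lieWeight_oddLie_some]
    exact pairLieWeight_self_ne_zero hpq s

include hγ

theorem lieWeight_oddLie_eq {s t : Option (Fin n ⊕ Fin n)} (hts : oddRank t < oddRank s) :
    lieWeight (oddLie γ p q s) (oddWeight n t) = oddCoeff γ p q s t := by
  rcases s with _ | s
  · exact absurd hts (Nat.not_lt_zero _)
  rcases t with _ | t
  · simp only [oddLie, oddWeight, oddCoeff, lieWeight_unitWeight, Fin.snoc_last]
  · rw [lieWeight_oddLie_some]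
    exact pairLieWeight_eq hγ hts

theorem oddValue_self (p q : Fin n → k) (lam : k) (s : Option (Fin n ⊕ Fin n)) :
    oddValue γ p q lam s s = 0 :=
  self_eq_neg.1 (oddValue_antisymm hγ p q lam s s)

theorem isOddBracket_iff {lam : k} (π : PoissonBracket k (OddAlg k n)) :
    IsOddBracket γ p q lam π ↔ ∀ s t, π.br (X s) (X t) = oddValue γ p q lam s t := by
  let v : Fin n ⊕ Fin n → OddAlg k n := fun s => X (some s)
  let ω : OddAlg k n := C lam * X none ^ 2
  have x_y_eq (i : Fin n) :
      C (q i) * v (Sum.inl i) * v (Sum.inr i) + pairSum p q v ω i =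
      C (q i) * OddAlg.x i * OddAlg.y i +
        (∑ l ∈ Finset.Iio i, C (q l - p l) * OddAlg.x l * OddAlg.y l) + C lam * OddAlg.z ^ 2 := by
    rw [pairSum, add_comm ω, ← add_assoc]
    rfl
  constructor
  · intro hπ
    have br_pair := br_eq_pairValue (v := v) (ω := ω) hγ hπ.y_y hπ.x_y_lt hπ.x_y_gt hπ.x_x
      fun i => (hπ.x_y i).trans (x_y_eq i).symm
    have br_z : ∀ t, π.br (X none) (X (some t)) = oddValue γ p q lam none (some t)
      | Sum.inl i => (hπ.z_x i).trans (add_zero _).symm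
      | Sum.inr i => (hπ.z_y i).trans (oddValue_z_y γ p q lam i).symm
    rintro (_ | s) (_ | t)
    · rw [π.self_eq_zero, oddValue_self hγ]
    · exact br_z t
    · rw [π.antisymm, oddValue_antisymm hγ, br_z]
    · exact br_pair s t
  · intro hπ
    have br_pair (s t) : π.br (v s) (v t) = pairValue γ p q v ω s t := hπ (some s) (some t)
    exact
    { z_x := fun i => (hπ _ _).trans (add_zero _)
      z_y := fun i => (hπ _ _).trans (oddValue_z_y γ p q lam i)
      y_y := fun i j => (br_pair _ _).trans (pairValue_y_y γ p q v ω i j)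
      x_y_lt := fun i j hij => (br_pair _ _).trans (pairValue_x_y_of_lt γ p q v ω hij)
      x_y_gt := fun i j hji => (br_pair _ _).trans (pairValue_x_y_of_gt γ p q v ω hji)
      x_x := fun i j hij => (br_pair _ _).trans (pairValue_x_x_of_lt γ p q v ω hij)
      x_y := fun i => by
        rw [← x_y_eq]
        exact (br_pair _ _).trans (pairValue_x_y_self hγ p q v ω i) }

end OddDimensional

section OddJacobi

variable {k : Type*} [Field k] {n : ℕ} {γ : Matrix (Fin n) (Fin n) k} {p q : Fin n → k} {lam : k}
  {D : Derivation k (OddAlg k n) (OddAlg k n)}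

theorem derivation_C_mul_z_sq {s : Option (Fin n ⊕ Fin n)}
    (hD : ∀ t, D (X t) = oddValue γ p q lam s t) :
    D (C lam * X none ^ 2) = C (oddCoeff γ p q s none + oddCoeff γ p q s none) * X s *
      (C lam * X none ^ 2) := by
  have hz : D (X none) = C (oddCoeff γ p q s none) * X s * X none := by
    rw [hD, oddValue]
    rcases s with _ | s <;> exact add_zero _
  rw [sq, ← mul_assoc, ← algebraMap_eq, derivation_algebraMap_mul_mul, hz, map_add, algebraMap_eq]
  ring

theorem derivation_pairSum_of_z (hD : ∀ t, D (X t) = oddValue γ p q lam none t) (i : Fin n) :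
    D (pairSum p q (fun s => X (some s)) (C lam * X none ^ 2) i) = 0 := by
  rw [pairSum, map_add, derivation_C_mul_z_sq hD, map_sum, Finset.sum_eq_zero fun l _ => ?_]
  · simp only [oddCoeff, add_zero, map_zero, zero_mul]
  · rw [derivation_algebraMap_mul_mul, hD, hD]
    simp only [oddValue, oddCoeff, oddOffset, offsetCoeff, Sum.elim_inl, Sum.elim_inr,
      Pi.neg_apply, neg_div, neg_neg, C_neg]
    ring

variable [CharZero k] (hγ : ∀ i j, γ j i = -γ i j)

include hγ

theorem derivation_oddOffset {s t u : Option (Fin n ⊕ Fin n)}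
    (hD : ∀ t, D (X t) = oddValue γ p q lam s t) (hst : s ≠ t) (hsu : s ≠ u) :
    D (oddOffset p q lam t u) =
      C (oddCoeff γ p q s t + oddCoeff γ p q s u) * X s * oddOffset p q lam t u := by
  rcases t with _ | t
  · simp only [oddOffset, map_zero, mul_zero]
  rcases u with _ | u
  · simp only [oddOffset, map_zero, mul_zero]
  rcases s with _ | s
  · refine pairOffset_induction (P := fun t u f => D f =
      C (oddCoeff γ p q none (some t) + oddCoeff γ p q none (some u)) * X none * f) p q _ _
      (fun t u => ?_) (fun i => ?_) (fun i => ?_) t u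
    · rw [map_zero, mul_zero]
    · rw [derivation_pairSum_of_z hD]
      simp only [oddCoeff, offsetCoeff, Sum.elim_inl, Sum.elim_inr, Pi.neg_apply, neg_div, neg_neg,
        neg_add_cancel, map_zero, zero_mul]
    · rw [map_neg, derivation_pairSum_of_z hD]
      simp only [oddCoeff, offsetCoeff, Sum.elim_inl, Sum.elim_inr, Pi.neg_apply, neg_div, neg_neg,
        add_neg_cancel, map_zero, zero_mul, neg_zero]
  · refine derivation_pairOffset (v := fun s => X (some s)) hγ (fun t => hD (some t)) ?_
      (fun h => hst (congrArg some h)) (fun h => hsu (congrArg some h))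
    rw [derivation_C_mul_z_sq hD, oddCoeff, add_halves]
    rfl

theorem isTorusPoissonTable_oddValue (hpq : ∀ i, p i ≠ q i) :
    IsTorusPoissonTable (oddValue γ p q lam) (oddWeight n) oddRank (oddLie γ p q) where
  antisymm := oddValue_antisymm hγ p q lam
  jacobi s t u := by
    have jacobi := jacobi_log (y := (X : _ → OddAlg k n)) (a := oddCoeff γ p q)
      (o := oddOffset p q lam) (D := fun s => mkDerivation k (oddValue γ p q lam s))
      (oddCoeff_antisymm hγ p q) (oddOffset_antisymm p q lam) (fun s t => mkDerivation_X _ _ _)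
      (fun s => (mkDerivation_X _ _ _).trans (oddValue_self hγ p q lam s))
      (fun s t u => derivation_oddOffset hγ fun t => mkDerivation_X _ _ _) s t u
    simpa only [mkDerivation_X] using jacobi
  isWeightedHomogeneous s t :=
    (isWeightedHomogeneous_C_mul_X_mul_X _ rfl).add (isWeightedHomogeneous_oddOffset p q lam s t)
  injective := oddRank_injective
  sub_mem s t hts := by
    rw [lieWeight_oddLie_eq hγ hts]
    convert oddOffset_mem_supported p q lam hts using 1
    rw [oddValue]
    ring
  ne_zero := lieWeight_oddLie_self_ne_zero hpq

end OddJacobi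

end PoissonDME

theorem mainTheorem5 {k : Type*} [Field k] [CharZero k] (n : ℕ) (hn : 1 ≤ n) :
    -- quantum matrices
    (∀ (lam : k) (p : Matrix (Fin n) (Fin n) k), lam ≠ 0 → (∀ i j, p j i = -p i j) →
      (∃! π, PoissonDME.IsMatrixBracket lam p π) ∧
      ∀ π, PoissonDME.IsMatrixBracket lam p π →
        PoissonDME.IsRationalPoissonAction π (PoissonDME.matrixAction k n) ∧
        (PoissonDME.stablePoissonPrimes π (PoissonDME.matrixAction k n)).Finite ∧
        (PoissonDME.stablePoissonPrimes π (PoissonDME.matrixAction k n)).ncard ≤ 2 ^ (n ^ 2) ∧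
        PoissonDME.PoissonDixmierMoeglin π) ∧
    -- the algebras `A^{P,Q}_{n,Γ}`
    (∀ (γ : Matrix (Fin n) (Fin n) k) (p q : Fin n → k),
      (∀ i j, γ j i = -γ i j) → (∀ i, p i ≠ q i) →
      (∃! π, PoissonDME.IsEvenBracket γ p q π) ∧
      ∀ π, PoissonDME.IsEvenBracket γ p q π →
        PoissonDME.IsRationalPoissonAction π (PoissonDME.evenAction k n) ∧
        (PoissonDME.stablePoissonPrimes π (PoissonDME.evenAction k n)).Finite ∧
        (PoissonDME.stablePoissonPrimes π (PoissonDME.evenAction k n)).ncard ≤ 2 ^ (2 * n) ∧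
        PoissonDME.PoissonDixmierMoeglin π) ∧
    -- odd-dimensional analogues
    (∀ (γ : Matrix (Fin n) (Fin n) k) (p q : Fin n → k) (lam : k),
      (∀ i j, γ j i = -γ i j) → (∀ i, p i ≠ q i) →
      (∃! π, PoissonDME.IsOddBracket γ p q lam π) ∧
      ∀ π, PoissonDME.IsOddBracket γ p q lam π →
        PoissonDME.IsRationalPoissonAction π (PoissonDME.oddAction k n) ∧
        (PoissonDME.stablePoissonPrimes π (PoissonDME.oddAction k n)).Finite ∧
        (PoissonDME.stablePoissonPrimes π (PoissonDME.oddAction k n)).ncard ≤ 2 ^ (2 * n + 1) ∧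
        PoissonDME.PoissonDixmierMoeglin π) ∧
    -- quantum symmetric matrices
    ((∃! π : PoissonDME.PoissonBracket k (PoissonDME.SymMatAlg k n), PoissonDME.IsSymBracket π) ∧
      ∀ π : PoissonDME.PoissonBracket k (PoissonDME.SymMatAlg k n), PoissonDME.IsSymBracket π →
        PoissonDME.IsRationalPoissonAction π (PoissonDME.symAction k n) ∧
        (PoissonDME.stablePoissonPrimes π (PoissonDME.symAction k n)).Finite ∧
        (PoissonDME.stablePoissonPrimes π (PoissonDME.symAction k n)).ncard
          ≤ 2 ^ (n * (n + 1) / 2) ∧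
        PoissonDME.PoissonDixmierMoeglin π) ∧
    -- quantum antisymmetric matrices
    ((∃! π : PoissonDME.PoissonBracket k (PoissonDME.AntisymMatAlg k n),
        PoissonDME.IsAntisymBracket π) ∧
      ∀ π : PoissonDME.PoissonBracket k (PoissonDME.AntisymMatAlg k n),
        PoissonDME.IsAntisymBracket π →
        PoissonDME.IsRationalPoissonAction π (PoissonDME.antisymAction k n) ∧
        (PoissonDME.stablePoissonPrimes π (PoissonDME.antisymAction k n)).Finite ∧
        (PoissonDME.stablePoissonPrimes π (PoissonDME.antisymAction k n)).ncard
          ≤ 2 ^ (n * (n - 1) / 2) ∧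
        PoissonDME.PoissonDixmierMoeglin π) := by
  refine ⟨fun lam p hlam hp => ?_, fun γ p q hγ hpq => ?_, fun γ p q lam hγ hpq => ?_, ?_, ?_⟩
  · obtain ⟨h, rfl⟩ : ∃ h, lam = h + h := ⟨lam / 2, (add_halves lam).symm⟩
    have hh : h ≠ 0 := fun h_zero => hlam (by rw [h_zero, add_zero])
    exact (PoissonDME.isTorusPoissonTable_matrixValue hp hh).existsUnique_and_poissonDixmierMoeglin
      (PoissonDME.isMatrixBracket_iff hp h)
      (fun _ _ => (PoissonDME.torusCharacter_unitWeight_add_unitWeight _ _ _).symm) (by simp [sq])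
  · have : NeZero n := ⟨Nat.one_le_iff_ne_zero.1 hn⟩
    exact (PoissonDME.isTorusPoissonTable_pairValue_zero hγ
      hpq).existsUnique_and_poissonDixmierMoeglin (PoissonDME.isEvenBracket_iff hγ)
      (fun h s => (PoissonDME.torusCharacter_evenWeight h s).symm) (by simp [two_mul])
  · exact (PoissonDME.isTorusPoissonTable_oddValue hγ hpq).existsUnique_and_poissonDixmierMoeglin
      (PoissonDME.isOddBracket_iff hγ)
      (fun h s => (PoissonDME.torusCharacter_oddWeight h s).symm) (by simp [two_mul])
  · exact PoissonDME.isSymmetricFamily_symMatAlg.isTorusPoissonTable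
      |>.existsUnique_and_poissonDixmierMoeglin PoissonDME.isSymBracket_iff
      (fun _ _ => (PoissonDME.torusCharacter_unitWeight_add_unitWeight _ _ _).symm)
      (PoissonDME.card_fin_le_pairs n)
  · exact PoissonDME.isSymmetricFamily_antisymMatAlg.isTorusPoissonTable
      |>.existsUnique_and_poissonDixmierMoeglin PoissonDME.isAntisymBracket_iff
      (fun _ _ => (PoissonDME.torusCharacter_unitWeight_add_unitWeight _ _ _).symm)
      (PoissonDME.card_fin_lt_pairs n)
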